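/- **Theorem (Dynamics of singularities in $\mathbb{R}^n$).** Let $n\ge 2$, let $I\subset\mathbb{R}$ be an open interval, and let $\Omega_t\subset\mathbb{R}^n$ $(t\in I)$ be a one-parameter family of domains whose boundaries $\Gamma_t=\partial\Omega_t$ are nonsingular real-analytic hypersurfaces with analytic time dependence; that is, near every boundary point of the space-time region $\{(t,x): t\in I,\ x\in\Omega_t\}$ over $I$, this region is $\{\varphi<0\}$ for a real-analytic function $\varphi(x,t)$ with $\nabla_x\varphi\ne0$ at that point. Let $w(x,t)$ be the Schwarz potential of $\Gamma_t$, i.e. the solution near $\Gamma_t$ (of class $C^2$ in $(x,t)$ near the moving boundary) of the Cauchy problem $$\Delta w=0\ \text{near }\Gamma_t,\qquad w|_{\Gamma_t}=\tfrac12\|x\|^2,\qquad \nabla w|_{\Gamma_t}=x .$$ Let $Q\neq0$, let $x_0\in\Omega_t$ for all $t\in I$, let $K$ be the fundamental solution of the Laplace equation normalized by $-\Delta K=\delta_0$, and let $P(\cdot,t)$ be the pressure, i.e. the Green's function of $\Omega_t$: $P$ is harmonic in $\Omega_t\setminus\{x_0\}$, $P=0$ on $\Gamma_t$, $P(x,t)\sim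 -Q\,K(x-x_0)$ as $x\to x_0$ (and, if $\Omega_t$ is unbounded, $P(x,t)=O(\|x\|^{2-n})$ as $x\to\infty$ in $\Omega_t$). (1) $\Omega_t$ solves the Laplacian growth problem with sink $x_0$ and rate $Q$, that is, the normal velocity (vector) of $\Gamma_t$ is $v_n=-\nabla P|_{\Gamma_t}$, if and only if $$\frac{\partial w}{\partial t}(x,t)=-n\,P(x,t)$$ for $(x,t)$ with $x\in\overline{\Omega_t}$ near the moving boundary. (2) In particular, for a Laplacian growth whose boundaries $\Gamma_t$ are bounded, locally uniformly in $t$, the singularities of $w$ in the oil domain do not move, except for the one at the sink, which changes strength: let $s,t\in I$, and let $S$ be a closed set with $S\subset\Omega_\tau$ for all $\tau$ between $s$ and $t$. If $w(\cdot,s)$ continues harmonically from $\Gamma_s$ to a function $F$ on $\Omega_s\setminus(S\cup\{x_0\})$, then $w(\cdot,t)$ continues harmonically from $\Gamma_t$ to a function $G$ on $\Omega_t\setminus(S\cup\{x_0\})$ such that $$G(x)=F(x)+nQ(t-s)K(x-x_0)+h(x)\qquad\text{on }(\Omega_s\cap\Omega_t)\setminus(S\cup\{x_0\}),$$ where $h$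 is harmonic on all of $\Omega_s\cap\Omega_t$. -/

import Mathlib

open Set Filter Topology Asymptotics MeasureTheory InnerProductSpace

noncomputable section

/-- The fundamental solution `K` of the Laplace equation in `ℝⁿ` (`n ≥ 2`), normalized by
`-ΔK = δ₀`, so that `K → +∞` at the origin. The number `n * vol(B₁)` is the area of the unit
sphere. -/
def fundamentalSolution (n : ℕ) (x : EuclideanSpace ℝ (Fin n)) : ℝ :=
  ((n : ℝ) * volume.real (Metric.ball (0 : EuclideanSpace ℝ (Fin n)) 1))⁻¹ *
    (if n = 2 then -Real.log ‖x‖ else (((n : ℝ) - 2) * ‖x‖ ^ (n - 2))⁻¹)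

/-- The space-time region `{(t, x) : t ∈ I, x ∈ Ω_t}`. -/
def spaceTime {n : ℕ} (I : Set ℝ) (Ω : ℝ → Set (EuclideanSpace ℝ (Fin n))) :
    Set (ℝ × EuclideanSpace ℝ (Fin n)) :=
  {p | p.1 ∈ I ∧ p.2 ∈ Ω p.1}

/-- `φ` is a real-analytic local defining function of the moving domain `Ω` near `(t, y)`:
`Ω_τ = {x : φ(τ, x) < 0}` for `(τ, x)` near `(t, y)`, and the spatial gradient of `φ` does not
vanish at `(t, y)`. -/
structure IsDefiningFunction {n : ℕ} (Ω : ℝ → Set (EuclideanSpace ℝ (Fin n)))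
    (φ : ℝ × EuclideanSpace ℝ (Fin n) → ℝ) (t : ℝ) (y : EuclideanSpace ℝ (Fin n)) : Prop where
  analytic : AnalyticAt ℝ φ (t, y)
  gradient_ne_zero : gradient (fun x => φ (t, x)) y ≠ 0
  mem_iff : ∀ᶠ p in 𝓝 (t, y), p.2 ∈ Ω p.1 ↔ φ p < 0

/-- A one-parameter family of domains whose boundaries are nonsingular real-analytic
hypersurfaces depending analytically on time: near each of its points `(t, y)`, `t ∈ I`, the
boundary of the space-time region has an analytic defining function which is regular in the space
variable. -/
structure IsAnalyticFamily {n : ℕ} (I : Set ℝ) (Ω : ℝ → Set (EuclideanSpace ℝ (Fin n))) :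
    Prop where
  isOpen : ∀ t ∈ I, IsOpen (Ω t)
  isConnected : ∀ t ∈ I, IsConnected (Ω t)
  exists_defining : ∀ t ∈ I, ∀ y, (t, y) ∈ frontier (spaceTime I Ω) →
    ∃ φ, IsDefiningFunction Ω φ t y

/-- `v` is the normal velocity (as a vector) at time `t` and at the point `y` of the moving
boundary: `v = -(∂ₜφ / |∇φ|²) ∇φ` for a local defining function `φ`. -/
def IsNormalVelocity {n : ℕ} (Ω : ℝ → Set (EuclideanSpace ℝ (Fin n))) (t : ℝ)
    (y v : EuclideanSpace ℝ (Fin n)) : Prop :=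
  ∃ φ, IsDefiningFunction Ω φ t y ∧
    v = -(deriv (fun τ => φ (τ, y)) t / ‖gradient (fun x => φ (t, x)) y‖ ^ 2) •
      gradient (fun x => φ (t, x)) y

/-- `P(·, t)` is the pressure: the Green's function of `Ω_t`, harmonic off the sink `x₀ ∈ Ω_t`,
zero on the boundary, and asymptotic to `-Q K(x - x₀)` at the sink. The last condition is void for
a bounded domain; on an unbounded one it is the usual behaviour of the Green's function at
infinity (bounded if `n = 2`, `O(|x|^{2-n})` if `n ≥ 3`). -/
structure IsPressure {n : ℕ} (I : Set ℝ) (Ω : ℝ → Set (EuclideanSpace ℝ (Fin n)))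
    (x₀ : EuclideanSpace ℝ (Fin n)) (Q : ℝ) (P : ℝ → EuclideanSpace ℝ (Fin n) → ℝ) : Prop where
  sink_mem : ∀ t ∈ I, x₀ ∈ Ω t
  harmonic : ∀ t ∈ I, HarmonicOnNhd (P t) (Ω t \ {x₀})
  boundary_eq : ∀ t ∈ I, ∀ y ∈ frontier (Ω t), P t y = 0
  boundary_lim : ∀ t ∈ I, ∀ y ∈ frontier (Ω t), Tendsto (P t) (𝓝[Ω t] y) (𝓝 0)
  sink : ∀ t ∈ I, P t ~[𝓝[≠] x₀] fun x => -Q * fundamentalSolution n (x - x₀)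
  infinity : ∀ t ∈ I,
    P t =O[Bornology.cobounded (EuclideanSpace ℝ (Fin n)) ⊓ 𝓟 (Ω t)] fun x => (‖x‖ ^ (n - 2))⁻¹

/-- The pair `(Ω, P)` solves the Laplacian growth problem with sink `x₀` and suction rate `Q`:
`P` is the pressure, and the normal velocity of the boundary is the boundary value (taken from
inside of `Ω_t`) of `-∇P`. -/
structure SolvesLaplacianGrowth {n : ℕ} (I : Set ℝ) (Ω : ℝ → Set (EuclideanSpace ℝ (Fin n)))
    (x₀ : EuclideanSpace ℝ (Fin n)) (Q : ℝ) (P : ℝ → EuclideanSpace ℝ (Fin n) → ℝ) : Prop where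
  pressure : IsPressure I Ω x₀ Q P
  velocity : ∀ t ∈ I, ∀ y ∈ frontier (Ω t), ∃ v, IsNormalVelocity Ω t y v ∧
    Tendsto (fun x => -gradient (P t) x) (𝓝[Ω t] y) (𝓝 v)

/-- `w(·, t)` is the Schwarz potential of `∂Ω_t` for every `t ∈ I`: near the moving boundary `w`
is harmonic in space (and `C²` in space-time, so that `∂w/∂t` makes sense), and on the boundary
`w = |x|²/2` and `∇w = x`. Only the values of `w` near the moving boundary matter. -/
structure IsSchwarzPotential {n : ℕ} (I : Set ℝ) (Ω : ℝ → Set (EuclideanSpace ℝ (Fin n)))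
    (w : ℝ → EuclideanSpace ℝ (Fin n) → ℝ) : Prop where
  contDiffAt : ∀ t ∈ I, ∀ y ∈ frontier (Ω t),
    ContDiffAt ℝ 2 (fun p : ℝ × EuclideanSpace ℝ (Fin n) => w p.1 p.2) (t, y)
  harmonic : ∀ t ∈ I, ∀ y ∈ frontier (Ω t), ∀ᶠ p in 𝓝 (t, y), HarmonicAt (w p.1) p.2
  value : ∀ t ∈ I, ∀ y ∈ frontier (Ω t), w t y = ‖y‖ ^ 2 / 2
  gradient_eq : ∀ t ∈ I, ∀ y ∈ frontier (Ω t), gradient (w t) y = y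

/-- `F` is a continuation of `u`, given near the boundary of `U`, to a harmonic function on
`U \ A`; that is, the singularities of `u` inside of `U` are confined to `A`. -/
def IsHarmonicContinuation {n : ℕ} (U A : Set (EuclideanSpace ℝ (Fin n)))
    (u F : EuclideanSpace ℝ (Fin n) → ℝ) : Prop :=
  HarmonicOnNhd F (U \ A) ∧ ∀ y ∈ frontier U, ∀ᶠ x in 𝓝[U] y, F x = u x

end

set_option linter.unusedSectionVars false


/-! ### Laplacian, Green's identities and weak harmonicity. -/

noncomputable section
section HarmonicTools

open scoped Laplacian ContDiff

/-! The hinge is the Cauchy data of ∂w/∂t on the moving boundary. The function w - |x|²/2 and its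
spatial gradient vanish on the space-time surface φ = 0. Hence its full first derivative vanishes
there, and its second derivative has the form c Dφ ⊗ Dφ. Since w is harmonic, the spatial trace
gives c|∇φ|² = -n, and the mixed entries then say ∇(∂w/∂t) = n vₙ, where vₙ = -(∂φ/∂t)∇φ/|∇φ|² is
the normal velocity; also ∂w/∂t = 0 on the boundary (`time_derivative_cauchy_data`). So ∂w/∂t and
-nP have the same Cauchy data exactly when vₙ = -∇P.

Both functions are harmonic in space (`harmonicOnNhd_time_derivative`), so part (1) is uniqueness in
the Cauchy problem. For a Laplacian growth, ∂w/∂t + nP extended by zero outside Ω_t is harmonic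
across the boundary (`harmonicAt_of_zero_cauchy_data`), and it vanishes by the identity theorem
because it vanishes outside. Conversely, ∂w/∂t = -nP near the boundary allows the velocity to be
read off from the gradient.

For part (2) the equation is integrated in time. At the sink the pressure splits as P = H - Q K(x -
x₀) with H harmonic on all of Ω_t (`IsPressure.exists_regular_part`, by removability of weak
singularities). Near the boundary this gives w(b) - w(a) = -n∫H + nQ(b - a)K(x - x₀), whose right
side makes sense deep inside the domain. It therefore continues w(b) once w(a) is continued. Over a
short time all boundaries lie in a fixed collar of Γ where w is regular. The continuity of H in
time, needed for the integral, is inherited from w through the maximum principle. Short steps are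
chained by connectedness of the time interval.

The potential theory rests on weak harmonicity. Weyl's lemma comes from radial averaging kernels,
interior gradient estimates from convolution with such a kernel, and the identity theorem from
iterating the gradient estimate. -/

theorem ContDiffAt.differentiableAt_fderiv_apply {X : Type*} [NormedAddCommGroup X] [NormedSpace ℝ X]
    {f : X → ℝ} {x : X} (h : ContDiffAt ℝ 2 f x)
    (v : X) : DifferentiableAt ℝ (fun y => fderiv ℝ f y v) x :=
  ((h.fderiv_right (m := 1) (by norm_num)).differentiableAt (by norm_num)).clm_apply
    (differentiableAt_const v)

theorem ContDiffAt.contDiffAt_fderiv_apply {X : Type*} [NormedAddCommGroup X] [NormedSpace ℝ X]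
    {f : X → ℝ} {x : X} (h : ContDiffAt ℝ 2 f x)
    (v : X) : ContDiffAt ℝ 1 (fun y => fderiv ℝ f y v) x :=
  (h.fderiv_right (m := 1) (by norm_num)).clm_apply contDiffAt_const

theorem fderiv_fderiv_apply_eq {X : Type*} [NormedAddCommGroup X] [NormedSpace ℝ X]
    {f : X → ℝ} {x : X} (h : ContDiffAt ℝ 2 f x) (v w : X) :
    fderiv ℝ (fun y => fderiv ℝ f y v) x w = fderiv ℝ (fderiv ℝ f) x w v := by
  have h1 : DifferentiableAt ℝ (fderiv ℝ f) x :=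
    (h.fderiv_right (m := 1) (by norm_num)).differentiableAt (by norm_num)
  have := fderiv_clm_apply h1 (differentiableAt_const v)
  rw [this]; simp

variable {E : Type*} [NormedAddCommGroup E] [InnerProductSpace ℝ E] [FiniteDimensional ℝ E]

/-- The Laplacian as a sum of repeated directional derivatives. -/
theorem laplacian_eq_sum_fderiv {ι : Type*} [Fintype ι] (b : OrthonormalBasis ι ℝ E)
    {f : E → ℝ} {x : E} (h : ContDiffAt ℝ 2 f x) :
    Δ f x = ∑ i, fderiv ℝ (fun y => fderiv ℝ f y (b i)) x (b i) := by
  rw [laplacian_eq_iteratedFDeriv_orthonormalBasis f b]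
  refine Finset.sum_congr rfl fun i _ => ?_
  rw [fderiv_fderiv_apply_eq h, iteratedFDeriv_two_apply]
  simp

theorem laplacian_comp_sub_right (f : E → ℝ) (a x : E) :
    Δ (fun y => f (y - a)) x = Δ f (x - a) := by
  rw [laplacian_eq_iteratedFDeriv_stdOrthonormalBasis, laplacian_eq_iteratedFDeriv_stdOrthonormalBasis]
  simp only [iteratedFDeriv_comp_sub]

theorem harmonicAt_comp_sub_right {f : E → ℝ} {a x : E} (h : HarmonicAt f (x - a)) :
    HarmonicAt (fun y => f (y - a)) x := by
  refine ⟨ContDiffAt.comp (g := f) x h.1 (contDiffAt_id.sub contDiffAt_const), ?_⟩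
  have ht : Tendsto (fun y : E => y - a) (𝓝 x) (𝓝 (x - a)) :=
    (continuous_id.sub continuous_const).continuousAt
  filter_upwards [ht.eventually h.2] with y hy
  rw [laplacian_comp_sub_right, hy]; rfl

/-- The Laplacian of a radial function. -/
theorem laplacian_comp_normSq {g : ℝ → ℝ} {x : E} (hg : ContDiffAt ℝ 2 g (‖x‖ ^ 2)) :
    Δ (fun y : E => g (‖y‖ ^ 2)) x =
      4 * ‖x‖ ^ 2 * deriv (deriv g) (‖x‖ ^ 2) + 2 * Module.finrank ℝ E * deriv g (‖x‖ ^ 2) := by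
  have hn : ContDiff ℝ 2 (fun y : E => ‖y‖ ^ 2) := contDiff_norm_sq ℝ
  have hc : ContDiffAt ℝ 2 (fun y : E => g (‖y‖ ^ 2)) x := hg.comp x hn.contDiffAt
  rw [laplacian_eq_sum_fderiv (stdOrthonormalBasis ℝ E) hc]
  have h1 : ∀ᶠ y in 𝓝 x, ∀ v, fderiv ℝ (fun y : E => g (‖y‖ ^ 2)) y v =
      deriv g (‖y‖ ^ 2) * (2 * inner ℝ y v) := by
    have : ∀ᶠ y in 𝓝 x, ContDiffAt ℝ 2 g (‖y‖ ^ 2) :=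
      (hn.continuous.tendsto x).eventually (hg.eventually (by simp))
    filter_upwards [this] with y hy v
    have h2 : HasFDerivAt (fun y : E => ‖y‖ ^ 2) (2 • (innerSL ℝ y)) y :=
      (hasStrictFDerivAt_norm_sq y).hasFDerivAt
    have h3 := (hy.differentiableAt (by norm_num)).hasDerivAt.comp_hasFDerivAt y h2
    have h4 : fderiv ℝ (fun y : E => g (‖y‖ ^ 2)) y = _ := h3.fderiv
    rw [h4]; simp
  have h5 : ∀ v, fderiv ℝ (fun y => fderiv ℝ (fun y : E => g (‖y‖ ^ 2)) y v) x v =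
      4 * deriv (deriv g) (‖x‖ ^ 2) * (inner ℝ x v) ^ 2 + 2 * deriv g (‖x‖ ^ 2) * ‖v‖ ^ 2 := by
    intro v
    have h6 : (fun y => fderiv ℝ (fun y : E => g (‖y‖ ^ 2)) y v) =ᶠ[𝓝 x]
      fun y => deriv g (‖y‖ ^ 2) * (2 * inner ℝ y v) := by
      filter_upwards [h1] with y hy using hy v
    rw [h6.fderiv_eq]
    have h2 : HasFDerivAt (fun y : E => ‖y‖ ^ 2) (2 • (innerSL ℝ x)) x :=
      (hasStrictFDerivAt_norm_sq x).hasFDerivAt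
    have hd : DifferentiableAt ℝ (deriv g) (‖x‖ ^ 2) := by
      have h9 := hg.fderiv_right (m := 1) (by norm_num)
      have : deriv g = fun t => fderiv ℝ g t 1 := by ext; simp
      rw [this]
      exact (h9.differentiableAt (by norm_num)).clm_apply (differentiableAt_const _)
    have h3 := hd.hasDerivAt.comp_hasFDerivAt x h2
    have h7 : HasFDerivAt (fun y : E => 2 * inner ℝ y v) ((2:ℝ) • (innerSL ℝ v)) x := by
      have : (fun y : E => 2 * inner ℝ y v) = fun y => ((2:ℝ) • (innerSL ℝ v)) y := by
        ext y; simp [real_inner_comm]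
      rw [this]
      exact ((2:ℝ) • (innerSL ℝ v)).hasFDerivAt
    have h8 := h3.mul h7
    have h4 : fderiv ℝ (fun y : E => deriv g (‖y‖ ^ 2) * (2 * inner ℝ y v)) x = _ := h8.fderiv
    rw [h4]
    simp
    ring
  simp only [h5]
  rw [Finset.sum_add_distrib, ← Finset.mul_sum]
  have h6 : ∑ i, (inner ℝ x (stdOrthonormalBasis ℝ E i)) ^ 2 = ‖x‖ ^ 2 := by
    have := (stdOrthonormalBasis ℝ E).sum_sq_norm_inner_left x
    simpa using this
  rw [h6]
  simp
  ring

variable [MeasurableSpace E] [BorelSpace E]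

/-- The integral of a directional derivative of a compactly supported function vanishes. -/
theorem integral_fderiv_apply_eq_zero {A : E → ℝ} (hA : ContDiff ℝ 1 A)
    (hc : HasCompactSupport A) (v : E) : ∫ x, fderiv ℝ A x v = 0 := by
  have h1 : Integrable (fun x => fderiv ℝ A x v) (volume : Measure E) :=
    (((hA.continuous_fderiv (by norm_num)).clm_apply continuous_const).integrable_of_hasCompactSupport
      (hc.fderiv_apply ℝ v))
  have h2 : Integrable A (volume : Measure E) := hA.continuous.integrable_of_hasCompactSupport hc
  have := integral_mul_fderiv_eq_neg_fderiv_mul_of_integrable (μ := (volume : Measure E))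
    (f := fun _ : E => (1 : ℝ)) (g := A) (v := v) (by simp) (by simpa using h1)
    (by simpa using h2) (fun x _ => differentiableAt_const _)
    (fun x _ => hA.differentiable (by norm_num) x)
  simpa using this

/-- Green's second identity with a cutoff `f`. -/
theorem integral_green_cutoff {f q η : E → ℝ} (hf : ContDiff ℝ 1 f) (hc : HasCompactSupport f)
    (hq : ∀ x ∈ tsupport f, ContDiffAt ℝ 2 q x) (hη : ∀ x ∈ tsupport f, ContDiffAt ℝ 2 η x) :
    ∫ x, f x * (q x * Δ η x - η x * Δ q x) =
      - ∑ i, ∫ x, fderiv ℝ f x (stdOrthonormalBasis ℝ E i) *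
        (q x * fderiv ℝ η x (stdOrthonormalBasis ℝ E i) -
          η x * fderiv ℝ q x (stdOrthonormalBasis ℝ E i)) := by
  set b := stdOrthonormalBasis ℝ E
  -- The components of f(q∇η - η∇q). The divergence of this field is ∇f·(q∇η - η∇q) + f(qΔη - ηΔq),
  -- and it integrates to zero because f has compact support.
  let A : Fin (Module.finrank ℝ E) → E → ℝ := fun i x =>
    f x * (q x * fderiv ℝ η x (b i) - η x * fderiv ℝ q x (b i))
  let B : Fin (Module.finrank ℝ E) → E → ℝ := fun i x =>
    fderiv ℝ f x (b i) * (q x * fderiv ℝ η x (b i) - η x * fderiv ℝ q x (b i))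
  have hB : ∀ i, Integrable (B i) := by
    intro i
    have hcs : HasCompactSupport (fun x => fderiv ℝ f x (b i)) := hc.fderiv_apply ℝ (b i)
    have hcont : Continuous (fun x => fderiv ℝ f x (b i)) :=
      (hf.continuous_fderiv (by norm_num)).clm_apply continuous_const
    refine Continuous.integrable_of_hasCompactSupport ?_ hcs.mul_right
    refine continuous_of_tsupport fun x hx => ?_
    have hx' : x ∈ tsupport f :=
      (tsupport_fderiv_apply_subset ℝ (b i)) (tsupport_mul_subset_left hx)
    exact hcont.continuousAt.mul
      (((hq x hx').continuousAt.mul ((hη x hx').differentiableAt_fderiv_apply (b i)).continuousAt).sub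
      ((hη x hx').continuousAt.mul ((hq x hx').differentiableAt_fderiv_apply (b i)).continuousAt))
  have hA : ∀ i, ContDiff ℝ 1 (A i) := by
    intro i
    rw [contDiff_iff_contDiffAt]
    intro x
    by_cases hx : x ∈ tsupport f
    · exact hf.contDiffAt.mul ((((hq x hx).of_le (by norm_num)).mul
        ((hη x hx).contDiffAt_fderiv_apply (b i))).sub (((hη x hx).of_le (by norm_num)).mul
        ((hq x hx).contDiffAt_fderiv_apply (b i))))
    -- Off the support of f nothing is known about q and η, but the component is locally zero there.
    · have : A i =ᶠ[𝓝 x] fun _ => 0 := by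
        filter_upwards [notMem_tsupport_iff_eventuallyEq.mp hx] with y hy
        simp [A, hy]
      exact contDiffAt_const.congr_of_eventuallyEq this
  have hAc : ∀ i, HasCompactSupport (A i) := fun i => hc.mul_right
  have hAd : ∀ i x, fderiv ℝ (A i) x (b i) = B i x + f x *
      (q x * fderiv ℝ (fun y => fderiv ℝ η y (b i)) x (b i) -
        η x * fderiv ℝ (fun y => fderiv ℝ q y (b i)) x (b i)) := by
    intro i x
    by_cases hx : x ∈ tsupport f
    · have h1 := ((((hq x hx).differentiableAt (by norm_num)).hasFDerivAt.mul
        ((hη x hx).differentiableAt_fderiv_apply (b i)).hasFDerivAt).sub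
        (((hη x hx).differentiableAt (by norm_num)).hasFDerivAt.mul
        ((hq x hx).differentiableAt_fderiv_apply (b i)).hasFDerivAt))
      have h2 := (hf.differentiable (by norm_num) x).hasFDerivAt.mul h1
      have h3 : fderiv ℝ (A i) x = _ := h2.fderiv
      rw [h3]
      simp [B]
      ring
    · have h0 := notMem_tsupport_iff_eventuallyEq.mp hx
      have : A i =ᶠ[𝓝 x] fun _ => 0 := by
        filter_upwards [h0] with y hy
        simp [A, hy]
      rw [this.fderiv_eq]
      have h1 : fderiv ℝ f x = 0 := by rw [h0.fderiv_eq]; simp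
      simp [B, h1, h0.self_of_nhds]
  have key : ∀ i, ∫ x, (fderiv ℝ (A i) x (b i) - B i x) = - ∫ x, B i x := by
    intro i
    rw [integral_sub ?_ (hB i), integral_fderiv_apply_eq_zero (hA i) (hAc i) (b i), zero_sub]
    exact (((hA i).continuous_fderiv (by norm_num)).clm_apply
      continuous_const).integrable_of_hasCompactSupport ((hAc i).fderiv_apply ℝ (b i))
  have hint : ∀ i, Integrable (fun x => fderiv ℝ (A i) x (b i) - B i x) := fun i =>
    ((((hA i).continuous_fderiv (by norm_num)).clm_apply
      continuous_const).integrable_of_hasCompactSupport ((hAc i).fderiv_apply ℝ (b i))).sub (hB i)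
  rw [← Finset.sum_neg_distrib]
  change _ = ∑ i, - ∫ x, B i x
  simp_rw [← key]
  rw [← integral_finsetSum _ fun i _ => hint i]
  refine integral_congr_ae (Eventually.of_forall fun x => ?_)
  simp only [hAd, add_sub_cancel_left]
  by_cases hx : x ∈ tsupport f
  · rw [laplacian_eq_sum_fderiv b (hη x hx), laplacian_eq_sum_fderiv b (hq x hx), ← Finset.mul_sum,
      Finset.sum_sub_distrib, Finset.mul_sum, Finset.mul_sum]
  · simp [image_eq_zero_of_notMem_tsupport hx]

theorem isOpen_setOf_contDiffAt_two (u : E → ℝ) : IsOpen {x | ContDiffAt ℝ 2 u x} := by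
  rw [isOpen_iff_mem_nhds]
  intro x hx
  exact ContDiffAt.eventually hx (by simp)

theorem tsupport_laplacian_subset (ζ : E → ℝ) : tsupport (Δ ζ) ⊆ tsupport ζ := by
  refine closure_minimal (fun x hx => ?_) (isClosed_tsupport ζ)
  by_contra h
  have h0 := notMem_tsupport_iff_eventuallyEq.mp h
  have := (laplacian_congr_nhds h0).self_of_nhds
  apply hx
  rw [this]
  change Δ (fun _ : E => (0:ℝ)) x = 0
  simp

theorem continuous_laplacian {ζ : E → ℝ} (h : ContDiff ℝ 2 ζ) : Continuous (Δ ζ) := by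
  have : Δ ζ = fun x => ∑ i, fderiv ℝ (fun y => fderiv ℝ ζ y (stdOrthonormalBasis ℝ E i)) x
      (stdOrthonormalBasis ℝ E i) := by
    ext x; exact laplacian_eq_sum_fderiv _ h.contDiffAt
  rw [this]
  refine continuous_finsetSum _ fun i _ => ?_
  have h1 : ContDiff ℝ 1 (fun y => fderiv ℝ ζ y (stdOrthonormalBasis ℝ E i)) :=
    (h.fderiv_right (m := 1) (by norm_num)).clm_apply contDiff_const
  exact (h1.continuous_fderiv (by norm_num)).clm_apply continuous_const

/-- Smooth cutoff functions. -/
theorem exists_smooth_cutoff {K U : Set E} (hK : IsCompact K) (hU : IsOpen U) (hKU : K ⊆ U) :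
    ∃ f : E → ℝ, ContDiff ℝ ∞ f ∧ HasCompactSupport f ∧ tsupport f ⊆ U ∧
      (∀ᶠ x in 𝓝ˢ K, f x = 1) ∧ ∀ x, f x ∈ Icc 0 1 := by
  obtain ⟨V, hVo, hV, hVU, hVc⟩ := exists_open_between_and_isCompact_closure hK hU hKU
  obtain ⟨W, hWo, hW, hWV, hWc⟩ := exists_open_between_and_isCompact_closure hK hVo hV
  obtain ⟨f, hf, hr, hs, h1⟩ := exists_contMDiff_support_eq_eq_one_iff (n := (⊤ : ℕ∞))
    (modelWithCornersSelf ℝ E) hVo isClosed_closure hWV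
  have ht : tsupport f ⊆ closure V := by rw [tsupport, hs]
  refine ⟨f, hf.contDiff, hVc.of_isClosed_subset (isClosed_tsupport f) ht, ht.trans hVU, ?_,
    fun x => hr ⟨x, rfl⟩⟩
  rw [eventually_nhdsSet_iff_exists]
  exact ⟨W, hWo, hW, fun x hx => (h1 x).mp (subset_closure hx)⟩

/-- Green's second identity for a compactly supported function. -/
theorem integral_mul_laplacian_comm {u ζ : E → ℝ} (hζ : ContDiff ℝ 2 ζ)
    (hc : HasCompactSupport ζ) (hu : ∀ x ∈ tsupport ζ, ContDiffAt ℝ 2 u x) :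
    ∫ x, u x * Δ ζ x = ∫ x, ζ x * Δ u x := by
  -- Regularity of u is known only near the support of ζ, so the cutoff version is used with a
  -- cutoff equal to 1 near that support. Where the cutoff varies, ζ vanishes, and the remaining
  -- terms drop out.
  obtain ⟨f, hf, hfc, hfs, hf1, -⟩ := exists_smooth_cutoff hc (isOpen_setOf_contDiffAt_two u) hu
  have hf1 : ∀ x ∈ tsupport ζ, f =ᶠ[𝓝 x] fun _ => 1 := fun x hx =>
    hf1.filter_mono (nhds_le_nhdsSet hx)
  have h := integral_green_cutoff (hf.of_le ENat.LEInfty.out) hfc hfs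
    (fun x _ => hζ.contDiffAt)
  have h0 : ∀ i : Fin (Module.finrank ℝ E), ∫ x, fderiv ℝ f x (stdOrthonormalBasis ℝ E i) *
        (u x * fderiv ℝ ζ x (stdOrthonormalBasis ℝ E i) -
          ζ x * fderiv ℝ u x (stdOrthonormalBasis ℝ E i)) = 0 := by
    intro i
    rw [← integral_zero E ℝ]
    congr 1
    ext x
    by_cases hx : x ∈ tsupport ζ
    · rw [(hf1 x hx).fderiv_eq]; simp
    · have h1 := notMem_tsupport_iff_eventuallyEq.mp hx
      rw [h1.fderiv_eq, h1.self_of_nhds]; simp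
  simp only [h0, Finset.sum_const_zero, neg_zero] at h
  have h2 : ∀ x, f x * (u x * Δ ζ x - ζ x * Δ u x) = u x * Δ ζ x - ζ x * Δ u x := by
    intro x
    by_cases hx : x ∈ tsupport ζ
    · rw [(hf1 x hx).self_of_nhds]; simp
    · have h1 := image_eq_zero_of_notMem_tsupport hx
      have h3 := image_eq_zero_of_notMem_tsupport (fun h => hx (tsupport_laplacian_subset ζ h))
      simp [h1, h3]
  simp only [h2] at h
  rw [integral_sub, sub_eq_zero] at h
  · exact h
  · refine Continuous.integrable_of_hasCompactSupport (continuous_of_tsupport fun x hx => ?_)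
      (HasCompactSupport.mul_left (hc.mono' ((subset_tsupport _).trans (tsupport_laplacian_subset ζ))))
    exact (hu x (tsupport_laplacian_subset ζ (tsupport_mul_subset_right hx))).continuousAt.mul
      (continuous_laplacian hζ).continuousAt
  · refine Continuous.integrable_of_hasCompactSupport (continuous_of_tsupport fun x hx => ?_)
      hc.mul_right
    have hx' := hu x (tsupport_mul_subset_left hx)
    refine hζ.continuous.continuousAt.mul ?_
    have h4 : Δ u =ᶠ[𝓝 x] fun x => ∑ i, fderiv ℝ (fun y => fderiv ℝ u y
        (stdOrthonormalBasis ℝ E i)) x (stdOrthonormalBasis ℝ E i) := by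
      filter_upwards [hx'.eventually (by simp)] with y hy using laplacian_eq_sum_fderiv _ hy
    refine ContinuousAt.congr ?_ h4.symm
    refine tendsto_finsetSum _ fun i _ => ?_
    exact (((hx'.contDiffAt_fderiv_apply _).fderiv_right (m := 0) (by norm_num)).continuousAt).clm_apply
      continuousAt_const

/-- `u` is harmonic on `U` in the sense of distributions. -/
def IsWeaklyHarmonicOn (u : E → ℝ) (U : Set E) : Prop :=
  ∀ ζ : E → ℝ, ContDiff ℝ ∞ ζ → HasCompactSupport ζ → tsupport ζ ⊆ U → ∫ x, u x * Δ ζ x = 0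

theorem IsWeaklyHarmonicOn.mono {u : E → ℝ} {U V : Set E} (h : IsWeaklyHarmonicOn u U)
    (hVU : V ⊆ U) : IsWeaklyHarmonicOn u V :=
  fun ζ h1 h2 h3 => h ζ h1 h2 (h3.trans hVU)

theorem IsWeaklyHarmonicOn.of_harmonicOnNhd {u : E → ℝ} {U : Set E} (h : HarmonicOnNhd u U) :
    IsWeaklyHarmonicOn u U := by
  intro ζ h1 h2 h3
  rw [integral_mul_laplacian_comm (h1.of_le ENat.LEInfty.out) h2
    fun x hx => (h x (h3 hx)).1, ← integral_zero E ℝ]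
  congr 1
  ext x
  by_cases hx : x ∈ tsupport ζ
  · rw [(h x (h3 hx)).2.self_of_nhds]; simp
  · simp [image_eq_zero_of_notMem_tsupport hx]

end HarmonicTools
end


/-! ### Mean values over radial kernels. -/

noncomputable section
section WeylLemma

open scoped Laplacian ContDiff

theorem contDiff_integral_right {g : ℝ → ℝ} (hg : ContDiff ℝ ∞ g) (a : ℝ) :
    ContDiff ℝ ∞ (fun s => ∫ t in a..s, g t) := by
  have hd : ∀ s, HasDerivAt (fun s => ∫ t in a..s, g t) (g s) s := fun s =>
    intervalIntegral.integral_hasDerivAt_right (hg.continuous.intervalIntegrable _ _)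
      (hg.continuous.stronglyMeasurableAtFilter _ _) hg.continuous.continuousAt
  rw [contDiff_infty_iff_deriv]
  refine ⟨fun s => (hd s).differentiableAt, ?_⟩
  have : deriv (fun s => ∫ t in a..s, g t) = g := funext fun s => (hd s).deriv
  rwa [this]

theorem deriv_integral_right_eq {g : ℝ → ℝ} (hg : Continuous g) (a : ℝ) :
    deriv (fun s => ∫ t in a..s, g t) = g :=
  funext fun _ => (intervalIntegral.integral_hasDerivAt_right (hg.intervalIntegrable _ _)
      (hg.stronglyMeasurableAtFilter _ _) hg.continuousAt).deriv

/-- Multiplication by a real power preserves smoothness of functions vanishing left of some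
positive number. -/
theorem contDiff_rpow_mul {g : ℝ → ℝ} (hg : ContDiff ℝ ∞ g) {a : ℝ} (ha : 0 < a)
    (h0 : ∀ s < a, g s = 0) (r : ℝ) : ContDiff ℝ ∞ (fun s => s ^ r * g s) := by
  rw [contDiff_iff_contDiffAt]
  intro s
  rcases lt_or_ge s a with hs | hs
  · have : (fun s => s ^ r * g s) =ᶠ[𝓝 s] fun _ => 0 := by
      filter_upwards [Iio_mem_nhds hs] with t ht
      rw [h0 t ht, mul_zero]
    exact contDiffAt_const.congr_of_eventuallyEq this
  · exact (Real.contDiffAt_rpow_const_of_ne (ha.trans_le hs).ne').mul hg.contDiffAt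

/-- A smooth function of total mass zero on `(0, ∞)` is, up to a weight, the radial Laplacian of
a compactly supported profile. -/
theorem exists_radial_profile {p : ℝ → ℝ} (hp : ContDiff ℝ ∞ p) {a b : ℝ} (ha : 0 < a)
    (h0 : ∀ s, s ∉ Icc a b → p s = 0) (hi : ∫ s in a..b, p s = 0) (d : ℝ) :
    ∃ ζ : ℝ → ℝ, ContDiff ℝ ∞ ζ ∧ (∀ s, b ≤ s → ζ s = 0) ∧
      ∀ s, 0 ≤ s → 4 * s * deriv (deriv ζ) s + 2 * d * deriv ζ s = 4 * (s ^ (1 - d / 2) * p s) := by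
  have ipi : ∀ x y, IntervalIntegrable p volume x y := fun x y =>
    hp.continuous.intervalIntegrable _ _
  -- For s > 0 the operator is 4 s^(1-d/2) (s^(d/2) ζ')', so ζ' = s^(-d/2) M solves the equation. M
  -- vanishes left of a because p does, and right of b because p has mass zero.
  set M : ℝ → ℝ := fun s => ∫ t in a..s, p t with hM
  have hMs : ContDiff ℝ ∞ M := contDiff_integral_right hp a
  have hM1 : ∀ s < a, M s = 0 := by
    intro s hs
    have : ∫ t in a..s, p t = ∫ t in a..s, (0:ℝ) := by
      refine intervalIntegral.integral_congr_ae ?_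
      filter_upwards [compl_mem_ae_iff.mpr (measure_singleton (μ := volume) a)] with t hta ht
      rw [uIoc_of_ge hs.le] at ht
      exact h0 t fun h => hta (le_antisymm ht.2 h.1)
    simpa [hM] using this
  have hM2 : ∀ s, b ≤ s → M s = 0 := by
    intro s hs
    have h1 : ∫ t in b..s, p t = ∫ t in b..s, (0:ℝ) := by
      refine intervalIntegral.integral_congr_ae ?_
      filter_upwards with t ht
      rw [uIoc_of_le hs] at ht
      exact h0 t fun h => absurd h.2 (not_le.mpr ht.1)
    have := intervalIntegral.integral_add_adjacent_intervals (ipi a b) (ipi b s)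
    simp only [hM]
    rw [← this, hi, h1]; simp
  have hdM : deriv M = p := deriv_integral_right_eq hp.continuous a
  set m : ℝ → ℝ := fun s => s ^ (-(d / 2)) * M s with hm
  have hms : ContDiff ℝ ∞ m := contDiff_rpow_mul hMs ha hM1 _
  have hdζ : deriv (fun s => ∫ t in b..s, m t) = m := deriv_integral_right_eq hms.continuous b
  -- Integrating from b makes ζ vanish beyond b; below a it is a constant, in general not zero.
  refine ⟨fun s => ∫ t in b..s, m t, contDiff_integral_right hms b, ?_, ?_⟩
  · intro s hs
    have h1 : ∫ t in b..s, m t = ∫ t in b..s, (0:ℝ) := by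
      refine intervalIntegral.integral_congr ?_
      intro t ht
      rw [uIcc_of_le hs] at ht
      simp [hm, hM2 t ht.1]
    simpa using h1
  · intro s hs
    rw [hdζ]
    rcases lt_or_ge s a with hsa | hsa
    · have h1 : m =ᶠ[𝓝 s] fun _ => 0 := by
        filter_upwards [Iio_mem_nhds hsa] with t ht
        simp [hm, hM1 t ht]
      rw [h1.deriv_eq, h1.self_of_nhds, h0 s fun h => absurd h.1 (not_le.mpr hsa)]
      simp
    · have hs0 : 0 < s := ha.trans_le hsa
      have hMd : HasDerivAt M (p s) s := by
        rw [← hdM]; exact (hMs.differentiable (by simp) s).hasDerivAt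
      have h2 := (Real.hasDerivAt_rpow_const (x := s) (p := -(d / 2)) (Or.inl hs0.ne')).mul hMd
      have h3 : deriv m s = _ := h2.deriv
      rw [h3]
      have e1 : s ^ (-(d / 2)) = s * s ^ (-(d / 2) - 1) := by
        rw [Real.rpow_sub_one hs0.ne']; field_simp
      have e2 : s ^ (1 - d / 2) = s * (s * s ^ (-(d / 2) - 1)) := by
        rw [← e1, sub_eq_add_neg, Real.rpow_add hs0, Real.rpow_one]
      simp only [hm]
      rw [e2, e1]
      ring

/-- Smooth probability densities on intervals. -/
theorem exists_smooth_density {a b : ℝ} (hab : a < b) :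
    ∃ p : ℝ → ℝ, ContDiff ℝ ∞ p ∧ (∀ s, 0 ≤ p s) ∧ (∀ s, s ∉ Icc a b → p s = 0) ∧
      0 < p ((a + b) / 2) ∧ ∫ s in a..b, p s = 1 := by
  let f : ContDiffBump ((a + b) / 2) := ⟨(b - a) / 4, (b - a) / 2, by linarith, by linarith⟩
  have hsupp : ∀ s, s ∉ Ioo a b → f.normed volume s = 0 := by
    intro s hs
    by_contra h
    have : s ∈ Function.support (f.normed volume) := h
    rw [f.support_normed_eq, Real.ball_eq_Ioo] at this
    apply hs
    simp only [f] at this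
    constructor <;> linarith [this.1, this.2]
  refine ⟨f.normed volume, f.contDiff_normed, f.nonneg_normed, fun s hs => hsupp s fun h =>
    hs (Ioo_subset_Icc_self h), ?_, ?_⟩
  · refine lt_of_le_of_ne (f.nonneg_normed _) (Ne.symm ?_)
    have : (a + b) / 2 ∈ Function.support (f.normed volume) := by
      rw [f.support_normed_eq]; exact Metric.mem_ball_self f.rOut_pos
    exact this
  · rw [← f.integral_normed (μ := volume), intervalIntegral.integral_of_le hab.le,
      setIntegral_eq_integral_of_forall_compl_eq_zero]
    intro s hs
    exact hsupp s fun h => hs (Ioo_subset_Ioc_self h)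

variable {E : Type*} [NormedAddCommGroup E] [InnerProductSpace ℝ E] [FiniteDimensional ℝ E]
  [MeasurableSpace E] [BorelSpace E]

/-- The radial kernel `|y|^{2-d} p(|y|²)`. -/
def radialKernel (E : Type*) [NormedAddCommGroup E] [InnerProductSpace ℝ E] (p : ℝ → ℝ) (y : E) :
    ℝ :=
  (‖y‖ ^ 2) ^ (1 - (Module.finrank ℝ E : ℝ) / 2) * p (‖y‖ ^ 2)

theorem contDiff_radialKernel {p : ℝ → ℝ} (hp : ContDiff ℝ ∞ p) {a b : ℝ} (ha : 0 < a)
    (h0 : ∀ s, s ∉ Icc a b → p s = 0) : ContDiff ℝ ∞ (radialKernel E p) :=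
  (contDiff_rpow_mul hp ha (fun s hs => h0 s fun h => absurd h.1 (not_le.mpr hs)) _).comp
    (contDiff_norm_sq ℝ)

theorem radialKernel_eq_zero {p : ℝ → ℝ} {a r : ℝ} (hr : 0 ≤ r)
    (h0 : ∀ s, s ∉ Icc a (r ^ 2) → p s = 0) {y : E} (hy : r < ‖y‖) : radialKernel E p y = 0 := by
  rw [radialKernel, h0, mul_zero]
  intro h
  exact absurd h.2 (not_le.mpr (by gcongr))

theorem hasCompactSupport_of_norm {k : E → ℝ} {r : ℝ} (h : ∀ y, r < ‖y‖ → k y = 0) :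
    HasCompactSupport k :=
  HasCompactSupport.intro (isCompact_closedBall 0 r) fun y hy => h y (by simpa using hy)

/-- A profile of mass zero turns the kernel, up to the factor 4, into the Laplacian of the test
function ζ(‖y - x‖²), which weak harmonicity annihilates. The weight in `radialKernel` is the one
that `exists_radial_profile` produces. -/
theorem integral_radialKernel_eq_zero {u : E → ℝ} {x : E} {r R : ℝ} (hr : 0 ≤ r) (hrR : r < R)
    (hu : IsWeaklyHarmonicOn u (Metric.ball x R)) {p : ℝ → ℝ} (hp : ContDiff ℝ ∞ p) {a : ℝ}
    (ha : 0 < a) (h0 : ∀ s, s ∉ Icc a (r ^ 2) → p s = 0)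
    (hi : ∫ s in a..r ^ 2, p s = 0) : ∫ y, u y * radialKernel E p (y - x) = 0 := by
  obtain ⟨ζ, hζ, hζ0, hζe⟩ := exists_radial_profile hp ha h0 hi (Module.finrank ℝ E)
  have hs : ContDiff ℝ ∞ (fun y : E => ζ (‖y‖ ^ 2)) := hζ.comp (contDiff_norm_sq ℝ)
  have hz : ∀ y : E, r < ‖y‖ → ζ (‖y‖ ^ 2) = 0 := fun y hy => hζ0 _ (by gcongr)
  have hs' : ContDiff ℝ ∞ (fun y : E => ζ (‖y - x‖ ^ 2)) := hs.comp (contDiff_id.sub contDiff_const)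
  have hsub : tsupport (fun y : E => ζ (‖y - x‖ ^ 2)) ⊆ Metric.closedBall x r := by
    refine closure_minimal (fun y hy => ?_) Metric.isClosed_closedBall
    by_contra hc
    exact hy (hz (y - x) (by simpa [dist_eq_norm] using hc))
  have h := hu _ hs' ((isCompact_closedBall x r).of_isClosed_subset (isClosed_tsupport _) hsub)
    (hsub.trans (Metric.closedBall_subset_ball hrR))
  have hL : ∀ y, Δ (fun y : E => ζ (‖y - x‖ ^ 2)) y = 4 * radialKernel E p (y - x) := by
    intro y
    rw [laplacian_comp_sub_right (fun z : E => ζ (‖z‖ ^ 2)),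
      laplacian_comp_normSq (hζ.of_le ENat.LEInfty.out).contDiffAt, hζe _ (by positivity)]
    rfl
  simp only [hL] at h
  have h4 : ∫ y, u y * (4 * radialKernel E p (y - x)) = 4 * ∫ y, u y * radialKernel E p (y - x) := by
    rw [← integral_const_mul]; congr 1; ext y; ring
  rw [h4] at h
  linarith

theorem MeasureTheory.LocallyIntegrable.integrable_mul_of_hasCompactSupport {u k : E → ℝ}
    (hu : LocallyIntegrable u) (hk : Continuous k) (hc : HasCompactSupport k) :
    Integrable (fun y => u y * k y) := by
  have := hu.integrable_smul_left_of_hasCompactSupport hk hc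
  refine this.congr (Eventually.of_forall fun y => ?_)
  simp [mul_comm]

theorem HasCompactSupport.comp_sub_right {k : E → ℝ} (hc : HasCompactSupport k) (x : E) :
    HasCompactSupport (fun y => k (y - x)) :=
  hc.comp_homeomorph (Homeomorph.subRight x)

/-- By linearity, averages against radial kernels depend only on the mass of the profile; this
allows the kernel to be concentrated near its centre. -/
theorem integral_radialKernel_congr {u : E → ℝ} (hul : LocallyIntegrable u) {x : E} {r R : ℝ}
    (hr : 0 ≤ r) (hrR : r < R)
    (hu : IsWeaklyHarmonicOn u (Metric.ball x R)) {p q : ℝ → ℝ} (hp : ContDiff ℝ ∞ p)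
    (hq : ContDiff ℝ ∞ q) {a : ℝ} (ha : 0 < a)
    (hp0 : ∀ s, s ∉ Icc a (r ^ 2) → p s = 0) (hq0 : ∀ s, s ∉ Icc a (r ^ 2) → q s = 0)
    (hi : ∫ s in a..r ^ 2, p s = ∫ s in a..r ^ 2, q s) :
    ∫ y, u y * radialKernel E p (y - x) = ∫ y, u y * radialKernel E q (y - x) := by
  have h := integral_radialKernel_eq_zero hr hrR hu (hp.sub hq) ha
    (fun s hs => by rw [hp0 s hs, hq0 s hs, sub_zero]) (by
      rw [intervalIntegral.integral_sub (hp.continuous.intervalIntegrable _ _)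
        (hq.continuous.intervalIntegrable _ _), hi, sub_self])
  have key : ∀ {p : ℝ → ℝ}, ContDiff ℝ ∞ p → (∀ s, s ∉ Icc a (r ^ 2) → p s = 0) →
      Integrable (fun y => u y * radialKernel E p (y - x)) := by
    intro p hp hp0
    exact hul.integrable_mul_of_hasCompactSupport
      ((contDiff_radialKernel hp ha hp0).continuous.comp (continuous_id.sub continuous_const))
      ((hasCompactSupport_of_norm fun y hy => radialKernel_eq_zero hr hp0 hy).comp_sub_right x)
  rw [← sub_eq_zero, ← integral_sub (key hp hp0) (key hq hq0), ← h]
  congr 1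
  ext y
  simp only [radialKernel]
  ring

theorem radialKernel_nonneg {p : ℝ → ℝ} (hp : ∀ s, 0 ≤ p s) (y : E) : 0 ≤ radialKernel E p y :=
  mul_nonneg (by positivity) (hp _)

theorem isWeaklyHarmonicOn_one (U : Set E) : IsWeaklyHarmonicOn (fun _ : E => (1 : ℝ)) U :=
  IsWeaklyHarmonicOn.of_harmonicOnNhd (harmonicOnNhd_const 1)

/-- The mean value property for a radial kernel, at the points of continuity of a weakly harmonic
function. -/
theorem IsWeaklyHarmonicOn.integral_radialKernel {u : E → ℝ} (hul : LocallyIntegrable u) {x : E}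
    {r R : ℝ} (hr : 0 ≤ r) (hrR : r < R)
    (hu : IsWeaklyHarmonicOn u (Metric.ball x R)) {p : ℝ → ℝ} (hp : ContDiff ℝ ∞ p) {a : ℝ}
    (ha : 0 < a) (har : a < r ^ 2) (hp0 : ∀ s, s ∉ Icc a (r ^ 2) → p s = 0)
    (hi : ∫ s in a..r ^ 2, p s = 1) (hx : ContinuousAt u x) :
    ∫ y, u y * radialKernel E p (y - x) = (∫ y, radialKernel E p y) * u x := by
  set c := ∫ y, radialKernel E p y with hcdef
  have hbound : ∀ ε > 0, |(∫ y, u y * radialKernel E p (y - x)) - c * u x| ≤ ε * c := by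
    intro ε hε
    obtain ⟨δ, hδ, hδu⟩ := Metric.continuousAt_iff.mp hx ε hε
    -- The kernel is moved into the ball of radius δ about x, where u differs from u x by less than
    -- ε. In the variable s = ‖y - x‖² the new density lives in [b/2, b], with b below both δ² and
    -- r².
    set b := min (r ^ 2) (δ ^ 2) / 2 with hb
    have hr2 : 0 < r ^ 2 := ha.trans har
    have hm0 : 0 < min (r ^ 2) (δ ^ 2) := lt_min hr2 (by positivity)
    have hb0 : 0 < b := by positivity
    have hbr : b < r ^ 2 := by have := min_le_left (r ^ 2) (δ ^ 2); linarith
    have hbδ : b < δ ^ 2 := by have := min_le_right (r ^ 2) (δ ^ 2); linarith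
    obtain ⟨q, hq, hqn, hq0, -, hqi⟩ := exists_smooth_density (a := b / 2) (b := b) (by linarith)
    set a' := min a (b / 2) with ha'
    have ha'0 : 0 < a' := lt_min ha (by positivity)
    have ha'r : a' ≤ r ^ 2 := (min_le_left _ _).trans har.le
    have hp0' : ∀ s, s ∉ Icc a' (r ^ 2) → p s = 0 := fun s hs => hp0 s fun h =>
      hs ⟨(min_le_left _ _).trans h.1, h.2⟩
    have hq0' : ∀ s, s ∉ Icc a' (r ^ 2) → q s = 0 := fun s hs => hq0 s fun h =>
      hs ⟨(min_le_right _ _).trans h.1, h.2.trans hbr.le⟩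
    have full : ∀ {g : ℝ → ℝ} {α β : ℝ}, α ≤ β → (∀ s, s ∉ Icc α β → g s = 0) →
        ∫ s in α..β, g s = ∫ s, g s := by
      intro g α β hαβ hg
      rw [intervalIntegral.integral_of_le hαβ, ← integral_Icc_eq_integral_Ioc,
        setIntegral_eq_integral_of_forall_compl_eq_zero hg]
    have hii : ∫ s in a'..r ^ 2, p s = ∫ s in a'..r ^ 2, q s := by
      rw [full ha'r hp0', full ha'r hq0', ← full har.le hp0, ← full (by linarith) hq0, hi, hqi]
    have e1 := integral_radialKernel_congr hul hr hrR hu hp hq ha'0 hp0' hq0' hii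
    -- The constant 1 is weakly harmonic as well, so both kernels have the same total mass; no polar
    -- coordinates are needed.
    have e2 := integral_radialKernel_congr (E := E) (locallyIntegrable_const (1:ℝ)) (x := 0) hr hrR
      (isWeaklyHarmonicOn_one _) hp hq ha'0 hp0' hq0' hii
    simp only [one_mul, sub_zero] at e2
    have hkc : Continuous (radialKernel E q) := (contDiff_radialKernel hq ha'0 hq0').continuous
    have hks : HasCompactSupport (radialKernel E q) :=
      hasCompactSupport_of_norm fun y hy => radialKernel_eq_zero hr hq0' hy
    have hkx : Continuous (fun y => radialKernel E q (y - x)) :=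
      hkc.comp (continuous_id.sub continuous_const)
    have i1 := hul.integrable_mul_of_hasCompactSupport hkx (hks.comp_sub_right x)
    have i2 : Integrable (fun y => radialKernel E q (y - x)) :=
      hkx.integrable_of_hasCompactSupport (hks.comp_sub_right x)
    have e3 : ∫ y, radialKernel E q (y - x) = c := by
      rw [hcdef, e2, integral_sub_right_eq_self (radialKernel E q)]
    rw [e1, ← e3, ← integral_mul_const, ← integral_sub i1 (i2.mul_const _), ← integral_const_mul,
      ← Real.norm_eq_abs]
    refine norm_integral_le_of_norm_le (i2.const_mul ε) (Eventually.of_forall fun y => ?_)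
    have hn := radialKernel_nonneg hqn (y - x)
    by_cases hy : ‖y - x‖ < δ
    · have := hδu (by simpa [dist_eq_norm] using hy : dist y x < δ)
      rw [Real.dist_eq] at this
      rw [Real.norm_eq_abs, show u y * radialKernel E q (y - x) - radialKernel E q (y - x) * u x =
        (u y - u x) * radialKernel E q (y - x) by ring, abs_mul, abs_of_nonneg hn]
      gcongr
    · have : radialKernel E q (y - x) = 0 := by
        rw [radialKernel, hq0, mul_zero]
        intro h
        have : δ ^ 2 ≤ ‖y - x‖ ^ 2 := by gcongr; exact not_lt.mp hy
        linarith [h.2]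
      simp [this]
  have hlim : |(∫ y, u y * radialKernel E p (y - x)) - c * u x| ≤ 0 := by
    refine le_of_forall_pos_le_add fun η hη => ?_
    have hcpos : 0 ≤ |c| + 1 := by positivity
    have := hbound (η / (|c| + 1)) (by positivity)
    refine this.trans ?_
    rw [zero_add, div_mul_eq_mul_div, div_le_iff₀ (by positivity)]
    have := le_abs_self c
    nlinarith
  have := abs_nonpos_iff.mp hlim
  linarith

theorem integral_radialKernel_pos [Nontrivial E] {p : ℝ → ℝ} (hp : ContDiff ℝ ∞ p)
    (hpn : ∀ s, 0 ≤ p s) {a r : ℝ}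
    (ha : 0 < a) (hr : 0 ≤ r) (hp0 : ∀ s, s ∉ Icc a (r ^ 2) → p s = 0) {s : ℝ} (hs : 0 < s)
    (hps : 0 < p s) : 0 < ∫ y, radialKernel E p y := by
  have hkc : Continuous (radialKernel E p) := (contDiff_radialKernel hp ha hp0).continuous
  have hks : HasCompactSupport (radialKernel E p) :=
    hasCompactSupport_of_norm fun y hy => radialKernel_eq_zero hr hp0 hy
  obtain ⟨y, hy⟩ := exists_norm_eq E (Real.sqrt_nonneg s)
  refine hkc.integral_pos_of_hasCompactSupport_nonneg_nonzero hks
    (fun y => radialKernel_nonneg hpn y) (x := y) ?_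
  rw [radialKernel, hy, Real.sq_sqrt hs.le]
  positivity

end WeylLemma
end


/-! ### Weyl's lemma, convolution representation and gradient estimates. -/

noncomputable section
section HarmonicRegularity

open scoped Laplacian ContDiff Convolution

variable {E : Type*} [NormedAddCommGroup E] [InnerProductSpace ℝ E] [FiniteDimensional ℝ E]
  [MeasurableSpace E] [BorelSpace E]

/-- The convolution of `u` with a kernel `k`. -/
def smear (u k : E → ℝ) (z : E) : ℝ := ∫ y, u y * k (z - y)

theorem smear_eq_convolution (u k : E → ℝ) :
    smear u k = u ⋆[ContinuousLinearMap.mul ℝ ℝ, volume] k := rfl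

theorem contDiff_smear {u k : E → ℝ} (hu : LocallyIntegrable u) (hk : ContDiff ℝ ∞ k)
    (hc : HasCompactSupport k) : ContDiff ℝ ∞ (smear u k) :=
  hc.contDiff_convolution_right (n := (⊤ : ℕ∞)) (ContinuousLinearMap.mul ℝ ℝ) hu hk

theorem fderiv_smear_apply {u k : E → ℝ} (hu : LocallyIntegrable u) (hk : ContDiff ℝ ∞ k)
    (hc : HasCompactSupport k) (z e : E) :
    fderiv ℝ (smear u k) z e = smear u (fun y => fderiv ℝ k y e) z := by
  have h := hc.hasFDerivAt_convolution_right (ContinuousLinearMap.mul ℝ ℝ) hu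
    (hk.of_le ENat.LEInfty.out) z
  rw [smear_eq_convolution, h.fderiv]
  have hint := (HasCompactSupport.convolutionExists_right
    ((ContinuousLinearMap.mul ℝ ℝ).precompR E) (hc.fderiv ℝ) hu
    (hk.continuous_fderiv (by simp))) z
  rw [convolution, ContinuousLinearMap.integral_apply hint.integrable]
  rfl

theorem fderiv_comp_const_sub_apply {f : E → ℝ} {z y : E} (hf : DifferentiableAt ℝ f (z - y))
    (e : E) : fderiv ℝ (fun y => f (z - y)) y e = - fderiv ℝ f (z - y) e := by
  have h1 : HasFDerivAt (fun y : E => z - y) (-(ContinuousLinearMap.id ℝ E)) y :=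
    (hasFDerivAt_id y).const_sub z
  have h2 := hf.hasFDerivAt.comp y h1
  have h3 : fderiv ℝ (fun y => f (z - y)) y = _ := h2.fderiv
  rw [h3]; simp

theorem laplacian_comp_const_sub {f : E → ℝ} (hf : ContDiff ℝ 2 f) (z y : E) :
    Δ (fun y => f (z - y)) y = Δ f (z - y) := by
  have h1 : ContDiff ℝ 2 (fun y => f (z - y)) := hf.comp (contDiff_const.sub contDiff_id)
  rw [laplacian_eq_sum_fderiv (stdOrthonormalBasis ℝ E) h1.contDiffAt,
    laplacian_eq_sum_fderiv (stdOrthonormalBasis ℝ E) hf.contDiffAt]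
  refine Finset.sum_congr rfl fun i _ => ?_
  have h2 : (fun y => fderiv ℝ (fun y => f (z - y)) y (stdOrthonormalBasis ℝ E i)) =
      fun y => -(fun w => fderiv ℝ f w (stdOrthonormalBasis ℝ E i)) (z - y) :=
    funext fun y => fderiv_comp_const_sub_apply (hf.differentiable (by norm_num) _) _
  rw [h2, fderiv_fun_neg, neg_apply, fderiv_comp_const_sub_apply
    (hf.contDiffAt.differentiableAt_fderiv_apply _), neg_neg]

/-- All derivatives fall on the kernel, since u is merely locally integrable. -/
theorem laplacian_smear {u k : E → ℝ} (hu : LocallyIntegrable u) (hk : ContDiff ℝ ∞ k)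
    (hc : HasCompactSupport k) (z : E) : Δ (smear u k) z = smear u (Δ k) z := by
  set b := stdOrthonormalBasis ℝ E
  have hk1 : ∀ e, ContDiff ℝ ∞ (fun y => fderiv ℝ k y e) := fun e =>
    (hk.fderiv_right (m := ∞) (by simp)).clm_apply contDiff_const
  have hk2 : ∀ e, HasCompactSupport (fun y => fderiv ℝ k y e) := fun e => hc.fderiv_apply ℝ e
  rw [laplacian_eq_sum_fderiv b
    ((contDiff_smear hu hk hc).of_le ENat.LEInfty.out).contDiffAt]
  have h1 : ∀ i, fderiv ℝ (fun y => fderiv ℝ (smear u k) y (b i)) z (b i) =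
      smear u (fun y => fderiv ℝ (fun y => fderiv ℝ k y (b i)) y (b i)) z := by
    intro i
    have : (fun y => fderiv ℝ (smear u k) y (b i)) = smear u (fun y => fderiv ℝ k y (b i)) :=
      funext fun y => fderiv_smear_apply hu hk hc y (b i)
    rw [this, fderiv_smear_apply hu (hk1 _) (hk2 _)]
  simp only [h1, smear]
  rw [← integral_finsetSum]
  · congr 1
    ext y
    rw [laplacian_eq_sum_fderiv b (hk.of_le ENat.LEInfty.out).contDiffAt, Finset.mul_sum]
  · intro i _
    have hcont : Continuous (fun y => fderiv ℝ (fun y => fderiv ℝ k y (b i)) y (b i)) :=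
      ((hk1 (b i)).continuous_fderiv (by simp)).clm_apply continuous_const
    have hcs : HasCompactSupport (fun y => fderiv ℝ (fun y => fderiv ℝ k y (b i)) y (b i)) :=
      (hk2 (b i)).fderiv_apply ℝ (b i)
    exact hu.integrable_mul_of_hasCompactSupport (hcont.comp (continuous_const.sub continuous_id))
      (hcs.comp_homeomorph (Homeomorph.subLeft z))

/-- The convolution of a weakly harmonic function with a test function is harmonic. -/
theorem IsWeaklyHarmonicOn.harmonicAt_smear {u k : E → ℝ} {x : E} {r R : ℝ}
    (h : IsWeaklyHarmonicOn u (Metric.ball x R)) (hu : LocallyIntegrable u) (hk : ContDiff ℝ ∞ k)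
    (hkr : ∀ y, r < ‖y‖ → k y = 0) {z : E} (hz : z ∈ Metric.ball x (R - r)) :
    HarmonicAt (smear u k) z := by
  have hc := hasCompactSupport_of_norm hkr
  refine ⟨((contDiff_smear hu hk hc).of_le ENat.LEInfty.out).contDiffAt, ?_⟩
  filter_upwards [Metric.isOpen_ball.mem_nhds hz] with w hw
  rw [laplacian_smear hu hk hc]
  have hs : ContDiff ℝ ∞ (fun y => k (w - y)) := hk.comp (contDiff_const.sub contDiff_id)
  have := h (fun y => k (w - y)) hs (hc.comp_homeomorph (Homeomorph.subLeft w)) ?_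
  · simp only [laplacian_comp_const_sub (hk.of_le ENat.LEInfty.out)] at this
    exact this
  · have : tsupport (fun y => k (w - y)) ⊆ Metric.closedBall w r := by
      refine closure_minimal (fun y hy => ?_) Metric.isClosed_closedBall
      by_contra hcn
      exact hy (hkr (w - y) (by simpa [dist_eq_norm, norm_sub_rev] using hcn))
    refine this.trans (Metric.closedBall_subset_ball' ?_)
    rw [Metric.mem_ball] at hw
    linarith

theorem radialKernel_sub_comm (p : ℝ → ℝ) (y z : E) :
    radialKernel E p (y - z) = radialKernel E p (z - y) := by
  rw [radialKernel, radialKernel, norm_sub_rev]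

/-- A probability-like radial kernel supported in the ball of radius `r`. -/
theorem exists_mean_value_kernel [Nontrivial E] {r : ℝ} (hr : 0 < r) :
    ∃ k : E → ℝ, ContDiff ℝ ∞ k ∧ (∀ y, r < ‖y‖ → k y = 0) ∧
      ∀ (u : E → ℝ) (x : E) (R : ℝ), LocallyIntegrable u →
        IsWeaklyHarmonicOn u (Metric.ball x R) → ∀ z ∈ Metric.ball x (R - r), ContinuousAt u z →
          smear u k z = u z := by
  have hr2 : 0 < r ^ 2 := by positivity
  obtain ⟨p, hp, hpn, hp0, hpm, hpi⟩ := exists_smooth_density (a := r ^ 2 / 2) (b := r ^ 2)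
    (by linarith)
  have hk := contDiff_radialKernel (E := E) hp (by positivity) hp0
  have hc : 0 < ∫ y, radialKernel E p y :=
    integral_radialKernel_pos hp hpn (by positivity) hr.le hp0
      (s := (r ^ 2 / 2 + r ^ 2) / 2) (by positivity) hpm
  set c := ∫ y, radialKernel E p y
  refine ⟨fun y => c⁻¹ * radialKernel E p y, contDiff_const.mul hk, fun y hy => ?_, ?_⟩
  · simp only [radialKernel_eq_zero hr.le hp0 hy, mul_zero]
  · intro u x R hul hu z hz hcz
    rw [Metric.mem_ball] at hz
    -- The mean value property needs a ball centred at z; since z is within R - r of x, the radius R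
    -- - dist z x still exceeds r.
    have h := (hu.mono (Metric.ball_subset_ball' (ε₁ := R - dist z x) (by linarith))
      ).integral_radialKernel hul (x := z) hr.le (by linarith : r < R - dist z x) hp
      (by positivity) (by linarith) hp0 hpi hcz
    rw [smear]
    have h2 : ∀ y, u y * (c⁻¹ * radialKernel E p (z - y)) =
        c⁻¹ * (u y * radialKernel E p (y - z)) := fun y => by
      rw [radialKernel_sub_comm]; ring
    simp only [h2]
    rw [integral_const_mul, h, inv_mul_cancel_left₀ hc.ne']

/-- **Weyl's lemma**: a weakly harmonic function agrees at its points of continuity with a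
harmonic function. -/
theorem IsWeaklyHarmonicOn.exists_harmonicOnNhd [Nontrivial E] {u : E → ℝ}
    (hu : LocallyIntegrable u)
    {x : E} {R : ℝ} (hR : 0 < R) (h : IsWeaklyHarmonicOn u (Metric.ball x R)) :
    ∃ g : E → ℝ, HarmonicOnNhd g (Metric.ball x (R / 2)) ∧
      ∀ z ∈ Metric.ball x (R / 2), ContinuousAt u z → u z = g z := by
  obtain ⟨k, hk, hkr, hm⟩ := exists_mean_value_kernel (E := E) (r := R / 2) (by positivity)
  refine ⟨smear u k, fun z hz => h.harmonicAt_smear hu hk hkr ?_, fun z hz hc =>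
    (hm u x R hu h z ?_ hc).symm⟩
  all_goals
    rw [Metric.mem_ball] at hz ⊢
    linarith

theorem IsWeaklyHarmonicOn.congr {u v : E → ℝ} {U : Set E} (h : IsWeaklyHarmonicOn u U)
    (huv : EqOn u v U) : IsWeaklyHarmonicOn v U := by
  intro ζ h1 h2 h3
  rw [← h ζ h1 h2 h3]
  congr 1
  ext x
  by_cases hx : x ∈ U
  · rw [huv hx]
  · rw [image_eq_zero_of_notMem_tsupport fun hh => hx (h3 (tsupport_laplacian_subset ζ hh))]
    simp

/-- Convolution needs a locally integrable function on the whole space, while harmonic functions are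
given only near a ball. Truncating by the indicator does not change them on the open ball. -/
theorem locallyIntegrable_indicator_closedBall {u : E → ℝ} {x : E} {R : ℝ}
    (hu : ContinuousOn u (Metric.closedBall x R)) :
    LocallyIntegrable ((Metric.closedBall x R).indicator u) :=
  ((hu.integrableOn_compact (isCompact_closedBall x R)).integrable_indicator
    measurableSet_closedBall).locallyIntegrable

theorem eqOn_indicator_ball (u : E → ℝ) (x : E) (R : ℝ) :
    EqOn u ((Metric.closedBall x R).indicator u) (Metric.ball x R) := fun y hy => by
  rw [indicator_of_mem (Metric.ball_subset_closedBall hy)]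

theorem continuousAt_indicator_ball {u : E → ℝ} {x : E} {R : ℝ}
    (hu : ContinuousOn u (Metric.closedBall x R)) {z : E} (hz : z ∈ Metric.ball x R) :
    ContinuousAt ((Metric.closedBall x R).indicator u) z := by
  have h1 : ContinuousAt u z := (hu.mono Metric.ball_subset_closedBall).continuousAt
    (Metric.isOpen_ball.mem_nhds hz)
  exact h1.congr ((eqOn_indicator_ball u x R).eventuallyEq_of_mem (Metric.isOpen_ball.mem_nhds hz))

/-- The working form of Weyl's lemma. For time derivatives, time integrals and glued functions,
harmonicity is later checked only against test functions, with continuity as the sole extra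
requirement. -/
theorem IsWeaklyHarmonicOn.harmonicOnNhd [Nontrivial E] {u : E → ℝ} {U : Set E} (hU : IsOpen U)
    (h : IsWeaklyHarmonicOn u U) (hc : ContinuousOn u U) : HarmonicOnNhd u U := by
  intro x hx
  obtain ⟨R, hR, hRU⟩ := Metric.nhds_basis_closedBall.mem_iff.mp (hU.mem_nhds hx)
  have hcR := hc.mono hRU
  obtain ⟨g, hg, hug⟩ := ((h.mono (Metric.ball_subset_closedBall.trans hRU)).congr
    (eqOn_indicator_ball u x R)).exists_harmonicOnNhd (locallyIntegrable_indicator_closedBall hcR) hR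
  have hx2 : x ∈ Metric.ball x (R / 2) := Metric.mem_ball_self (by positivity)
  refine (harmonicAt_congr_nhds ?_).mpr (hg x hx2)
  filter_upwards [Metric.isOpen_ball.mem_nhds hx2] with z hz
  have hzR : z ∈ Metric.ball x R := Metric.ball_subset_ball (by linarith) hz
  rw [← hug z hz (continuousAt_indicator_ball hcR hzR), ← eqOn_indicator_ball u x R hzR]

/-- The representation of a harmonic function as a convolution. -/
theorem InnerProductSpace.HarmonicOnNhd.exists_kernel [Nontrivial E] {r : ℝ} (hr : 0 < r) :
    ∃ k : E → ℝ, ContDiff ℝ ∞ k ∧ (∀ y, r < ‖y‖ → k y = 0) ∧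
      ∀ (u : E → ℝ) (x : E) (R : ℝ), HarmonicOnNhd u (Metric.closedBall x R) →
        ∀ z ∈ Metric.ball x (R - r), smear ((Metric.closedBall x R).indicator u) k z = u z := by
  obtain ⟨k, hk, hkr, hm⟩ := exists_mean_value_kernel (E := E) hr
  refine ⟨k, hk, hkr, fun u x R hu z hz => ?_⟩
  have hzR : z ∈ Metric.ball x R := Metric.ball_subset_ball (by linarith) hz
  rw [eqOn_indicator_ball u x R hzR]
  exact hm _ x R (locallyIntegrable_indicator_closedBall hu.continuousOn)
    ((IsWeaklyHarmonicOn.of_harmonicOnNhd (hu.mono Metric.ball_subset_closedBall)).congr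
      (eqOn_indicator_ball u x R)) z hz (continuousAt_indicator_ball hu.continuousOn hzR)

/-- Near x, u is the convolution of its truncation with k, so its derivative is the convolution with
the derivative of k. This is again a test kernel of the same support radius, and `harmonicAt_smear`
applies. -/
theorem InnerProductSpace.HarmonicAt.fderiv_apply [Nontrivial E] {u : E → ℝ} {x : E} (h : HarmonicAt u x) (e : E) :
    HarmonicAt (fun y => fderiv ℝ u y e) x := by
  obtain ⟨R, hR, hRU⟩ := Metric.nhds_basis_closedBall.mem_iff.mp h.eventually
  obtain ⟨k, hk, hkr, hm⟩ := HarmonicOnNhd.exists_kernel (E := E) (r := R / 2) (by positivity)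
  have hu : HarmonicOnNhd u (Metric.closedBall x R) := fun y hy => hRU hy
  have hR2 : R - R / 2 = R / 2 := by ring
  have hc := hasCompactSupport_of_norm hkr
  have hli := locallyIntegrable_indicator_closedBall hu.continuousOn
  have hx2 : x ∈ Metric.ball x (R - R / 2) := Metric.mem_ball_self (by linarith)
  have h1 : (fun y => fderiv ℝ u y e) =ᶠ[𝓝 x]
      smear ((Metric.closedBall x R).indicator u) (fun y => fderiv ℝ k y e) := by
    filter_upwards [Metric.isOpen_ball.mem_nhds hx2] with y hy
    rw [← fderiv_smear_apply hli hk hc]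
    have : u =ᶠ[𝓝 y] smear ((Metric.closedBall x R).indicator u) k := by
      filter_upwards [Metric.isOpen_ball.mem_nhds hy] with z hz
      rw [hm u x R hu z hz]
    rw [this.fderiv_eq]
  rw [harmonicAt_congr_nhds h1]
  refine IsWeaklyHarmonicOn.harmonicAt_smear ((IsWeaklyHarmonicOn.of_harmonicOnNhd
    (hu.mono Metric.ball_subset_closedBall)).congr (eqOn_indicator_ball u x R)) hli
    ((hk.fderiv_right (m := ∞) (by simp)).clm_apply contDiff_const) (r := R / 2) ?_ hx2
  intro y hy
  have : k =ᶠ[𝓝 y] fun _ => 0 := by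
    filter_upwards [(isOpen_lt continuous_const continuous_norm).mem_nhds hy] with z hz
      using hkr z hz
  rw [this.fderiv_eq]; simp

/-- Rescaling reduces the gradient estimate to the unit ball, which is how its constant acquires the
factor 1/δ. -/
theorem harmonicAt_comp_affine {u : E → ℝ} {x y : E} {δ : ℝ} (h : HarmonicAt u (x + δ • y)) :
    HarmonicAt (fun y => u (x + δ • y)) y := by
  have haff : ContDiff ℝ 2 (fun y : E => x + δ • y) := by fun_prop
  have hfd : ∀ (f : E → ℝ) (w e : E), DifferentiableAt ℝ f (x + δ • w) →
      fderiv ℝ (fun y => f (x + δ • y)) w e = δ * fderiv ℝ f (x + δ • w) e := by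
    intro f w e hf
    have h1 : HasFDerivAt (fun y : E => x + δ • y) (δ • (ContinuousLinearMap.id ℝ E)) w :=
      ((hasFDerivAt_id w).const_smul δ).const_add x
    have h2 := hf.hasFDerivAt.comp w h1
    have h3 : fderiv ℝ (fun y => f (x + δ • y)) w = _ := h2.fderiv
    rw [h3]; simp
  refine ⟨ContDiffAt.comp (g := u) y h.1 haff.contDiffAt, ?_⟩
  have h3 : ∀ᶠ w in 𝓝 y, HarmonicAt u (x + δ • w) :=
    haff.continuous.continuousAt.eventually h.eventually
  filter_upwards [h3.eventually_nhds] with w hw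
  have hw0 := hw.self_of_nhds
  have hL := hw0.2.self_of_nhds
  have hcw : ContDiffAt ℝ 2 (fun y => u (x + δ • y)) w :=
    ContDiffAt.comp (g := u) w hw0.1 haff.contDiffAt
  rw [laplacian_eq_sum_fderiv (stdOrthonormalBasis ℝ E) hcw]
  rw [laplacian_eq_sum_fderiv (stdOrthonormalBasis ℝ E) hw0.1] at hL
  have h4 : ∀ e : E, fderiv ℝ (fun y => fderiv ℝ (fun y => u (x + δ • y)) y e) w e =
      δ * δ * fderiv ℝ (fun y => fderiv ℝ u y e) (x + δ • w) e := by
    intro e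
    have h5 : (fun y => fderiv ℝ (fun y => u (x + δ • y)) y e) =ᶠ[𝓝 w]
        fun y => δ * fderiv ℝ u (x + δ • y) e := by
      filter_upwards [hw] with v hv using hfd u v e (hv.1.differentiableAt (by norm_num))
    have h6 : DifferentiableAt ℝ (fun y => fderiv ℝ u y e) (x + δ • w) :=
      hw0.1.differentiableAt_fderiv_apply e
    have h7 : DifferentiableAt ℝ (fun y => fderiv ℝ u (x + δ • y) e) w :=
      DifferentiableAt.comp (g := fun y => fderiv ℝ u y e) w h6
        (haff.differentiable (by norm_num) w)
    rw [h5.fderiv_eq, fderiv_const_mul h7, smul_apply, smul_eq_mul,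
      hfd (fun y => fderiv ℝ u y e) w e h6]
    ring
  simp only [h4, ← Finset.mul_sum]
  rw [hL]; simp

/-- The interior gradient estimate. -/
theorem exists_gradient_bound (E : Type*) [NormedAddCommGroup E] [InnerProductSpace ℝ E]
    [FiniteDimensional ℝ E] [MeasurableSpace E] [BorelSpace E] [Nontrivial E] :
    ∃ C > 0, ∀ (u : E → ℝ) (x : E) (δ M : ℝ), 0 < δ →
      HarmonicOnNhd u (Metric.closedBall x δ) → (∀ y ∈ Metric.closedBall x δ, |u y| ≤ M) →
        ∀ e, |fderiv ℝ u x e| ≤ C / δ * M * ‖e‖ := by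
  obtain ⟨k, hk, hkr, hm⟩ := HarmonicOnNhd.exists_kernel (E := E) (r := 1 / 2) (by positivity)
  have hc := hasCompactSupport_of_norm hkr
  have hfc : Continuous (fderiv ℝ k) := hk.continuous_fderiv (by simp)
  -- On the unit ball the derivative falls on the kernel, so its L¹ norm is the constant; 1 is added
  -- below only to make it positive.
  set C := ∫ y, ‖fderiv ℝ k (0 - y)‖ with hC
  have hC0 : 0 ≤ C := integral_nonneg fun y => norm_nonneg _
  have hint : Integrable (fun y => ‖fderiv ℝ k (0 - y)‖) := by
    refine Continuous.integrable_of_hasCompactSupport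
      ((hfc.comp (continuous_const.sub continuous_id)).norm) ?_
    exact ((hc.fderiv ℝ).comp_homeomorph (Homeomorph.subLeft (0 : E))).norm
  refine ⟨C + 1, by positivity, fun u x δ M hδ hu hM e => ?_⟩
  have hM0 : 0 ≤ M := (abs_nonneg _).trans (hM x (Metric.mem_closedBall_self hδ.le))
  set v : E → ℝ := fun y => u (x + δ • y) with hv
  have hmem : ∀ y ∈ Metric.closedBall (0 : E) 1, x + δ • y ∈ Metric.closedBall x δ := by
    intro y hy
    rw [mem_closedBall_zero_iff] at hy
    rw [Metric.mem_closedBall, dist_eq_norm, add_sub_cancel_left, norm_smul, Real.norm_eq_abs,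
      abs_of_pos hδ]
    nlinarith
  have hvh : HarmonicOnNhd v (Metric.closedBall 0 1) := fun y hy =>
    harmonicAt_comp_affine (hu _ (hmem y hy))
  have h0 : (0 : E) ∈ Metric.ball (0 : E) (1 - 1 / 2) := Metric.mem_ball_self (by norm_num)
  have hli := locallyIntegrable_indicator_closedBall hvh.continuousOn
  have h1 : fderiv ℝ v 0 e = smear ((Metric.closedBall 0 1).indicator v)
      (fun y => fderiv ℝ k y e) 0 := by
    rw [← fderiv_smear_apply hli hk hc]
    have : v =ᶠ[𝓝 0] smear ((Metric.closedBall 0 1).indicator v) k := by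
      filter_upwards [Metric.isOpen_ball.mem_nhds h0] with z hz
      rw [hm v 0 1 hvh z hz]
    rw [this.fderiv_eq]
  have h2 : fderiv ℝ v 0 e = δ * fderiv ℝ u x e := by
    have h3 : HasFDerivAt (fun y : E => x + δ • y) (δ • (ContinuousLinearMap.id ℝ E)) 0 :=
      ((hasFDerivAt_id (0:E)).const_smul δ).const_add x
    have h4 : HasFDerivAt u (fderiv ℝ u x) (x + δ • (0:E)) := by
      rw [smul_zero, add_zero]
      exact ((hu x (Metric.mem_closedBall_self hδ.le)).1.differentiableAt
        (by norm_num)).hasFDerivAt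
    have h5 : fderiv ℝ v 0 = _ := (h4.comp (0:E) h3).fderiv
    rw [h5]; simp
  have h3 : |fderiv ℝ v 0 e| ≤ M * ‖e‖ * C := by
    rw [h1, smear, hC, ← integral_const_mul, ← Real.norm_eq_abs]
    refine norm_integral_le_of_norm_le (hint.const_mul _) (Eventually.of_forall fun y => ?_)
    rw [norm_mul]
    have h6 : ‖(Metric.closedBall (0:E) 1).indicator v y‖ ≤ M := by
      by_cases hy : y ∈ Metric.closedBall (0:E) 1
      · rw [indicator_of_mem hy]; exact hM _ (hmem y hy)
      · rw [indicator_of_notMem hy]; simpa using hM0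
    have h7 := (fderiv ℝ k (0 - y)).le_opNorm e
    calc _ ≤ M * (‖fderiv ℝ k (0 - y)‖ * ‖e‖) := by gcongr
      _ = _ := by ring
  rw [h2, abs_mul, abs_of_pos hδ] at h3
  rw [div_mul_eq_mul_div, div_mul_eq_mul_div, le_div_iff₀ hδ]
  nlinarith [mul_nonneg hM0 (norm_nonneg e)]

end HarmonicRegularity
end


/-! ### Identity theorem, maximum principle and families of harmonic functions. -/

noncomputable section
section HarmonicPrinciples

open scoped Laplacian ContDiff

variable {E : Type*} [NormedAddCommGroup E] [InnerProductSpace ℝ E] [FiniteDimensional ℝ E]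
  [MeasurableSpace E] [BorelSpace E]

/-- Taylor's estimate along a segment, obtained by iterating the gradient bound. Each
differentiation costs a factor C/δ and a width δ of the tube around the segment. Each integration
from x, where all derivatives vanish, gains a factor that builds up t^k / k!. -/
theorem abs_le_pow_div_factorial_of_gradient_bound [Nontrivial E] {C : ℝ}
    (hC : ∀ (u : E → ℝ) (x : E) (δ M : ℝ), 0 < δ →
      HarmonicOnNhd u (Metric.closedBall x δ) → (∀ y ∈ Metric.closedBall x δ, |u y| ≤ M) →
        ∀ e, |fderiv ℝ u x e| ≤ C / δ * M * ‖e‖) {x e : E} (he : ‖e‖ = 1) {δ a : ℝ} (hδ : 0 < δ)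
    (k : ℕ) : ∀ (v : E → ℝ) (M : ℝ),
      (∀ t ∈ Icc 0 a, HarmonicOnNhd v (Metric.closedBall (x + t • e) (k * δ))) →
      (∀ t ∈ Icc 0 a, ∀ y ∈ Metric.closedBall (x + t • e) (k * δ), |v y| ≤ M) → v =ᶠ[𝓝 x] 0 →
      ∀ t ∈ Icc 0 a, |v (x + t • e)| ≤ M * (C / δ) ^ k * (t ^ k / k.factorial) := by
  induction k with
  | zero =>
    intro v M _ hM _ t ht
    have := hM t ht (x + t • e) (Metric.mem_closedBall_self (by simp))
    simpa using this
  | succ k ih =>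
    intro v M hv hM h0 t ht
    have hsub : ∀ t : ℝ, ∀ y ∈ Metric.closedBall (x + t • e) (k * δ),
        Metric.closedBall y δ ⊆ Metric.closedBall (x + t • e) ((k + 1 : ℕ) * δ) := by
      intro t y hy
      refine Metric.closedBall_subset_closedBall' ?_
      rw [Metric.mem_closedBall] at hy
      push_cast
      linarith
    have hmem : ∀ t : ℝ, x + t • e ∈ Metric.closedBall (x + t • e) ((k + 1 : ℕ) * δ) := fun t =>
      Metric.mem_closedBall_self (by positivity)
    -- The directional derivative is again harmonic and zero near x, and it is bounded by (C/δ)M on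
    -- the tube thinner by δ.
    have h1 := ih (fun y => fderiv ℝ v y e) (C / δ * M)
      (fun t ht y hy => (hv t ht y (hsub t y hy (Metric.mem_closedBall_self hδ.le))).fderiv_apply e)
      (fun t ht y hy => by
        have := hC v y δ M hδ ((hv t ht).mono (hsub t y hy))
          (fun z hz => hM t ht z (hsub t y hy hz)) e
        rwa [he, mul_one] at this)
      (by
        filter_upwards [h0.eventuallyEq_nhds] with y hy
        rw [hy.fderiv_eq]
        simp)
    have hd : ∀ s ∈ Icc 0 a, HasDerivAt (fun s : ℝ => v (x + s • e)) (fderiv ℝ v (x + s • e) e) s := by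
      intro s hs
      have h2 : HasDerivAt (fun s : ℝ => x + s • e) e s := by
        simpa using ((hasDerivAt_id s).smul_const e).const_add x
      exact ((hv s hs _ (hmem s)).1.differentiableAt
        (by norm_num)).hasFDerivAt.comp_hasDerivAt s h2
    have hB : ∀ s : ℝ, HasDerivAt (fun s => M * (C / δ) ^ (k + 1) * (s ^ (k + 1) / (k + 1).factorial))
        (C / δ * M * (C / δ) ^ k * (s ^ k / k.factorial)) s := by
      intro s
      have := ((hasDerivAt_pow (k + 1) s).div_const ((k + 1).factorial : ℝ)).const_mul
        (M * (C / δ) ^ (k + 1))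
      refine this.congr_deriv ?_
      rw [Nat.factorial_succ]
      push_cast
      have : (k + 1 : ℝ) ≠ 0 := by positivity
      rw [pow_succ (C / δ), mul_div_mul_left _ _ this]
      ring
    have := image_norm_le_of_norm_deriv_right_le_deriv_boundary
      (f := fun s : ℝ => v (x + s • e)) (f' := fun s => fderiv ℝ v (x + s • e) e) (a := 0) (b := a)
      (fun s hs => (hd s hs).continuousAt.continuousWithinAt)
      (fun s hs => (hd s ⟨hs.1, hs.2.le⟩).hasDerivWithinAt) (B := fun s =>
        M * (C / δ) ^ (k + 1) * (s ^ (k + 1) / (k + 1).factorial))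
      (B' := fun s => C / δ * M * (C / δ) ^ k * (s ^ k / k.factorial))
      (by simp [h0.self_of_nhds]) hB (fun s hs => h1 s ⟨hs.1, hs.2.le⟩) ht
    exact this

/-- A harmonic function on a ball that vanishes near the center vanishes on a ball whose radius is
a fixed proportion of that of the original ball. -/
theorem exists_vanishing_ratio (E : Type*) [NormedAddCommGroup E] [InnerProductSpace ℝ E]
    [FiniteDimensional ℝ E] [MeasurableSpace E] [BorelSpace E] [Nontrivial E] :
    ∃ ρ > 0, ∀ (u : E → ℝ) (x : E) (R : ℝ), 0 < R → HarmonicOnNhd u (Metric.closedBall x R) →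
      u =ᶠ[𝓝 x] 0 → ∀ y ∈ Metric.ball x (ρ * R), u y = 0 := by
  obtain ⟨C, hC0, hC⟩ := exists_gradient_bound E
  -- The bound 1/2 keeps balls of radius R/2 about the segment inside the given ball; the other
  -- bound makes the geometric ratio 2Cte/R at most 1/2.
  refine ⟨min (1 / 2) (1 / (4 * C * Real.exp 1)), by positivity, fun u x R hR hu h0 y hy => ?_⟩
  rcases eq_or_ne y x with rfl | hyx
  · exact h0.self_of_nhds
  set t := ‖y - x‖ with ht
  have ht0 : 0 < t := norm_pos_iff.mpr (sub_ne_zero.mpr hyx)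
  set e := t⁻¹ • (y - x) with he
  have he1 : ‖e‖ = 1 := by
    rw [he, norm_smul, norm_inv, Real.norm_eq_abs, abs_of_pos ht0, ← ht, inv_mul_cancel₀ ht0.ne']
  have hyt : x + t • e = y := by
    rw [he, smul_smul, mul_inv_cancel₀ ht0.ne', one_smul]; abel
  rw [Metric.mem_ball, dist_eq_norm, ← ht] at hy
  have ht1 : t ≤ R / 2 := by
    have := mul_le_mul_of_nonneg_right (min_le_left (1 / 2) (1 / (4 * C * Real.exp 1))) hR.le
    linarith
  have ht2 : t ≤ R / (4 * C * Real.exp 1) := by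
    have := mul_le_mul_of_nonneg_right (min_le_right (1 / 2) (1 / (4 * C * Real.exp 1))) hR.le
    rw [one_div_mul_eq_div] at this
    linarith
  obtain ⟨M, hM⟩ := (isCompact_closedBall x R).exists_bound_of_continuousOn hu.continuousOn
  have hM0 : 0 ≤ M := (norm_nonneg _).trans (hM x (Metric.mem_closedBall_self hR.le))
  have hsub : ∀ s ∈ Icc 0 t, Metric.closedBall (x + s • e) (R / 2) ⊆ Metric.closedBall x R := by
    intro s hs
    refine Metric.closedBall_subset_closedBall' ?_
    rw [dist_eq_norm, add_sub_cancel_left, norm_smul, he1, Real.norm_eq_abs, abs_of_nonneg hs.1]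
    linarith [hs.2]
  -- The width R/2 is divided into k steps of size R/(2k), so (C/δ)^k contributes k^k. This is
  -- absorbed by k! through k^k/k! ≤ e^k.
  have key : ∀ k : ℕ, 0 < k → |u y| ≤ M * (1 / 2) ^ k := by
    intro k hk
    have hk0 : (0 : ℝ) < k := by exact_mod_cast hk
    have hδ : (k : ℝ) * (R / 2 / k) = R / 2 := by field_simp
    have h1 := abs_le_pow_div_factorial_of_gradient_bound hC (x := x) he1 (δ := R / 2 / k)
      (a := t) (by positivity) k u M (by rw [hδ]; exact fun s hs => hu.mono (hsub s hs))
      (by rw [hδ]; exact fun s hs z hz => hM z (hsub s hs hz)) h0 t ⟨ht0.le, le_rfl⟩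
    rw [hyt] at h1
    refine h1.trans ?_
    rw [mul_assoc]
    refine mul_le_mul_of_nonneg_left ?_ hM0
    have h2 : (C / (R / 2 / k)) ^ k * (t ^ k / k.factorial) =
        (2 * C * t / R) ^ k * ((k : ℝ) ^ k / k.factorial) := by
      have : C / (R / 2 / k) = 2 * C / R * k := by field_simp
      rw [this, mul_pow, show 2 * C * t / R = 2 * C / R * t by ring, mul_pow]
      ring
    have h3 := Real.pow_div_factorial_le_exp k hk0.le k
    have h4 : Real.exp k = Real.exp 1 ^ k := by rw [← Real.exp_nat_mul, mul_one]
    rw [h2]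
    calc (2 * C * t / R) ^ k * ((k : ℝ) ^ k / k.factorial)
        ≤ (2 * C * t / R) ^ k * Real.exp 1 ^ k := by rw [← h4]; gcongr
      _ = (2 * C * t / R * Real.exp 1) ^ k := by rw [mul_pow]
      _ ≤ (1 / 2) ^ k := by
        gcongr
        rw [le_div_iff₀ (by positivity)] at ht2
        rw [div_mul_eq_mul_div, div_le_iff₀ hR]
        linarith
  have hlim : Tendsto (fun k : ℕ => M * (1 / 2 : ℝ) ^ k) atTop (𝓝 0) := by
    simpa using (tendsto_pow_atTop_nhds_zero_of_lt_one (r := (1 / 2 : ℝ)) (by norm_num)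
      (by norm_num)).const_mul M
  have := ge_of_tendsto hlim (Filter.eventually_atTop.mpr ⟨1, fun k hk => key k hk⟩)
  exact abs_nonpos_iff.mp this

/-- **Identity theorem** for harmonic functions. -/
theorem InnerProductSpace.HarmonicOnNhd.eventuallyEq_zero_of_isPreconnected [Nontrivial E] {u : E → ℝ} {U : Set E}
    (hu : HarmonicOnNhd u U) (hU : IsPreconnected U) {x : E} (hx : x ∈ U) (h0 : u =ᶠ[𝓝 x] 0)
    {y : E} (hy : y ∈ U) : u =ᶠ[𝓝 y] 0 := by
  obtain ⟨ρ, hρ, hv⟩ := exists_vanishing_ratio E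
  have hopen : IsOpen {y | u =ᶠ[𝓝 y] 0} := isOpen_setOfPred_eventually_nhds
  refine hU.subset_of_closure_inter_subset hopen ⟨x, hx, h0⟩ ?_ hy
  rintro z ⟨hz, hzU⟩
  obtain ⟨R, hR, hRU⟩ := Metric.nhds_basis_closedBall.mem_iff.mp (hu z hzU).eventually
  -- The first radius keeps the ball of radius R/2 about z' inside that about z; the second places z
  -- in the ball about z' where u is forced to vanish.
  have hε : 0 < min (R / 2) (ρ * (R / 2)) := by positivity
  obtain ⟨z', hz', hd⟩ := Metric.mem_closure_iff.mp hz _ hε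
  have hsub : Metric.closedBall z' (R / 2) ⊆ Metric.closedBall z R := by
    refine Metric.closedBall_subset_closedBall' ?_
    have := hd.trans_le (min_le_left _ _)
    rw [dist_comm]
    linarith
  have h1 := hv u z' (R / 2) (by positivity) (fun w hw => hRU (hsub hw)) hz'
  have hzm : z ∈ Metric.ball z' (ρ * (R / 2)) := hd.trans_le (min_le_right _ _)
  filter_upwards [Metric.isOpen_ball.mem_nhds hzm] with w hw using h1 w hw

/-- At a local maximum the Laplacian is not positive. -/
theorem laplacian_nonpos_of_isLocalMax {v : E → ℝ} {x : E} (hv : ContDiffAt ℝ 2 v x)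
    (hmax : IsLocalMax v x) : Δ v x ≤ 0 := by
  rw [laplacian_eq_sum_fderiv (stdOrthonormalBasis ℝ E) hv]
  refine Finset.sum_nonpos fun i _ => ?_
  set e := stdOrthonormalBasis ℝ E i
  by_contra! hpos
  have hline : ∀ t : ℝ, HasDerivAt (fun t : ℝ => x + t • e) e t := fun t => by
    simpa using ((hasDerivAt_id t).smul_const e).const_add x
  have hcont : Continuous (fun t : ℝ => x + t • e) := by fun_prop
  have hx0 : x + (0 : ℝ) • e = x := by simp
  have ht0 : Tendsto (fun t : ℝ => x + t • e) (𝓝 0) (𝓝 x) := by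
    simpa using hcont.tendsto 0
  set g : ℝ → ℝ := fun t => v (x + t • e) with hg
  have hd1 : ∀ᶠ t in 𝓝 (0 : ℝ), deriv g t = fderiv ℝ v (x + t • e) e := by
    filter_upwards [ht0.eventually (hv.eventually (by simp))] with t ht
    exact ((ht.differentiableAt (by norm_num)).hasFDerivAt.comp_hasDerivAt t (hline t)).deriv
  have hd2 : deriv (deriv g) 0 = fderiv ℝ (fun y => fderiv ℝ v y e) x e := by
    have hev : deriv g =ᶠ[𝓝 0] fun t => fderiv ℝ v (x + t • e) e := hd1
    rw [hev.deriv_eq]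
    have h1 : HasFDerivAt (fun y => fderiv ℝ v y e) (fderiv ℝ (fun y => fderiv ℝ v y e) x)
        (x + (0 : ℝ) • e) := by
      rw [hx0]; exact (hv.differentiableAt_fderiv_apply e).hasFDerivAt
    exact (h1.comp_hasDerivAt (0 : ℝ) (hline 0)).deriv
  have hgmax : IsLocalMax g 0 := by
    have : ∀ᶠ t in 𝓝 (0 : ℝ), v (x + t • e) ≤ v x := ht0.eventually hmax
    filter_upwards [this] with t ht
    simpa [hg] using ht
  have hgc : ContinuousAt g 0 := by
    have : ContinuousAt v (x + (0 : ℝ) • e) := by rw [hx0]; exact hv.continuousAt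
    exact ContinuousAt.comp (g := v) this hcont.continuousAt
  -- A critical point with positive second derivative is a local minimum. Being also a local
  -- maximum, g is locally constant, so its second derivative is zero after all.
  have hgmin := isLocalMin_of_deriv_deriv_pos (by rw [hd2]; exact hpos) hgmax.deriv_eq_zero hgc
  have hconst : g =ᶠ[𝓝 0] fun _ => g 0 := by
    filter_upwards [hgmax, hgmin] with t h1 h2 using le_antisymm h1 h2
  have h3 : deriv g =ᶠ[𝓝 0] fun _ => 0 := by
    filter_upwards [hconst.eventuallyEq_nhds] with t ht
    rw [ht.deriv_eq, deriv_const]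
  rw [← hd2, h3.deriv_eq, deriv_const] at hpos
  exact lt_irrefl _ hpos

theorem laplacian_normSq (x : E) : Δ (fun y : E => ‖y‖ ^ 2) x = 2 * Module.finrank ℝ E := by
  have := laplacian_comp_normSq (E := E) (g := id) (x := x) contDiffAt_id
  simpa [Function.id_def] using this

/-- **Weak maximum principle** on a compact set. -/
theorem le_of_harmonic_of_isCompact [Nontrivial E] {u : E → ℝ} {K S : Set E} (hK : IsCompact K)
    (hc : ContinuousOn u K) (h : ∀ x ∈ K, x ∉ S → HarmonicAt u x ∧ K ∈ 𝓝 x) {m : ℝ}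
    (hm : ∀ x ∈ K, x ∈ S → u x ≤ m) : ∀ x ∈ K, u x ≤ m := by
  intro x hx
  by_contra! hlt
  obtain ⟨B, hB⟩ := hK.isBounded.exists_norm_le
  -- Adding ε‖·‖² makes the Laplacian positive off S, which excludes an interior maximum there. The
  -- size of ε keeps the added term below the gap u x - m on K, so a maximum in S is excluded too.
  set ε := (u x - m) / (2 * (B ^ 2 + 1)) with hε
  have hε0 : 0 < ε := div_pos (by linarith) (by positivity)
  have hεB : ε * B ^ 2 < u x - m := by
    rw [hε, div_mul_eq_mul_div, div_lt_iff₀ (by positivity)]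
    nlinarith [sq_nonneg B]
  obtain ⟨z, hz, hzmax⟩ := hK.exists_isMaxOn ⟨x, hx⟩
    (hc.add ((continuous_const.mul (continuous_norm.pow 2)).continuousOn (s := K))
      : ContinuousOn (fun y => u y + ε * ‖y‖ ^ 2) K)
  have hzx : u x + ε * ‖x‖ ^ 2 ≤ u z + ε * ‖z‖ ^ 2 := hzmax hx
  have hzB : ‖z‖ ^ 2 ≤ B ^ 2 := by
    have := hB z hz
    gcongr
  by_cases hzS : z ∈ S
  · have h1 := hm z hz hzS
    have h2 : ε * ‖z‖ ^ 2 ≤ ε * B ^ 2 := by gcongr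
    have h3 : 0 ≤ ε * ‖x‖ ^ 2 := by positivity
    linarith
  · obtain ⟨hzh, hzK⟩ := h z hz hzS
    have hcd : ContDiffAt ℝ 2 (fun y : E => ‖y‖ ^ 2) z := (contDiff_norm_sq ℝ).contDiffAt
    have hcd2 : ContDiffAt ℝ 2 (ε • fun y : E => ‖y‖ ^ 2) z := hcd.const_smul ε
    have h1 := laplacian_nonpos_of_isLocalMax (v := u + ε • fun y : E => ‖y‖ ^ 2) (x := z)
      (hzh.1.add hcd2) (hzmax.isLocalMax hzK)
    rw [hzh.1.laplacian_add hcd2, hzh.2.self_of_nhds, laplacian_smul ε hcd, laplacian_normSq] at h1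
    have hd : (0 : ℝ) < Module.finrank ℝ E := by exact_mod_cast Module.finrank_pos
    have : 0 < ε • (2 * (Module.finrank ℝ E : ℝ)) := by rw [smul_eq_mul]; positivity
    simp only [Pi.zero_apply, zero_add] at h1
    linarith

/-- The time derivative of a smooth family of harmonic functions is harmonic. -/
theorem harmonicOnNhd_time_derivative [Nontrivial E] {F : ℝ × E → ℝ} {J : Set ℝ} {U : Set E}
    (hJ : IsOpen J)
    (hU : IsOpen U) (hF : ∀ τ ∈ J, ∀ x ∈ U, ContDiffAt ℝ 2 F (τ, x))
    (hh : ∀ τ ∈ J, HarmonicOnNhd (fun x => F (τ, x)) U) {τ : ℝ} (hτ : τ ∈ J) :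
    HarmonicOnNhd (fun x => fderiv ℝ F (τ, x) (1, 0)) U := by
  have hWc : ContinuousOn (fun p => fderiv ℝ F p (1, 0)) (J ×ˢ U) := fun p hp =>
    (((hF p.1 hp.1 p.2 hp.2).fderiv_right (m := 0) (by norm_num)).continuousAt.clm_apply
      continuousAt_const).continuousWithinAt
  have hFc : ∀ s ∈ J, ContinuousOn (fun x => F (s, x)) U := fun s hs => (hh s hs).continuousOn
  -- F is only jointly C², so Δ cannot be interchanged with the time derivative pointwise. Instead
  -- the identity ∫ F(s, x) Δζ dx = 0 is differentiated in s, and Weyl's lemma applies.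
  refine IsWeaklyHarmonicOn.harmonicOnNhd hU ?_
    (hWc.comp (by fun_prop) fun x hx => ⟨hτ, hx⟩)
  intro ζ h1 h2 h3
  obtain ⟨ε, hε, hεJ⟩ := Metric.nhds_basis_closedBall.mem_iff.mp (hJ.mem_nhds hτ)
  have hcomp : IsCompact (Metric.closedBall τ ε ×ˢ tsupport ζ) :=
    (isCompact_closedBall τ ε).prod h2
  obtain ⟨C, hC⟩ := hcomp.exists_bound_of_continuousOn
    (hWc.mono (prod_mono hεJ h3))
  have hLc : Continuous (Δ ζ) := continuous_laplacian (h1.of_le ENat.LEInfty.out)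
  have hLs : HasCompactSupport (Δ ζ) :=
    h2.mono' ((subset_tsupport _).trans (tsupport_laplacian_subset ζ))
  have hmul : ∀ f : E → ℝ, ContinuousOn f U → Continuous (fun x => f x * Δ ζ x) := fun f hf =>
    continuous_of_tsupport fun x hx =>
      (hf.continuousAt (hU.mem_nhds (h3 (tsupport_laplacian_subset ζ
        (tsupport_mul_subset_right hx))))).mul hLc.continuousAt
  have hder := hasDerivAt_integral_of_dominated_loc_of_deriv_le (μ := (volume : Measure E))
    (F := fun s x => F (s, x) * Δ ζ x) (F' := fun s x => fderiv ℝ F (s, x) (1, 0) * Δ ζ x)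
    (x₀ := τ) (s := Metric.ball τ ε) (bound := fun x => C * ‖Δ ζ x‖)
    (Metric.ball_mem_nhds τ hε)
    (by
      filter_upwards [hJ.mem_nhds hτ] with s hs
      exact (hmul _ (hFc s hs)).aestronglyMeasurable)
    ((hmul _ (hFc τ hτ)).integrable_of_hasCompactSupport hLs.mul_left)
    (hmul _ (hWc.comp (by fun_prop) fun x hx => ⟨hτ, hx⟩)).aestronglyMeasurable
    (by
      refine Eventually.of_forall fun x s hs => ?_
      rw [norm_mul]
      by_cases hx : x ∈ tsupport ζ
      · exact mul_le_mul_of_nonneg_right (hC (s, x) ⟨Metric.ball_subset_closedBall hs, hx⟩)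
          (norm_nonneg _)
      · rw [image_eq_zero_of_notMem_tsupport fun h => hx (tsupport_laplacian_subset ζ h)]
        simp)
    ((hLc.integrable_of_hasCompactSupport hLs).norm.const_mul C)
    (by
      refine Eventually.of_forall fun x s hs => ?_
      by_cases hx : x ∈ tsupport ζ
      · have h4 : HasDerivAt (fun s : ℝ => ((s, x) : ℝ × E)) (1, 0) s :=
          (hasDerivAt_id s).prodMk (hasDerivAt_const s x)
        have h5 := (hF s (hεJ (Metric.ball_subset_closedBall hs)) x (h3 hx)).differentiableAt
          (by norm_num)
        exact (h5.hasFDerivAt.comp_hasDerivAt s h4).mul_const _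
      · rw [image_eq_zero_of_notMem_tsupport fun h => hx (tsupport_laplacian_subset ζ h)]
        simpa using hasDerivAt_const s (0 : ℝ))
  have hzero : (fun s => ∫ x, F (s, x) * Δ ζ x) =ᶠ[𝓝 τ] fun _ => 0 := by
    filter_upwards [hJ.mem_nhds hτ] with s hs
    exact IsWeaklyHarmonicOn.of_harmonicOnNhd (hh s hs) ζ h1 h2 h3
  exact (hder.2.congr_of_eventuallyEq hzero.symm).unique (hasDerivAt_const τ 0)

/-- Integrals of continuous families of harmonic functions are harmonic. -/
theorem harmonicOnNhd_intervalIntegral [Nontrivial E] {H : ℝ → E → ℝ} {a b : ℝ} {U : Set E}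
    (hU : IsOpen U) (hc : ContinuousOn (fun p : ℝ × E => H p.1 p.2) (uIcc a b ×ˢ U))
    (hh : ∀ σ ∈ uIcc a b, HarmonicOnNhd (H σ) U) :
    HarmonicOnNhd (fun x => ∫ σ in a..b, H σ x) U := by
  -- Clamping time to the interval makes the integrand defined and continuous for every σ, as the
  -- Fubini and parameter-continuity theorems require.
  set π : ℝ → ℝ := fun σ => projIcc (min a b) (max a b) min_le_max σ with hπ
  have hπc : Continuous π := continuous_subtype_val.comp continuous_projIcc
  have hπm : ∀ σ, π σ ∈ uIcc a b := fun σ => (projIcc (min a b) (max a b) min_le_max σ).2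
  have hπe : ∀ σ ∈ uIcc a b, π σ = σ := fun σ hσ => by
    simp only [hπ]; rw [projIcc_of_mem min_le_max hσ]
  have hext : ∀ χ : E → ℝ, Continuous χ → tsupport χ ⊆ U →
      Continuous (fun p : ℝ × E => H (π p.1) p.2 * χ p.2) := by
    intro χ hχ hχU
    rw [continuous_iff_continuousAt]
    rintro ⟨σ, x⟩
    by_cases hx : x ∈ tsupport χ
    · have hg : ContinuousOn (fun p : ℝ × E => H (π p.1) p.2) (univ ×ˢ U) :=
        hc.comp (f := fun p : ℝ × E => (π p.1, p.2)) (by fun_prop) fun p hp => ⟨hπm _, hp.2⟩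
      exact (hg.continuousAt ((isOpen_univ.prod hU).mem_nhds ⟨mem_univ _, hχU hx⟩)).mul
        (hχ.comp continuous_snd).continuousAt
    · have : (fun p : ℝ × E => H (π p.1) p.2 * χ p.2) =ᶠ[𝓝 (σ, x)] fun _ => 0 := by
        have h1 : ∀ᶠ p : ℝ × E in 𝓝 (σ, x), χ p.2 = 0 :=
          (continuous_snd.tendsto (σ, x)).eventually (notMem_tsupport_iff_eventuallyEq.mp hx)
        filter_upwards [h1] with p hp
        rw [hp, mul_zero]
      exact continuousAt_const.congr this.symm
  have hpi : ∀ x, ∫ σ in a..b, H σ x = ∫ σ in a..b, H (π σ) x := fun x =>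
    intervalIntegral.integral_congr fun σ hσ => by simp only [hπe σ hσ]
  refine IsWeaklyHarmonicOn.harmonicOnNhd hU ?_ ?_
  · intro ζ h1 h2 h3
    have hLc : Continuous (Δ ζ) := continuous_laplacian (h1.of_le ENat.LEInfty.out)
    have hLs : HasCompactSupport (Δ ζ) :=
      h2.mono' ((subset_tsupport _).trans (tsupport_laplacian_subset ζ))
    have hG := hext (Δ ζ) hLc ((tsupport_laplacian_subset ζ).trans h3)
    obtain ⟨C, hC⟩ := ((isCompact_uIcc (a := a) (b := b)).prod h2).exists_bound_of_continuousOn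
      (hc.mono (prod_mono Subset.rfl h3))
    have hswap : ∀ α β : ℝ, ∫ x, ∫ σ in Ioc α β, H (π σ) x * Δ ζ x =
        ∫ σ in Ioc α β, ∫ x, H (π σ) x * Δ ζ x := by
      intro α β
      refine integral_integral_swap (f := fun x σ => H (π σ) x * Δ ζ x) ?_
      have hb : Integrable (fun p : E × ℝ => ‖Δ ζ p.1‖ * C)
          ((volume : Measure E).prod (volume.restrict (Ioc α β))) :=
        (hLc.integrable_of_hasCompactSupport hLs).norm.mul_prod (integrable_const C)
      refine hb.mono' (hG.comp continuous_swap).aestronglyMeasurable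
        (Eventually.of_forall fun p => ?_)
      change ‖H (π p.2) p.1 * Δ ζ p.1‖ ≤ _
      rw [norm_mul, mul_comm]
      by_cases hx : p.1 ∈ tsupport ζ
      · exact mul_le_mul_of_nonneg_left (hC (π p.2, p.1) ⟨hπm _, hx⟩) (norm_nonneg _)
      · rw [image_eq_zero_of_notMem_tsupport fun h => hx (tsupport_laplacian_subset ζ h)]
        simp
    have hz : ∀ σ, ∫ x, H (π σ) x * Δ ζ x = 0 := fun σ =>
      IsWeaklyHarmonicOn.of_harmonicOnNhd (hh (π σ) (hπm σ)) ζ h1 h2 h3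
    have e1 : ∀ x, (∫ σ in a..b, H σ x) * Δ ζ x = ∫ σ in a..b, H (π σ) x * Δ ζ x := by
      intro x
      rw [hpi, intervalIntegral.integral_mul_const]
    simp only [e1]
    rcases le_total a b with hab | hab
    · simp only [intervalIntegral.integral_of_le hab]
      rw [hswap]; simp [hz]
    · simp only [intervalIntegral.integral_of_ge hab]
      rw [integral_neg, hswap]; simp [hz]
  · intro x hx
    -- Continuity is local: a cutoff equal to 1 near x makes the integrand continuous everywhere
    -- without changing the integral near x.
    obtain ⟨χ, hχ, -, hχU, hχ1, -⟩ := exists_smooth_cutoff (isCompact_singleton (x := x)) hU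
      (singleton_subset_iff.mpr hx)
    rw [nhdsSet_singleton] at hχ1
    have h1 : Continuous (fun x => ∫ σ in a..b, H (π σ) x * χ x) :=
      intervalIntegral.continuous_parametric_intervalIntegral_of_continuous'
        (f := fun x σ => H (π σ) x * χ x) ((hext χ hχ.continuous hχU).comp continuous_swap) a b
    refine (h1.continuousAt.congr ?_).continuousWithinAt
    filter_upwards [hχ1] with y hy
    simp only [hy, mul_one, hpi]

end HarmonicPrinciples
end


/-! ### Gluing across a hypersurface with zero Cauchy data. -/

noncomputable section
section Gluing

open scoped Laplacian ContDiff

variable {E : Type*} [NormedAddCommGroup E] [InnerProductSpace ℝ E] [FiniteDimensional ℝ E]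
  [MeasurableSpace E] [BorelSpace E]

/-- Used twice below: for the function extended by zero, and for its derivative extended by zero. -/
theorem continuousAt_of_tendsto_nhdsWithin_neg {F : Type*} [NormedAddCommGroup F] {g : E → F}
    {φ : E → ℝ} {x : E} (hφ : ContinuousAt φ x) (hx : 0 ≤ φ x)
    (h0 : ∀ᶠ y in 𝓝 x, 0 ≤ φ y → g y = 0)
    (hl : φ x = 0 → Tendsto g (𝓝[{y | φ y < 0}] x) (𝓝 0)) : ContinuousAt g x := by
  have hgx : g x = 0 := h0.self_of_nhds hx
  rw [ContinuousAt, hgx]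
  rcases hx.lt_or_eq with hpos | hzero
  · refine tendsto_const_nhds.congr' ?_
    filter_upwards [h0, hφ.eventually (lt_mem_nhds hpos)] with y h1 h2 using (h1 h2.le).symm
  · have h1 := hl hzero.symm
    have h2 : Tendsto g (𝓝[{y | φ y < 0}ᶜ] x) (𝓝 0) := by
      refine tendsto_const_nhds.congr' ?_
      filter_upwards [h0.filter_mono nhdsWithin_le_nhds, self_mem_nhdsWithin] with y h3 h4
      exact (h3 (not_lt.mp h4)).symm
    have := h1.sup h2
    rwa [← nhdsWithin_union, union_compl_self, nhdsWithin_univ] at this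

/-- A function on the complement of a hypersurface `{φ = 0}`, harmonic on the side `{φ < 0}`, with
zero Cauchy data there, and zero on the other side, is harmonic across the hypersurface. -/
theorem harmonicAt_of_zero_cauchy_data [Nontrivial E] {q φ : E → ℝ} {z : E}
    (hφ : ContDiffAt ℝ 1 φ z)
    (hgrad : fderiv ℝ φ z ≠ 0) (hneg : ∀ᶠ x in 𝓝 z, φ x < 0 → HarmonicAt q x)
    (hpos : ∀ᶠ x in 𝓝 z, 0 ≤ φ x → q x = 0)
    (hlim : ∀ᶠ y in 𝓝 z, φ y = 0 → Tendsto q (𝓝[{x | φ x < 0}] y) (𝓝 0) ∧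
      Tendsto (fderiv ℝ q) (𝓝[{x | φ x < 0}] y) (𝓝 0)) : HarmonicAt q z := by
  -- A fixed direction transversal to the hypersurface; near z, φ grows along it at a rate above c.
  obtain ⟨e, he⟩ : ∃ e, 0 < fderiv ℝ φ z e := by
    obtain ⟨v, hv⟩ : ∃ v, fderiv ℝ φ z v ≠ 0 := by
      by_contra! h; exact hgrad (ContinuousLinearMap.ext h)
    rcases lt_or_gt_of_ne hv with h | h
    · exact ⟨-v, by rw [map_neg]; linarith⟩
    · exact ⟨v, h⟩
  set c := fderiv ℝ φ z e / 2 with hc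
  have hc0 : 0 < c := by positivity
  have hder : ∀ᶠ x in 𝓝 z, c < fderiv ℝ φ x e := by
    have : ContinuousAt (fun x => fderiv ℝ φ x e) z :=
      ((hφ.fderiv_right (m := 0) (by norm_num)).continuousAt).clm_apply continuousAt_const
    exact this.eventually (lt_mem_nhds (by linarith))
  obtain ⟨R, hR, hB⟩ := Metric.eventually_nhds_iff_ball.mp
    ((hφ.eventually (by simp)).and (hder.and (hneg.and (hpos.and hlim))))
  set B := Metric.ball z R
  have hBo : IsOpen B := Metric.isOpen_ball
  have hφB : ∀ x ∈ B, ContDiffAt ℝ 1 φ x := fun x hx => (hB x hx).1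
  have hposB : ∀ x ∈ B, ∀ᶠ y in 𝓝 x, 0 ≤ φ y → q y = 0 := fun x hx => by
    filter_upwards [hBo.mem_nhds hx] with y hy using (hB y hy).2.2.2.1
  have hqc : ContinuousOn q B := fun x hx => by
    refine ContinuousAt.continuousWithinAt ?_
    rcases lt_or_ge (φ x) 0 with h | h
    · exact ((hB x hx).2.2.1 h).1.continuousAt
    · exact continuousAt_of_tendsto_nhdsWithin_neg (hφB x hx).continuousAt h (hposB x hx)
        fun h0 => ((hB x hx).2.2.2.2 h0).1
  refine IsWeaklyHarmonicOn.harmonicOnNhd hBo ?_ hqc z (Metric.mem_ball_self hR)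
  intro ζ h1 h2 h3
  set K := tsupport ζ
  obtain ⟨χ, hχ, hχs, hχB, hχ1, hχI⟩ := exists_smooth_cutoff h2 hBo h3
  have hχK : ∀ x ∈ K, χ =ᶠ[𝓝 x] fun _ => 1 := fun x hx => hχ1.filter_mono (nhds_le_nhdsSet hx)
  have hφc : ContinuousOn φ B := fun x hx => (hφB x hx).continuousAt.continuousWithinAt
  -- uniform bounds
  obtain ⟨Cφ, hCφ⟩ := h2.exists_bound_of_continuousOn (f := fderiv ℝ φ) fun x hx =>
    ((hφB x (h3 hx)).fderiv_right (m := 0) (by norm_num)).continuousAt.continuousWithinAt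
  obtain ⟨C1, hC1⟩ := h2.exists_bound_of_continuousOn (f := ζ) h1.continuous.continuousOn
  obtain ⟨C2, hC2⟩ := h2.exists_bound_of_continuousOn (f := fderiv ℝ ζ)
    (h1.continuous_fderiv (by simp)).continuousOn
  have hLc : Continuous (Δ ζ) := continuous_laplacian (h1.of_le ENat.LEInfty.out)
  have hLs : HasCompactSupport (Δ ζ) :=
    h2.mono' ((subset_tsupport _).trans (tsupport_laplacian_subset ζ))
  have hLi : Integrable (Δ ζ) := hLc.integrable_of_hasCompactSupport hLs
  set A := ∫ x, |fderiv ℝ χ x e| with hA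
  set D := (Module.finrank ℝ E : ℝ) * (|Cφ| * (|C2| + |C1|) * (A / c)) + ∫ x, |Δ ζ x| with hD
  have hA0 : 0 ≤ A := integral_nonneg fun x => abs_nonneg _
  have hD0 : 0 ≤ D := add_nonneg (by positivity) (integral_nonneg fun x => abs_nonneg _)
  -- D depends neither on κ nor on the width ε of the layer chosen below, so letting κ tend to zero
  -- finishes the proof.
  suffices hκ : ∀ κ > 0, |∫ x, q x * Δ ζ x| ≤ κ * D by
    refine abs_nonpos_iff.mp (le_of_forall_pos_le_add fun η hη => ?_)
    refine (hκ (η / (D + 1)) (by positivity)).trans ?_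
    rw [zero_add, div_mul_eq_mul_div, div_le_iff₀ (by positivity)]
    nlinarith
  intro κ hκ
  -- the Cauchy data are small near the hypersurface
  obtain ⟨ε, hε, hsmall⟩ : ∃ ε > 0, ∀ x ∈ K, -(2 * ε) < φ x →
      |q x| < κ ∧ (φ x < 0 → ‖fderiv ℝ q x‖ < κ) := by
    classical
    set dq : E → E →L[ℝ] ℝ := fun x => if φ x < 0 then fderiv ℝ q x else 0 with hdq
    have hdqc : ContinuousOn dq B := fun x hx => by
      refine ContinuousAt.continuousWithinAt ?_
      rcases lt_or_ge (φ x) 0 with h | h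
      · have h4 : ∀ᶠ y in 𝓝 x, φ y < 0 := (hφB x hx).continuousAt.eventually (gt_mem_nhds h)
        refine ContinuousAt.congr (f := fderiv ℝ q) ?_ ?_
        · exact (((hB x hx).2.2.1 h).1.fderiv_right (m := 1) (by norm_num)).continuousAt
        · filter_upwards [h4] with y hy; simp [hdq, hy]
      · refine continuousAt_of_tendsto_nhdsWithin_neg (hφB x hx).continuousAt h
          (Eventually.of_forall fun y hy => by simp [hdq, not_lt.mpr hy]) fun h0 => ?_
        refine ((hB x hx).2.2.2.2 h0).2.congr' ?_
        filter_upwards [self_mem_nhdsWithin] with y hy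
        simp only [hdq, if_pos (show φ y < 0 from hy)]
    have hGc : ContinuousOn (fun x => |q x| + ‖dq x‖) K := ((hqc.abs).add hdqc.norm).mono h3
    -- The points of K with data not smaller than κ form a compact set on which φ < 0, since the
    -- data vanish where φ ≥ 0. The maximum of φ on it is therefore negative, and ε is half its
    -- absolute value.
    set K' := K ∩ (fun x => |q x| + ‖dq x‖) ⁻¹' Ici κ
    have hK'c : IsCompact K' := h2.of_isClosed_subset
      (hGc.preimage_isClosed_of_isClosed (isClosed_tsupport ζ) isClosed_Ici) inter_subset_left
    have hout : ∀ x ∈ K, x ∉ K' → |q x| < κ ∧ (φ x < 0 → ‖fderiv ℝ q x‖ < κ) := by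
      intro x hx hx'
      have h4 : |q x| + ‖dq x‖ < κ := not_le.mp fun h => hx' ⟨hx, h⟩
      refine ⟨by linarith [norm_nonneg (dq x)], fun h => ?_⟩
      have : dq x = fderiv ℝ q x := by simp [hdq, h]
      rw [← this]; linarith [abs_nonneg (q x)]
    rcases K'.eq_empty_or_nonempty with hem | hne
    · exact ⟨1, one_pos, fun x hx _ => hout x hx (by simp [hem])⟩
    · obtain ⟨y, hy, hymax⟩ := hK'c.exists_isMaxOn hne
        (hφc.mono (inter_subset_left.trans h3))
      have hy0 : φ y < 0 := by
        by_contra! hge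
        have h5 := hy.2
        simp only [mem_preimage, mem_Ici, (hposB y (h3 hy.1)).self_of_nhds hge, hdq,
          not_lt.mpr hge, if_false, abs_zero, norm_zero, add_zero] at h5
        linarith
      refine ⟨-φ y / 2, by linarith, fun x hx hxφ => hout x hx fun hx' => ?_⟩
      have := hymax hx'
      simp only [mem_ofPred_eq] at this
      linarith
  -- θ is 1 up to -2ε and 0 from -ε on. So θ ∘ φ stays off the hypersurface and varies only in a
  -- layer where the Cauchy data are below κ.
  set θ : ℝ → ℝ := fun s => Real.smoothTransition (-s / ε - 1) with hθ
  have hθs : ContDiff ℝ ∞ θ := Real.smoothTransition.contDiff.comp (by fun_prop)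
  have hθd : Differentiable ℝ θ := hθs.differentiable (by simp)
  have hθ0 : ∀ s, -ε ≤ s → θ s = 0 := fun s hs => by
    refine Real.smoothTransition.zero_of_nonpos ?_
    have : -s / ε ≤ 1 := by rw [div_le_one hε]; linarith
    linarith
  have hθ1 : ∀ s, s ≤ -(2 * ε) → θ s = 1 := fun s hs => by
    refine Real.smoothTransition.one_of_one_le ?_
    have : 2 ≤ -s / ε := by rw [le_div_iff₀ hε]; linarith
    linarith
  have hθI : ∀ s, θ s ∈ Icc 0 1 := fun s =>
    ⟨Real.smoothTransition.nonneg _, Real.smoothTransition.le_one _⟩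
  have hθanti : Antitone θ := fun s t hst => by
    refine Real.smoothTransition.monotone ?_
    gcongr
  have hθ' : ∀ s, 0 ≤ -deriv θ s := fun s => neg_nonneg.mpr hθanti.deriv_nonpos
  have hθ'0 : ∀ s, s < -(2 * ε) ∨ -ε < s → deriv θ s = 0 := by
    rintro s (hs | hs)
    · have : θ =ᶠ[𝓝 s] fun _ => 1 := by
        filter_upwards [Iio_mem_nhds hs] with t ht using hθ1 t (le_of_lt ht)
      rw [this.deriv_eq, deriv_const]
    · have : θ =ᶠ[𝓝 s] fun _ => 0 := by
        filter_upwards [Ioi_mem_nhds hs] with t ht using hθ0 t (le_of_lt ht)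
      rw [this.deriv_eq, deriv_const]
  set f : E → ℝ := fun x => θ (φ x) * χ x with hf
  have hfs : HasCompactSupport f := hχs.mul_left
  have hft : tsupport f ⊆ {x | x ∈ tsupport χ ∧ φ x ≤ -ε} := by
    have hcl : IsClosed (tsupport χ ∩ φ ⁻¹' Iic (-ε)) :=
      (hφc.mono hχB).preimage_isClosed_of_isClosed (isClosed_tsupport χ) isClosed_Iic
    refine closure_minimal (fun x hx => ?_) hcl
    have hx' : θ (φ x) * χ x ≠ 0 := hx
    refine ⟨subset_tsupport _ (right_ne_zero_of_mul hx'), ?_⟩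
    by_contra hgt
    exact left_ne_zero_of_mul hx' (hθ0 _ (le_of_lt (not_le.mp hgt)))
  have hfd : ∀ x ∈ B, HasFDerivAt f (θ (φ x) • fderiv ℝ χ x +
      χ x • (deriv θ (φ x) • fderiv ℝ φ x)) x := fun x hx =>
    ((hθd (φ x)).hasDerivAt.comp_hasFDerivAt x ((hφB x hx).differentiableAt
      (by norm_num)).hasFDerivAt).mul (hχ.differentiable (by simp) x).hasFDerivAt
  have hfC : ContDiff ℝ 1 f := by
    rw [contDiff_iff_contDiffAt]
    intro x
    by_cases hx : x ∈ tsupport χ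
    · exact (ContDiffAt.comp (g := θ) x (hθs.of_le ENat.LEInfty.out).contDiffAt
        (hφB x (hχB hx))).mul (hχ.of_le ENat.LEInfty.out).contDiffAt
    · refine contDiffAt_const (c := (0 : ℝ)).congr_of_eventuallyEq ?_
      filter_upwards [notMem_tsupport_iff_eventuallyEq.mp hx] with y hy
      simp [hf, hy]
  -- total variation of the cutoff
  set T : E → ℝ := fun x => -deriv θ (φ x) * χ x with hT
  have hT0 : ∀ x, 0 ≤ T x := fun x => mul_nonneg (hθ' _) (hχI x).1
  have hTi : Integrable T := by
    refine Continuous.integrable_of_hasCompactSupport (continuous_of_tsupport fun x hx => ?_)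
      hχs.mul_left
    have hx' := hχB (tsupport_mul_subset_right hx)
    exact (ContinuousAt.comp (g := deriv θ) ((hθs.continuous_deriv (by simp)).continuousAt)
      (hφB x hx').continuousAt).neg.mul hχ.continuous.continuousAt
  have hTint : ∫ x, T x ≤ A / c := by
    rw [le_div_iff₀ hc0, mul_comm, ← integral_const_mul]
    have hχi : Integrable (fun x => fderiv ℝ χ x e) :=
      ((hχ.continuous_fderiv (by simp)).clm_apply continuous_const).integrable_of_hasCompactSupport
        (hχs.fderiv_apply ℝ e)
    have hfi : Integrable (fun x => fderiv ℝ f x e) :=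
      ((hfC.continuous_fderiv (by norm_num)).clm_apply
        continuous_const).integrable_of_hasCompactSupport (hfs.fderiv_apply ℝ e)
    -- The derivative of the cutoff along e integrates to zero. As φ grows along e at rate at least
    -- c, the mass of T is at most A/c although T is of size 1/ε: this replaces the area of the
    -- hypersurface.
    have h5 : ∫ x, c * T x ≤ ∫ x, (|fderiv ℝ χ x e| - fderiv ℝ f x e) := by
      refine integral_mono (hTi.const_mul c) (hχi.abs.sub hfi) fun x => ?_
      by_cases hx : x ∈ tsupport χ
      · have hxB := hχB hx
        have h6 : fderiv ℝ f x e = θ (φ x) * fderiv ℝ χ x e - T x * fderiv ℝ φ x e := by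
          rw [(hfd x hxB).fderiv]; simp [hT]; ring
        have h7 : c * T x ≤ T x * fderiv ℝ φ x e := by
          rw [mul_comm]; exact mul_le_mul_of_nonneg_left (hB x hxB).2.1.le (hT0 x)
        have h8 : θ (φ x) * fderiv ℝ χ x e ≤ |fderiv ℝ χ x e| := by
          refine (le_abs_self _).trans ?_
          rw [abs_mul, abs_of_nonneg (hθI _).1]
          exact mul_le_of_le_one_left (abs_nonneg _) (hθI _).2
        change c * T x ≤ |fderiv ℝ χ x e| - fderiv ℝ f x e
        linarith
      · have h6 := notMem_tsupport_iff_eventuallyEq.mp hx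
        have h7 : f =ᶠ[𝓝 x] fun _ => 0 := by
          filter_upwards [h6] with y hy; simp [hf, hy]
        change c * T x ≤ |fderiv ℝ χ x e| - fderiv ℝ f x e
        rw [h7.fderiv_eq, h6.fderiv_eq]
        simp [hT, h6.self_of_nhds]
    rw [integral_sub hχi.abs hfi, integral_fderiv_apply_eq_zero hfC hfs e, sub_zero] at h5
    exact h5
  -- Green's identity
  have hharm : ∀ x ∈ tsupport f, HarmonicAt q x := fun x hx =>
    (hB x (hχB (hft hx).1)).2.2.1 (by linarith [(hft hx).2])
  have hgreen := integral_green_cutoff hfC hfs (fun x hx => (hharm x hx).1)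
    (fun x _ => (h1.of_le ENat.LEInfty.out).contDiffAt (n := 2) (f := ζ))
  have hl : ∀ x, f x * (q x * Δ ζ x - ζ x * Δ q x) = f x * (q x * Δ ζ x) := by
    intro x
    by_cases hx : x ∈ tsupport f
    · rw [(hharm x hx).2.self_of_nhds]; simp
    · rw [image_eq_zero_of_notMem_tsupport hx]; simp
  simp only [hl] at hgreen
  have hterm : ∀ i, |∫ x, fderiv ℝ f x (stdOrthonormalBasis ℝ E i) *
        (q x * fderiv ℝ ζ x (stdOrthonormalBasis ℝ E i) -
          ζ x * fderiv ℝ q x (stdOrthonormalBasis ℝ E i))| ≤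
      κ * (|Cφ| * (|C2| + |C1|) * (A / c)) := by
    intro i
    set b := stdOrthonormalBasis ℝ E i with hb
    have hb1 : ‖b‖ = 1 := (stdOrthonormalBasis ℝ E).norm_eq_one i
    have hap : ∀ l : E →L[ℝ] ℝ, |l b| ≤ ‖l‖ := fun l => by
      have := l.le_opNorm b; rwa [hb1, mul_one] at this
    rw [← Real.norm_eq_abs]
    have h5 : ‖∫ x, fderiv ℝ f x b * (q x * fderiv ℝ ζ x b - ζ x * fderiv ℝ q x b)‖ ≤
        ∫ x, (κ * (|Cφ| * (|C2| + |C1|))) * T x := by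
      refine norm_integral_le_of_norm_le (hTi.const_mul _) (Eventually.of_forall fun x => ?_)
      by_cases hx : x ∈ K
      · have hxB := h3 hx
        have h6 : fderiv ℝ f x b = - (T x * fderiv ℝ φ x b) := by
          rw [(hfd x hxB).fderiv, (hχK x hx).fderiv_eq]; simp [hT]; ring
        by_cases hTx : T x = 0
        · simp [h6, hTx]
        · have hd0 : deriv θ (φ x) ≠ 0 := fun h => hTx (by simp [hT, h])
          have hφ1 : -(2 * ε) ≤ φ x := not_lt.mp fun h => hd0 (hθ'0 _ (Or.inl h))
          have hφ2 : φ x ≤ -ε := not_lt.mp fun h => hd0 (hθ'0 _ (Or.inr h))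
          -- `hsmall` asks for strict inequality; at -2ε itself the derivative of θ is zero by
          -- continuity.
          have hφ3 : -(2 * ε) < φ x := lt_of_le_of_ne hφ1 fun h => hd0 (by
            have hcl : IsClosed {s | deriv θ s = 0} :=
              isClosed_eq (hθs.continuous_deriv (by simp)) continuous_const
            have : closure (Iio (-(2 * ε))) ⊆ {s | deriv θ s = 0} :=
              closure_minimal (fun s hs => hθ'0 s (Or.inl hs)) hcl
            rw [closure_Iio] at this
            exact this (le_of_eq h.symm))
          obtain ⟨hq1, hq2⟩ := hsmall x hx hφ3
          have hq2 := hq2 (by linarith)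
          rw [h6, norm_mul, norm_neg, norm_mul, Real.norm_eq_abs, Real.norm_eq_abs,
            Real.norm_eq_abs, abs_of_nonneg (hT0 x)]
          have h7 : |fderiv ℝ φ x b| ≤ |Cφ| := ((hap _).trans (hCφ x hx)).trans (le_abs_self _)
          have h8 : |fderiv ℝ ζ x b| ≤ |C2| := ((hap _).trans (hC2 x hx)).trans (le_abs_self _)
          have h9 : |ζ x| ≤ |C1| := (hC1 x hx).trans (le_abs_self _)
          have h10 : |fderiv ℝ q x b| ≤ κ := (hap _).trans hq2.le
          have h11 : |q x * fderiv ℝ ζ x b - ζ x * fderiv ℝ q x b| ≤ κ * |C2| + |C1| * κ := by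
            refine (abs_sub _ _).trans ?_
            rw [abs_mul, abs_mul]
            gcongr
          calc T x * |fderiv ℝ φ x b| * |q x * fderiv ℝ ζ x b - ζ x * fderiv ℝ q x b|
              ≤ T x * |Cφ| * (κ * |C2| + |C1| * κ) := by
                have := hT0 x
                gcongr
            _ = _ := by ring
      · have h6 := notMem_tsupport_iff_eventuallyEq.mp hx
        rw [h6.fderiv_eq, h6.self_of_nhds]
        have := hT0 x
        simp
        positivity
    refine h5.trans ?_
    rw [integral_const_mul, mul_assoc, mul_assoc, mul_assoc]
    gcongr
  have hfi : Integrable (fun x => f x * (q x * Δ ζ x)) := by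
    refine Continuous.integrable_of_hasCompactSupport (continuous_of_tsupport fun x hx => ?_)
      hfs.mul_right
    exact hfC.continuous.continuousAt.mul
      ((hharm x (tsupport_mul_subset_left hx)).1.continuousAt.mul hLc.continuousAt)
  have hqi : Integrable (fun x => q x * Δ ζ x) := by
    refine Continuous.integrable_of_hasCompactSupport (continuous_of_tsupport fun x hx => ?_)
      hLs.mul_left
    exact (hqc.continuousAt (hBo.mem_nhds (h3 (tsupport_laplacian_subset ζ
      (tsupport_mul_subset_right hx))))).mul hLc.continuousAt
  have hG : |∫ x, f x * (q x * Δ ζ x)| ≤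
      (Module.finrank ℝ E : ℝ) * (κ * (|Cφ| * (|C2| + |C1|) * (A / c))) := by
    rw [hgreen, abs_neg]
    refine (Finset.abs_sum_le_sum_abs _ _).trans ((Finset.sum_le_sum fun i _ => hterm i).trans ?_)
    simp
  have hdiff : |(∫ x, q x * Δ ζ x) - ∫ x, f x * (q x * Δ ζ x)| ≤ κ * ∫ x, |Δ ζ x| := by
    rw [← integral_sub hqi hfi, ← integral_const_mul, ← Real.norm_eq_abs]
    refine norm_integral_le_of_norm_le (hLi.abs.const_mul κ) (Eventually.of_forall fun x => ?_)
    by_cases hx : x ∈ K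
    · have h5 : f x = θ (φ x) := by simp [hf, (hχK x hx).self_of_nhds]
      rw [h5, Real.norm_eq_abs, show q x * Δ ζ x - θ (φ x) * (q x * Δ ζ x) =
        (1 - θ (φ x)) * q x * Δ ζ x by ring, abs_mul, abs_mul,
        abs_of_nonneg (sub_nonneg.mpr (hθI _).2)]
      refine mul_le_mul_of_nonneg_right ?_ (abs_nonneg _)
      rcases le_or_gt (φ x) (-(2 * ε)) with h6 | h6
      · rw [hθ1 _ h6]; simp [hκ.le]
      · have h7 := (hsmall x hx h6).1
        have h8 := (hθI (φ x)).1
        nlinarith [abs_nonneg (q x)]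
    · rw [image_eq_zero_of_notMem_tsupport fun h => hx (tsupport_laplacian_subset ζ h)]
      simp
  have := abs_sub_abs_le_abs_sub (∫ x, q x * Δ ζ x) (∫ x, f x * (q x * Δ ζ x))
  rw [hD]
  linarith

end Gluing
end


/-! ### Isolated singularities. -/

noncomputable section
section RemovableSingularities

open scoped Laplacian ContDiff

variable {E : Type*} [NormedAddCommGroup E] [InnerProductSpace ℝ E] [FiniteDimensional ℝ E]
  [MeasurableSpace E] [BorelSpace E]

theorem laplacian_mul {f g : E → ℝ} {x : E} (hf : ContDiffAt ℝ 2 f x) (hg : ContDiffAt ℝ 2 g x) :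
    Δ (fun y => f y * g y) x = f x * Δ g x + 2 * ∑ i, fderiv ℝ f x (stdOrthonormalBasis ℝ E i) *
      fderiv ℝ g x (stdOrthonormalBasis ℝ E i) + g x * Δ f x := by
  set b := stdOrthonormalBasis ℝ E
  rw [laplacian_eq_sum_fderiv b (hf.mul hg), laplacian_eq_sum_fderiv b hf,
    laplacian_eq_sum_fderiv b hg, Finset.mul_sum, Finset.mul_sum, Finset.mul_sum,
    ← Finset.sum_add_distrib, ← Finset.sum_add_distrib]
  refine Finset.sum_congr rfl fun i _ => ?_
  have h1 : (fun y => fderiv ℝ (fun y => f y * g y) y (b i)) =ᶠ[𝓝 x]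
      fun y => f y * fderiv ℝ g y (b i) + g y * fderiv ℝ f y (b i) := by
    filter_upwards [hf.eventually (by simp), hg.eventually (by simp)] with y h1 h2
    rw [fderiv_fun_mul (h1.differentiableAt (by norm_num)) (h2.differentiableAt (by norm_num))]
    simp
  have hf1 := (hf.differentiableAt (by norm_num)).hasFDerivAt
  have hg1 := (hg.differentiableAt (by norm_num)).hasFDerivAt
  have hf2 := (hf.differentiableAt_fderiv_apply (b i)).hasFDerivAt
  have hg2 := (hg.differentiableAt_fderiv_apply (b i)).hasFDerivAt
  rw [h1.fderiv_eq]
  have h2 : fderiv ℝ (fun y => f y * fderiv ℝ g y (b i) + g y * fderiv ℝ f y (b i)) x = _ :=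
    ((hf1.mul hg2).add (hg1.mul hf2)).fderiv
  rw [h2]
  simp
  ring

theorem fderiv_comp_smul_apply {f : E → ℝ} {x : E} {a : ℝ} (hf : DifferentiableAt ℝ f (a • x))
    (e : E) : fderiv ℝ (fun y => f (a • y)) x e = a * fderiv ℝ f (a • x) e := by
  have h1 : HasFDerivAt (fun y : E => a • y) (a • (ContinuousLinearMap.id ℝ E)) x :=
    (hasFDerivAt_id x).const_smul a
  have h3 : fderiv ℝ (fun y => f (a • y)) x = _ := (hf.hasFDerivAt.comp x h1).fderiv
  rw [h3]; simp

theorem laplacian_comp_smul {f : E → ℝ} (hf : ContDiff ℝ 2 f) (a : ℝ) (x : E) :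
    Δ (fun y => f (a • y)) x = a ^ 2 * Δ f (a • x) := by
  have h1 : ContDiff ℝ 2 (fun y => f (a • y)) := hf.comp (contDiff_id.const_smul a)
  rw [laplacian_eq_sum_fderiv (stdOrthonormalBasis ℝ E) h1.contDiffAt,
    laplacian_eq_sum_fderiv (stdOrthonormalBasis ℝ E) hf.contDiffAt, Finset.mul_sum]
  refine Finset.sum_congr rfl fun i _ => ?_
  set e := stdOrthonormalBasis ℝ E i
  have h2 : (fun y => fderiv ℝ (fun y => f (a • y)) y e) = fun y =>
      a * (fun z => fderiv ℝ f z e) (a • y) :=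
    funext fun y => fderiv_comp_smul_apply (hf.differentiable (by norm_num) _) _
  have h3 : DifferentiableAt ℝ (fun z => fderiv ℝ f z e) (a • x) :=
    hf.contDiffAt.differentiableAt_fderiv_apply e
  have h4 : DifferentiableAt ℝ (fun y => (fun z => fderiv ℝ f z e) (a • y)) x :=
    DifferentiableAt.comp (g := fun z => fderiv ℝ f z e) x h3 (by fun_prop)
  rw [h2, fderiv_const_mul h4, smul_apply, smul_eq_mul, fderiv_comp_smul_apply h3]
  ring

theorem integrableOn_inv_norm_pow [Nontrivial E] (r : ℝ) :
    IntegrableOn (fun x : E => (‖x‖ ^ (Module.finrank ℝ E - 1))⁻¹) (Metric.ball 0 r) := by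
  rw [integrableOn_fun_norm_addHaar (μ := (volume : Measure E)) (f := fun y : ℝ => (y ^ (Module.finrank ℝ E - 1))⁻¹)]
  refine (integrableOn_const (C := (1 : ℝ)) (s := Ioo 0 r) (by simp)).congr_fun ?_
    measurableSet_Ioo
  intro y hy
  have : y ^ (Module.finrank ℝ E - 1) ≠ 0 := pow_ne_zero _ hy.1.ne'
  simp [this]

theorem setIntegral_inv_norm_pow [Nontrivial E] {r : ℝ} (hr : 0 ≤ r) :
    ∫ x in Metric.ball (0 : E) r, (‖x‖ ^ (Module.finrank ℝ E - 1))⁻¹ =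
      Module.finrank ℝ E * volume.real (Metric.ball (0 : E) 1) * r := by
  have h1 : ∫ x in Metric.ball (0 : E) r, (‖x‖ ^ (Module.finrank ℝ E - 1))⁻¹ =
      ∫ x : E, (Iio r).indicator (fun y : ℝ => (y ^ (Module.finrank ℝ E - 1))⁻¹) ‖x‖ := by
    rw [← integral_indicator measurableSet_ball]
    congr 1
    ext x
    simp [indicator]
  rw [h1, integral_fun_norm_addHaar]
  have h2 : ∫ y in Ioi (0 : ℝ), y ^ (Module.finrank ℝ E - 1) •
      (Iio r).indicator (fun y : ℝ => (y ^ (Module.finrank ℝ E - 1))⁻¹) y = r := by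
    have h3 : ∀ y ∈ Ioi (0 : ℝ), y ^ (Module.finrank ℝ E - 1) •
      (Iio r).indicator (fun y : ℝ => (y ^ (Module.finrank ℝ E - 1))⁻¹) y =
        (Iio r).indicator (fun _ => (1 : ℝ)) y := by
      intro y hy
      have : y ^ (Module.finrank ℝ E - 1) ≠ 0 := pow_ne_zero _ (ne_of_gt hy)
      by_cases hyr : y < r <;> simp [hyr, this]
    rw [setIntegral_congr_fun measurableSet_Ioi h3, setIntegral_indicator measurableSet_Iio,
      Ioi_inter_Iio]
    simp [hr]
  rw [h2]
  simp [mul_assoc]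

/-- The distributional Laplacian of a function with a weak isolated singularity annihilates the
test functions vanishing at the singularity. -/
theorem integral_mul_laplacian_eq_zero_of_apply_zero [Nontrivial E] {u : E → ℝ} {R : ℝ}
    (hul : LocallyIntegrable u) (hu : IsWeaklyHarmonicOn u (Metric.ball 0 R \ {0}))
    (hdec : Tendsto (fun x => ‖x‖ ^ (Module.finrank ℝ E - 1) * u x) (𝓝[≠] 0) (𝓝 0)) {ζ : E → ℝ}
    (h1 : ContDiff ℝ ∞ ζ) (h2 : HasCompactSupport ζ) (h3 : tsupport ζ ⊆ Metric.ball 0 R)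
    (h0 : ζ 0 = 0) : ∫ x, u x * Δ ζ x = 0 := by
  set d := Module.finrank ℝ E
  have hle2 : (2 : WithTop ℕ∞) ≤ ∞ := ENat.LEInfty.out
  obtain ⟨b, hb, hbs, hbU, hb1, hbI⟩ := exists_smooth_cutoff (isCompact_closedBall (0 : E) 1)
    (Metric.isOpen_ball (x := (0 : E)) (ε := 2)) (Metric.closedBall_subset_ball (by norm_num))
  have hlap : ∀ {g : E → ℝ}, HasCompactSupport g → HasCompactSupport (Δ g) := fun {g} hg =>
    hg.mono' ((subset_tsupport _).trans (tsupport_laplacian_subset g))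
  obtain ⟨M1, hM1⟩ := (hbs.fderiv ℝ).exists_bound_of_continuous (hb.continuous_fderiv (by simp))
  obtain ⟨M2, hM2⟩ := (hlap hbs).exists_bound_of_continuous (continuous_laplacian (hb.of_le hle2))
  obtain ⟨L1, hL1⟩ := (h2.fderiv ℝ).exists_bound_of_continuous (h1.continuous_fderiv (by simp))
  obtain ⟨L2, hL2⟩ := (hlap h2).exists_bound_of_continuous (continuous_laplacian (h1.of_le hle2))
  have hM10 : 0 ≤ M1 := (norm_nonneg _).trans (hM1 0)
  have hM20 : 0 ≤ M2 := (norm_nonneg _).trans (hM2 0)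
  have hL10 : 0 ≤ L1 := (norm_nonneg _).trans (hL1 0)
  have hL20 : 0 ≤ L2 := (norm_nonneg _).trans (hL2 0)
  have hζL : ∀ x, |ζ x| ≤ L1 * ‖x‖ := fun x => by
    have := Convex.norm_image_sub_le_of_norm_fderiv_le (𝕜 := ℝ) (f := ζ) (s := univ) (x := 0)
      (y := x) (fun y _ => h1.differentiable (by simp) y) (fun y _ => hL1 y) convex_univ
      (mem_univ _) (mem_univ _)
    simpa [h0] using this
  set C := L2 + 2 * (d * (M1 * L1)) + 2 * L1 * M2 with hC
  have hC0 : 0 ≤ C := by positivity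
  set c := d * volume.real (Metric.ball (0 : E) 1) with hc
  have hc0 : 0 ≤ c := by positivity
  suffices hκ : ∀ κ > 0, |∫ x, u x * Δ ζ x| ≤ κ * (2 * c * C) by
    refine abs_nonpos_iff.mp (le_of_forall_pos_le_add fun η hη => ?_)
    refine (hκ (η / (2 * c * C + 1)) (by positivity)).trans ?_
    rw [zero_add, div_mul_eq_mul_div, div_le_iff₀ (by positivity)]
    nlinarith
  intro κ hκ
  have hev : ∀ᶠ x in 𝓝[≠] (0 : E), |‖x‖ ^ (d - 1) * u x| < κ := by
    have := hdec.abs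
    rw [abs_zero] at this
    exact this.eventually (gt_mem_nhds hκ)
  obtain ⟨ρ, hρ, hρu⟩ := Metric.mem_nhdsWithin_iff.mp hev
  set ε := min 1 (ρ / 2) with hε
  have hε0 : 0 < ε := by positivity
  have hε1 : ε ≤ 1 := min_le_left _ _
  have hερ : 2 * ε ≤ ρ := by have := min_le_right 1 (ρ / 2); linarith
  set bε : E → ℝ := fun x => b (ε⁻¹ • x) with hbε
  have hbεs : ContDiff ℝ ∞ bε := hb.comp (contDiff_id.const_smul ε⁻¹)
  -- ζ - ψ vanishes near the origin, so only ψ, supported in the ball of radius 2ε, contributes.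
  -- Because ζ 0 = 0, ζ is O(ε) there and Δψ is O(1/ε) instead of O(1/ε²). Since |u| ≤ κ‖x‖^(1-d)
  -- has integral O(κε) over that ball, the contribution is O(κ).
  set ψ : E → ℝ := fun x => bε x * ζ x with hψ
  have hψs : ContDiff ℝ ∞ ψ := hbεs.mul h1
  have hψc : HasCompactSupport ψ := h2.mul_left
  have hbε1 : ∀ᶠ x in 𝓝 (0 : E), bε x = 1 := by
    have h4 : ∀ᶠ x in 𝓝 (0 : E), b x = 1 :=
      hb1.filter_mono (nhds_le_nhdsSet (Metric.mem_closedBall_self zero_le_one))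
    have h5 : Tendsto (fun x : E => ε⁻¹ • x) (𝓝 0) (𝓝 0) := by
      have : Continuous (fun x : E => ε⁻¹ • x) := by fun_prop
      simpa using this.tendsto 0
    exact h5.eventually h4
  have hrem : ∫ x, u x * Δ (ζ - ψ) x = 0 := by
    refine hu (ζ - ψ) (h1.sub hψs) (h2.sub hψc) fun x hx => ⟨?_, ?_⟩
    · have : tsupport (ζ - ψ) ⊆ tsupport ζ := by
        refine closure_mono fun y hy => ?_
        contrapose! hy
        have : ζ y = 0 := by simpa using hy
        simp [hψ, this]
      exact h3 (this hx)
    · rintro rfl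
      refine (notMem_tsupport_iff_eventuallyEq.mpr ?_) hx
      filter_upwards [hbε1] with y hy
      simp [hψ, hy]
  have hi : ∀ {g : E → ℝ}, ContDiff ℝ ∞ g → HasCompactSupport g →
      Integrable (fun x => u x * Δ g x) := fun {g} hg hgc =>
    hul.integrable_mul_of_hasCompactSupport (continuous_laplacian (hg.of_le hle2)) (hlap hgc)
  have hsplit : ∫ x, u x * Δ ζ x = ∫ x, u x * Δ ψ x := by
    rw [← sub_eq_zero, ← integral_sub (hi h1 h2) (hi hψs hψc), ← hrem]
    congr 1
    ext x
    rw [(h1.of_le hle2).contDiffAt.laplacian_sub (hψs.of_le hle2).contDiffAt]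
    ring
  have hψ0 : ∀ x, 2 * ε ≤ ‖x‖ → Δ ψ x = 0 := by
    intro x hx
    refine image_eq_zero_of_notMem_tsupport fun h => ?_
    have h4 : x ∈ tsupport bε := tsupport_mul_subset_left (tsupport_laplacian_subset ψ h)
    have h5 : ε⁻¹ • x ∈ tsupport b :=
      tsupport_comp_subset_preimage (f := fun x : E => ε⁻¹ • x) b (by fun_prop) h4
    have h6 := hbU h5
    rw [mem_ball_zero_iff, norm_smul, norm_inv, Real.norm_eq_abs, abs_of_pos hε0,
      inv_mul_lt_iff₀ hε0] at h6
    linarith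
  have hψC : ∀ x, ‖x‖ ≤ 2 * ε → |Δ ψ x| ≤ C / ε := by
    intro x hx
    have hfd : ∀ e, fderiv ℝ bε x e = ε⁻¹ * fderiv ℝ b (ε⁻¹ • x) e := fun e =>
      fderiv_comp_smul_apply (hb.differentiable (by simp) _) e
    rw [laplacian_mul (hbεs.of_le hle2).contDiffAt (h1.of_le hle2).contDiffAt,
      show Δ bε x = (ε⁻¹) ^ 2 * Δ b (ε⁻¹ • x) from laplacian_comp_smul (hb.of_le hle2) _ _]
    have hap : ∀ (l : E →L[ℝ] ℝ) (i : Fin d), |l (stdOrthonormalBasis ℝ E i)| ≤ ‖l‖ := fun l i => by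
      have := l.le_opNorm (stdOrthonormalBasis ℝ E i)
      rwa [(stdOrthonormalBasis ℝ E).norm_eq_one i, mul_one] at this
    have t1 : |bε x * Δ ζ x| ≤ L2 := by
      rw [abs_mul, abs_of_nonneg (hbI _).1]
      exact (mul_le_of_le_one_left (abs_nonneg _) (hbI _).2).trans (hL2 x)
    have t2 : |2 * ∑ i, fderiv ℝ bε x (stdOrthonormalBasis ℝ E i) *
        fderiv ℝ ζ x (stdOrthonormalBasis ℝ E i)| ≤ 2 * (d * (M1 * L1)) / ε := by
      rw [abs_mul, abs_two, mul_div_assoc]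
      refine mul_le_mul_of_nonneg_left ?_ zero_le_two
      refine (Finset.abs_sum_le_sum_abs _ _).trans ((Finset.sum_le_card_nsmul _ _ (M1 * L1 / ε)
        fun i _ => ?_).trans (by simp [d, mul_div_assoc]))
      rw [hfd, abs_mul, abs_mul, abs_of_pos (inv_pos.mpr hε0), div_eq_inv_mul, mul_assoc]
      have := (hap (fderiv ℝ b (ε⁻¹ • x)) i).trans (hM1 _)
      have := (hap (fderiv ℝ ζ x) i).trans (hL1 _)
      gcongr
    have t3 : |ζ x * ((ε⁻¹) ^ 2 * Δ b (ε⁻¹ • x))| ≤ 2 * L1 * M2 / ε := by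
      rw [abs_mul, abs_mul, abs_of_nonneg (by positivity : (0:ℝ) ≤ (ε⁻¹) ^ 2)]
      have h4 : |ζ x| ≤ L1 * (2 * ε) := (hζL x).trans (by gcongr)
      have h5 : |Δ b (ε⁻¹ • x)| ≤ M2 := hM2 _
      calc _ ≤ L1 * (2 * ε) * ((ε⁻¹) ^ 2 * M2) := by gcongr
        _ = _ := by field_simp
    have t4 : L2 ≤ L2 / ε := by
      rw [le_div_iff₀ hε0]; exact mul_le_of_le_one_right hL20 hε1
    refine (abs_add_le _ _).trans ((add_le_add_left (abs_add_le _ _) _).trans ?_)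
    rw [hC, add_div, add_div]
    linarith
  rw [hsplit]
  have hsupp : ∫ x, u x * Δ ψ x = ∫ x in Metric.ball 0 (2 * ε), u x * Δ ψ x := by
    rw [setIntegral_eq_integral_of_forall_compl_eq_zero]
    intro x hx
    rw [hψ0 x (by simpa using hx), mul_zero]
  rw [hsupp, ← Real.norm_eq_abs]
  have hbound : ‖∫ x in Metric.ball (0 : E) (2 * ε), u x * Δ ψ x‖ ≤
      ∫ x in Metric.ball (0 : E) (2 * ε), (κ * (C / ε)) * (‖x‖ ^ (d - 1))⁻¹ := by
    refine norm_integral_le_of_norm_le ((integrableOn_inv_norm_pow (2 * ε)).const_mul _) ?_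
    filter_upwards [ae_restrict_mem measurableSet_ball,
      ae_restrict_of_ae (compl_mem_ae_iff.mpr (measure_singleton (μ := (volume : Measure E)) 0))]
      with x hx hx0
    rw [mem_ball_zero_iff] at hx
    have hxpos : 0 < ‖x‖ := norm_pos_iff.mpr hx0
    have h4 : |‖x‖ ^ (d - 1) * u x| < κ := hρu ⟨by rw [mem_ball_zero_iff]; linarith, hx0⟩
    rw [abs_mul, abs_of_pos (pow_pos hxpos _)] at h4
    have h5 : |u x| ≤ κ * (‖x‖ ^ (d - 1))⁻¹ := by
      rw [← div_eq_mul_inv, le_div_iff₀ (pow_pos hxpos _)]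
      linarith
    rw [norm_mul, Real.norm_eq_abs, Real.norm_eq_abs]
    calc _ ≤ κ * (‖x‖ ^ (d - 1))⁻¹ * (C / ε) := by
          gcongr
          exact hψC x hx.le
      _ = _ := by ring
  refine hbound.trans (le_of_eq ?_)
  rw [integral_const_mul, setIntegral_inv_norm_pow (by positivity), ← hc]
  field_simp

theorem integrableOn_closedBall_of_decay [Nontrivial E] {v : E → ℝ} {R : ℝ}
    (hv : ContinuousOn v (Metric.closedBall 0 R \ {0}))
    (hdec : Tendsto (fun x => ‖x‖ ^ (Module.finrank ℝ E - 1) * v x) (𝓝[≠] 0) (𝓝 0)) :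
    IntegrableOn v (Metric.closedBall 0 R) := by
  have hev : ∀ᶠ x in 𝓝[≠] (0 : E), |‖x‖ ^ (Module.finrank ℝ E - 1) * v x| < 1 := by
    have := hdec.abs
    rw [abs_zero] at this
    exact this.eventually (gt_mem_nhds one_pos)
  obtain ⟨ρ, hρ, hρu⟩ := Metric.mem_nhdsWithin_iff.mp hev
  have hsub : Metric.closedBall (0 : E) R ⊆ (Metric.closedBall 0 R \ {0}) ∪ {0} := by
    intro x hx
    by_cases h : x = 0
    · exact Or.inr h
    · exact Or.inl ⟨hx, h⟩
  have hmeas : AEStronglyMeasurable v (volume.restrict (Metric.closedBall (0 : E) R \ {0})) :=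
    hv.aestronglyMeasurable (measurableSet_closedBall.diff (measurableSet_singleton _))
  have h1 : IntegrableOn v ((Metric.closedBall 0 R \ {0}) ∩ Metric.ball 0 ρ) := by
    refine ((integrableOn_inv_norm_pow ρ).mono_set inter_subset_right).mono'
      (hmeas.mono_set inter_subset_left) ?_
    filter_upwards [ae_restrict_mem ((measurableSet_closedBall.diff
      (measurableSet_singleton _)).inter measurableSet_ball)] with x hx
    have hxpos : 0 < ‖x‖ := norm_pos_iff.mpr hx.1.2
    have h4 : |‖x‖ ^ (Module.finrank ℝ E - 1) * v x| < 1 := hρu ⟨hx.2, hx.1.2⟩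
    rw [abs_mul, abs_of_pos (pow_pos hxpos _)] at h4
    rw [Real.norm_eq_abs, ← one_div, le_div_iff₀ (pow_pos hxpos _)]
    linarith
  have h2 : IntegrableOn v (Metric.closedBall 0 R \ Metric.ball 0 ρ) := by
    refine (hv.mono fun x hx => ⟨hx.1, ?_⟩).integrableOn_compact
      ((isCompact_closedBall 0 R).diff Metric.isOpen_ball)
    rintro rfl
    exact hx.2 (Metric.mem_ball_self hρ)
  have h3 : IntegrableOn v ({0} : Set E) := by
    rw [IntegrableOn, Measure.restrict_singleton, measure_singleton, zero_smul]
    exact integrable_zero_measure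
  refine ((h1.union h2).union h3).mono_set fun x hx => ?_
  rcases hsub hx with h | h
  · by_cases hxρ : x ∈ Metric.ball (0 : E) ρ
    · exact Or.inl (Or.inl ⟨h, hxρ⟩)
    · exact Or.inl (Or.inr ⟨hx, hxρ⟩)
  · exact Or.inr h

/-- **Removable singularities**: an isolated singularity of lower order than that of a function
`K` harmonic off the origin, which tends to infinity there, is removable. -/
theorem exists_harmonicAt_extension [Nontrivial E] {K v : E → ℝ}
    (hK : HarmonicOnNhd K {0}ᶜ)
    (hKtop : Tendsto K (𝓝[≠] 0) atTop)
    (hKdec : Tendsto (fun x => ‖x‖ ^ (Module.finrank ℝ E - 1) * K x) (𝓝[≠] 0) (𝓝 0))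
    (hv : ∀ᶠ x in 𝓝[≠] 0, HarmonicAt v x) (hvK : v =o[𝓝[≠] 0] K) :
    ∃ g, HarmonicAt g 0 ∧ v =ᶠ[𝓝[≠] 0] g := by
  have hvdec : Tendsto (fun x => ‖x‖ ^ (Module.finrank ℝ E - 1) * v x) (𝓝[≠] 0) (𝓝 0) := by
    have h1 : (fun x => ‖x‖ ^ (Module.finrank ℝ E - 1) * v x) =O[𝓝[≠] 0]
        fun x => ‖x‖ ^ (Module.finrank ℝ E - 1) * K x := (isBigO_refl _ _).mul hvK.isBigO
    exact h1.trans_tendsto hKdec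
  obtain ⟨R', hR', hball⟩ := Metric.mem_nhdsWithin_iff.mp hv
  set R := R' / 2 with hRdef
  have hR : 0 < R := by positivity
  have hvR : HarmonicOnNhd v (Metric.closedBall 0 R \ {0}) := fun x hx =>
    hball ⟨Metric.closedBall_subset_ball (by linarith) hx.1, hx.2⟩
  have hKR : HarmonicOnNhd K (Metric.closedBall 0 R \ {0}) := fun x hx => hK x hx.2
  set ind : (E → ℝ) → E → ℝ := fun f => (Metric.closedBall 0 R).indicator f with hind
  have hli : ∀ {f : E → ℝ}, HarmonicOnNhd f (Metric.closedBall 0 R \ {0}) →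
      Tendsto (fun x => ‖x‖ ^ (Module.finrank ℝ E - 1) * f x) (𝓝[≠] 0) (𝓝 0) →
      LocallyIntegrable (ind f) := fun hf hd =>
    ((integrableOn_closedBall_of_decay hf.continuousOn hd).integrable_indicator
      measurableSet_closedBall).locallyIntegrable
  have hwk : ∀ {f : E → ℝ}, HarmonicOnNhd f (Metric.closedBall 0 R \ {0}) →
      IsWeaklyHarmonicOn (ind f) (Metric.ball 0 R \ {0}) := fun hf =>
    (IsWeaklyHarmonicOn.of_harmonicOnNhd (hf.mono (sdiff_subset_sdiff_left
      Metric.ball_subset_closedBall))).congr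
      ((eqOn_indicator_ball _ 0 R).mono sdiff_subset)
  have hdi : ∀ {f : E → ℝ},
      Tendsto (fun x => ‖x‖ ^ (Module.finrank ℝ E - 1) * f x) (𝓝[≠] 0) (𝓝 0) →
      Tendsto (fun x => ‖x‖ ^ (Module.finrank ℝ E - 1) * ind f x) (𝓝[≠] 0) (𝓝 0) := fun {f} hd => by
    refine hd.congr' ?_
    filter_upwards [nhdsWithin_le_nhds (Metric.ball_mem_nhds (0 : E) hR)] with x hx
    change _ = _ * (Metric.closedBall 0 R).indicator f x
    rw [← eqOn_indicator_ball f 0 R hx]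
  obtain ⟨η, hη, hηs, hηU, hη1, -⟩ := exists_smooth_cutoff (isCompact_singleton (x := (0 : E)))
    (Metric.isOpen_ball (x := (0 : E)) (ε := R))
    (singleton_subset_iff.mpr (Metric.mem_ball_self hR))
  rw [nhdsSet_singleton] at hη1
  have hη0 : η 0 = 1 := hη1.self_of_nhds
  have hle2 : (2 : WithTop ℕ∞) ≤ ∞ := ENat.LEInfty.out
  have hi : ∀ {u g : E → ℝ}, LocallyIntegrable u → ContDiff ℝ ∞ g → HasCompactSupport g →
      Integrable (fun x => u x * Δ g x) := fun {u g} hul hg hgc =>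
    hul.integrable_mul_of_hasCompactSupport (continuous_laplacian (hg.of_le hle2))
      (hgc.mono' ((subset_tsupport _).trans (tsupport_laplacian_subset g)))
  -- Subtracting ζ 0 • η leaves a test function vanishing at the origin. Hence the distributional
  -- Laplacian of u is a multiple of the Dirac mass, the factor being its value on η.
  have hform : ∀ {u : E → ℝ}, LocallyIntegrable u →
      IsWeaklyHarmonicOn u (Metric.ball 0 R \ {0}) →
      Tendsto (fun x => ‖x‖ ^ (Module.finrank ℝ E - 1) * u x) (𝓝[≠] 0) (𝓝 0) →
      ∀ ζ : E → ℝ, ContDiff ℝ ∞ ζ → HasCompactSupport ζ → tsupport ζ ⊆ Metric.ball 0 R →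
        ∫ x, u x * Δ ζ x = ζ 0 * ∫ x, u x * Δ η x := by
    intro u hul hu hd ζ h1 h2 h3
    have hs : ContDiff ℝ ∞ (ζ 0 • η) := hη.const_smul (ζ 0)
    have hsc : HasCompactSupport (ζ 0 • η) := hηs.smul_left (f := fun _ => ζ 0)
    have h := integral_mul_laplacian_eq_zero_of_apply_zero hul hu hd (h1.sub hs)
      (h2.sub hsc) ((tsupport_sub _ _).trans (union_subset h3
        ((tsupport_smul_subset_right (fun _ => ζ 0) η).trans hηU))) (by simp [hη0])
    rw [← integral_const_mul, ← sub_eq_zero, ← integral_sub (hi hul h1 h2)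
      ((hi hul hη hηs).const_mul _), ← h]
    congr 1
    ext x
    change _ = u x * Δ (ζ - ζ 0 • η) x
    rw [(h1.of_le hle2).contDiffAt.laplacian_sub (hs.of_le hle2).contDiffAt,
      laplacian_smul (ζ 0) (hη.of_le hle2).contDiffAt, smul_eq_mul]
    ring
  have hKf := hform (hli hKR hKdec) (hwk hKR) (hdi hKdec)
  have hvf := hform (hli hvR hvdec) (hwk hvR) (hdi hvdec)
  -- a weakly harmonic function on the ball, harmonic off the origin, has a harmonic extension
  have hweyl : ∀ {f : E → ℝ}, HarmonicOnNhd f (Metric.closedBall 0 R \ {0}) →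
      LocallyIntegrable (ind f) → IsWeaklyHarmonicOn (ind f) (Metric.ball 0 R) →
      ∃ g, HarmonicAt g 0 ∧ f =ᶠ[𝓝[≠] 0] g := by
    intro f hf hfl hfw
    obtain ⟨g, hg, hfg⟩ := hfw.exists_harmonicOnNhd hfl hR
    have h0 : (0 : E) ∈ Metric.ball (0 : E) (R / 2) := Metric.mem_ball_self (by positivity)
    refine ⟨g, hg 0 h0, ?_⟩
    filter_upwards [nhdsWithin_le_nhds (Metric.isOpen_ball.mem_nhds h0), self_mem_nhdsWithin]
      with x hx hx0
    have hxR : x ∈ Metric.ball (0 : E) R := Metric.ball_subset_ball (by linarith) hx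
    rw [eqOn_indicator_ball f 0 R hxR]
    refine hfg x hx ?_
    refine (hf x ⟨Metric.ball_subset_closedBall hxR, hx0⟩).1.continuousAt.congr ?_
    exact (eqOn_indicator_ball f 0 R).eventuallyEq_of_mem (Metric.isOpen_ball.mem_nhds hxR)
  have hbdd : ∀ {g : E → ℝ}, HarmonicAt g 0 → ¬ K =ᶠ[𝓝[≠] 0] g := by
    intro g hg h
    have h1 := hKtop.congr' h
    exact not_tendsto_nhds_of_tendsto_atTop h1 (g 0)
      (hg.1.continuousAt.tendsto.mono_left nhdsWithin_le_nhds)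
  set cK := ∫ x, ind K x * Δ η x with hcK
  set cv := ∫ x, ind v x * Δ η x with hcv
  -- With factor zero, K would extend harmonically and so stay bounded near the origin. Nonvanishing
  -- is all that is needed; the value of the factor is never computed.
  have hcK0 : cK ≠ 0 := by
    intro h0
    obtain ⟨g, hg, hKg⟩ := hweyl hKR (hli hKR hKdec) fun ζ h1 h2 h3 => by
      rw [hKf ζ h1 h2 h3, h0, mul_zero]
    exact hbdd hg hKg
  -- This choice cancels the two Dirac masses, so v - aK extends harmonically. Then aK is the
  -- difference of v = o(K) and a bounded function, which forces a = 0.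
  set a := cv / cK with ha
  set f : E → ℝ := v - a • K with hf
  have hfR : HarmonicOnNhd f (Metric.closedBall 0 R \ {0}) := hvR.sub hKR.const_smul
  have hfdec : Tendsto (fun x => ‖x‖ ^ (Module.finrank ℝ E - 1) * f x) (𝓝[≠] 0) (𝓝 0) := by
    have := hvdec.sub (hKdec.const_mul a)
    rw [mul_zero, sub_zero] at this
    refine this.congr fun x => ?_
    simp [hf]; ring
  have hindf : ∀ x, ind f x = ind v x - a * ind K x := by
    intro x
    by_cases hx : x ∈ Metric.closedBall (0 : E) R
    · simp only [hind, indicator_of_mem hx]; simp [hf]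
    · simp only [hind, indicator_of_notMem hx]; simp
  obtain ⟨g, hg, hfg⟩ := hweyl hfR (hli hfR hfdec) fun ζ h1 h2 h3 => by
    have h4 : ∀ x, ind f x * Δ ζ x = ind v x * Δ ζ x - a * (ind K x * Δ ζ x) := fun x => by
      rw [hindf]; ring
    simp only [h4]
    rw [integral_sub (hi (hli hvR hvdec) h1 h2) ((hi (hli hKR hKdec) h1 h2).const_mul a),
      integral_const_mul, hKf ζ h1 h2 h3, hvf ζ h1 h2 h3, ha]
    field_simp
    ring
  have ha0 : a = 0 := by
    have hgb : g =o[𝓝[≠] 0] K := by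
      have h1 : g =O[𝓝[≠] 0] fun _ => (1 : ℝ) :=
        (hg.1.continuousAt.tendsto.mono_left nhdsWithin_le_nhds).isBigO_one ℝ
      exact h1.trans_isLittleO ((isLittleO_const_left).mpr
        (Or.inr (tendsto_norm_atTop_atTop.comp hKtop)))
    have h2 : (fun x => a * K x) =o[𝓝[≠] 0] K := by
      have h3 : (fun x => a * K x) =ᶠ[𝓝[≠] 0] fun x => v x - g x := by
        filter_upwards [hfg] with x hx
        rw [← hx]; simp [hf]
      exact (hvK.sub hgb).congr' h3.symm EventuallyEq.rfl
    by_contra hne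
    have h4 : K =o[𝓝[≠] 0] K := (isLittleO_const_mul_left_iff hne).mp h2
    have h5 := isLittleO_irrefl' (f' := K) (l := 𝓝[≠] (0 : E)) (by
      refine (Eventually.frequently ?_)
      filter_upwards [hKtop.eventually (eventually_gt_atTop 0)] with x hx
      exact (norm_pos_iff.mpr hx.ne').ne')
    exact h5 h4
  refine ⟨g, hg, ?_⟩
  filter_upwards [hfg] with x hx
  rw [← hx]
  simp [hf, ha0]

end RemovableSingularities
end


/-! ### The fundamental solution and the maximum principle on unbounded sets. -/

noncomputable section
section FundamentalSolution

open scoped Laplacian ContDiff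

section Generic

variable {E : Type*} [NormedAddCommGroup E] [InnerProductSpace ℝ E] [FiniteDimensional ℝ E]

/-- In the variable s = ‖x‖² the Laplace equation for radial functions is the ordinary differential
equation 4s g'' + 2d g' = 0, solved by log s for d = 2 and by s^(-k/2) for d = k + 2. -/
theorem harmonicAt_comp_normSq {g g' g'' : ℝ → ℝ} (h1 : ∀ s > 0, HasDerivAt g (g' s) s)
    (h2 : ∀ s > 0, HasDerivAt g' (g'' s) s) (hg : ∀ s > 0, ContDiffAt ℝ 2 g s)
    (h0 : ∀ s > 0, 4 * s * g'' s + 2 * Module.finrank ℝ E * g' s = 0) {x : E} (hx : x ≠ 0) :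
    HarmonicAt (fun y : E => g (‖y‖ ^ 2)) x := by
  have hpos : ∀ y : E, y ≠ 0 → 0 < ‖y‖ ^ 2 := fun y hy => by positivity
  refine ⟨(hg _ (hpos x hx)).comp x (contDiff_norm_sq ℝ).contDiffAt, ?_⟩
  filter_upwards [isOpen_ne.mem_nhds hx] with y hy
  have hy0 := hpos y hy
  have h3 : deriv g =ᶠ[𝓝 (‖y‖ ^ 2)] g' := by
    filter_upwards [Ioi_mem_nhds hy0] with s hs using (h1 s hs).deriv
  rw [laplacian_comp_normSq (hg _ hy0), h3.deriv_eq, (h2 _ hy0).deriv, (h1 _ hy0).deriv,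
    h0 _ hy0]
  rfl

theorem harmonicAt_log_norm_of_finrank_eq_two (hd : Module.finrank ℝ E = 2) {x : E} (hx : x ≠ 0) :
    HarmonicAt (fun y : E => Real.log ‖y‖) x := by
  have h : (fun y : E => Real.log ‖y‖) = fun y => (fun s => Real.log s / 2) (‖y‖ ^ 2) := by
    ext y; simp
  rw [h]
  refine harmonicAt_comp_normSq (g := fun s => Real.log s / 2) (g' := fun s => s⁻¹ / 2)
    (g'' := fun s => -(s ^ 2)⁻¹ / 2) (fun s hs => (Real.hasDerivAt_log hs.ne').div_const 2)
    (fun s hs => (hasDerivAt_inv hs.ne').div_const 2)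
    (fun s hs => (Real.contDiffAt_log.mpr hs.ne').div_const 2) (fun s hs => ?_) hx
  rw [hd]
  have : s ≠ 0 := ne_of_gt hs
  field_simp
  push_cast
  ring

theorem harmonicAt_inv_norm_pow {k : ℕ} (hd : Module.finrank ℝ E = k + 2) {x : E} (hx : x ≠ 0) :
    HarmonicAt (fun y : E => (‖y‖ ^ k)⁻¹) x := by
  have h : (fun y : E => (‖y‖ ^ k)⁻¹) = fun y => (fun s : ℝ => s ^ (-(k : ℝ) / 2)) (‖y‖ ^ 2) := by
    ext y
    simp only
    rw [← Real.rpow_natCast ‖y‖ 2, ← Real.rpow_mul (norm_nonneg y),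
      show ((2 : ℕ) : ℝ) * (-(k : ℝ) / 2) = -k by push_cast; ring,
      Real.rpow_neg (norm_nonneg y), Real.rpow_natCast]
  rw [h]
  set p : ℝ := -(k : ℝ) / 2 with hp
  refine harmonicAt_comp_normSq (g := fun s => s ^ p) (g' := fun s => p * s ^ (p - 1))
    (g'' := fun s => p * ((p - 1) * s ^ (p - 1 - 1)))
    (fun s hs => Real.hasDerivAt_rpow_const (Or.inl (ne_of_gt hs)))
    (fun s hs => (Real.hasDerivAt_rpow_const (Or.inl (ne_of_gt hs))).const_mul p)
    (fun s hs => Real.contDiffAt_rpow_const_of_ne (ne_of_gt hs)) (fun s hs => ?_) hx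
  have hs0 : s ≠ 0 := ne_of_gt hs
  rw [hd, Real.rpow_sub_one hs0 (p - 1)]
  have hk : (k : ℝ) = -2 * p := by rw [hp]; ring
  push_cast
  rw [hk]
  field_simp
  ring

end Generic

section Euclidean

variable {n : ℕ}

theorem fundamentalSolution_const_pos (hn : 2 ≤ n) :
    0 < ((n : ℝ) * volume.real (Metric.ball (0 : EuclideanSpace ℝ (Fin n)) 1))⁻¹ := by
  have h1 : 0 < volume.real (Metric.ball (0 : EuclideanSpace ℝ (Fin n)) 1) :=
    ENNReal.toReal_pos (Metric.measure_ball_pos _ _ one_pos).ne' measure_ball_lt_top.ne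
  have h2 : (0 : ℝ) < n := by exact_mod_cast (by omega : 0 < n)
  positivity

theorem harmonicAt_fundamentalSolution (hn : 2 ≤ n) {x : EuclideanSpace ℝ (Fin n)} (hx : x ≠ 0) :
    HarmonicAt (fundamentalSolution n) x := by
  have hd : Module.finrank ℝ (EuclideanSpace ℝ (Fin n)) = n := finrank_euclideanSpace_fin
  by_cases h2 : n = 2
  · have h := (harmonicAt_log_norm_of_finrank_eq_two (hd.trans h2) hx).const_smul
      (c := -((n : ℝ) * volume.real (Metric.ball (0 : EuclideanSpace ℝ (Fin n)) 1))⁻¹)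
    refine (harmonicAt_congr_nhds (Eventually.of_forall fun y => ?_)).mp h
    simp only [Pi.smul_apply, smul_eq_mul, fundamentalSolution, if_pos h2]
    ring
  · have h := (harmonicAt_inv_norm_pow (k := n - 2) (by omega) hx).const_smul
      (c := ((n : ℝ) * volume.real (Metric.ball (0 : EuclideanSpace ℝ (Fin n)) 1))⁻¹ *
        ((n : ℝ) - 2)⁻¹)
    refine (harmonicAt_congr_nhds (Eventually.of_forall fun y => ?_)).mp h
    simp only [Pi.smul_apply, smul_eq_mul, fundamentalSolution, if_neg h2, mul_inv]
    ring

theorem tendsto_fundamentalSolution (hn : 2 ≤ n) :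
    Tendsto (fundamentalSolution n) (𝓝[≠] 0) atTop := by
  have hc := fundamentalSolution_const_pos hn
  have hnorm : Tendsto (fun x : EuclideanSpace ℝ (Fin n) => ‖x‖) (𝓝[≠] 0) (𝓝[>] 0) :=
    tendsto_norm_nhdsNE_zero
  refine Tendsto.const_mul_atTop hc ?_
  by_cases h2 : n = 2
  · simp only [if_pos h2]
    exact tendsto_neg_atBot_atTop.comp (Real.tendsto_log_nhdsGT_zero.comp hnorm)
  · simp only [if_neg h2]
    have hk : (0 : ℝ) < (n : ℝ) - 2 := by
      have : (2 : ℝ) < n := by exact_mod_cast (by omega : 2 < n)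
      linarith
    have h1 : Tendsto (fun r : ℝ => ((n : ℝ) - 2) * r ^ (n - 2)) (𝓝[>] 0) (𝓝[>] 0) := by
      refine tendsto_nhdsWithin_iff.mpr ⟨?_, ?_⟩
      · have : Continuous (fun r : ℝ => ((n : ℝ) - 2) * r ^ (n - 2)) := by fun_prop
        have h3 := this.tendsto 0
        rw [zero_pow (by omega), mul_zero] at h3
        exact h3.mono_left nhdsWithin_le_nhds
      · filter_upwards [self_mem_nhdsWithin] with r hr
        have : (0 : ℝ) < r := hr
        exact mem_Ioi.mpr (by positivity)
    exact tendsto_inv_nhdsGT_zero.comp (h1.comp hnorm)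

theorem tendsto_norm_pow_mul_fundamentalSolution (hn : 2 ≤ n) :
    Tendsto (fun x : EuclideanSpace ℝ (Fin n) =>
      ‖x‖ ^ (Module.finrank ℝ (EuclideanSpace ℝ (Fin n)) - 1) * fundamentalSolution n x)
      (𝓝[≠] 0) (𝓝 0) := by
  have hd : Module.finrank ℝ (EuclideanSpace ℝ (Fin n)) = n := finrank_euclideanSpace_fin
  rw [hd]
  have hnorm : Tendsto (fun x : EuclideanSpace ℝ (Fin n) => ‖x‖) (𝓝[≠] 0) (𝓝[>] 0) :=
    tendsto_norm_nhdsNE_zero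
  set c := ((n : ℝ) * volume.real (Metric.ball (0 : EuclideanSpace ℝ (Fin n)) 1))⁻¹ with hc
  by_cases h2 : n = 2
  · have h1 : Tendsto (fun r : ℝ => (-c) * (Real.log r * r ^ (1 : ℝ))) (𝓝[>] 0) (𝓝 0) := by
      simpa using (tendsto_log_mul_rpow_nhdsGT_zero one_pos).const_mul (-c)
    refine (h1.comp hnorm).congr fun x => ?_
    simp only [Function.comp, fundamentalSolution, if_pos h2, ← hc, Real.rpow_one]
    rw [show n - 1 = 1 by omega, pow_one]
    ring
  · have h1 : Tendsto (fun r : ℝ => (c * ((n : ℝ) - 2)⁻¹) * r) (𝓝[>] 0) (𝓝 0) := by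
      have : Continuous (fun r : ℝ => (c * ((n : ℝ) - 2)⁻¹) * r) := by fun_prop
      have h3 := this.tendsto 0
      rw [mul_zero] at h3
      exact h3.mono_left nhdsWithin_le_nhds
    refine (h1.comp hnorm).congr' ?_
    filter_upwards [self_mem_nhdsWithin] with x hx
    have hx0 : ‖x‖ ≠ 0 := norm_ne_zero_iff.mpr hx
    simp only [Function.comp, fundamentalSolution, if_neg h2, ← hc]
    rw [show n - 1 = (n - 2) + 1 by omega, pow_succ, mul_inv]
    field_simp

/-- Maximum principle for functions on a closed set that decay at infinity (or stay bounded, in the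
plane, if the closed set omits a disk). -/
theorem le_of_harmonic_of_isBigO (hn : 2 ≤ n) {u : EuclideanSpace ℝ (Fin n) → ℝ}
    {C S : Set (EuclideanSpace ℝ (Fin n))} (hC : IsClosed C)
    (hc : ContinuousOn u C) (h : ∀ x ∈ C, x ∉ S → HarmonicAt u x ∧ C ∈ 𝓝 x) {m : ℝ} (hm0 : 0 ≤ m)
    (hm : ∀ x ∈ C, x ∈ S → u x ≤ m) {a : EuclideanSpace ℝ (Fin n)} {r : ℝ} (hr : 0 < r)
    (ha : ∀ x ∈ C, r ≤ dist x a)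
    (hinf : u =O[Bornology.cobounded (EuclideanSpace ℝ (Fin n)) ⊓ 𝓟 C]
      fun x => (‖x‖ ^ (n - 2))⁻¹) : ∀ x ∈ C, u x ≤ m := by
  have : NeZero n := ⟨by omega⟩
  have hd : Module.finrank ℝ (EuclideanSpace ℝ (Fin n)) = n := finrank_euclideanSpace_fin
  -- reduction to compact sets
  have key : ∀ v : EuclideanSpace ℝ (Fin n) → ℝ, ∀ m' : ℝ, ContinuousOn v C →
      (∀ x ∈ C, x ∉ S → HarmonicAt v x) → (∀ x ∈ C, x ∈ S → v x ≤ m') →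
      (∀ᶠ x in Bornology.cobounded (EuclideanSpace ℝ (Fin n)) ⊓ 𝓟 C, v x ≤ m') →
      ∀ x ∈ C, v x ≤ m' := by
    intro v m' hvc hvh hvm hvi x hx
    rw [eventually_inf_principal, ← comap_norm_atTop, eventually_comap] at hvi
    obtain ⟨ρ, hρ⟩ := Filter.eventually_atTop.mp hvi
    set ρ' := max ρ (‖x‖ + 1)
    refine le_of_harmonic_of_isCompact (K := C ∩ Metric.closedBall 0 ρ')
      (S := S ∪ {y | ρ' ≤ ‖y‖}) ((isCompact_closedBall 0 ρ').inter_left hC)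
      (hvc.mono inter_subset_left) (fun y hy hyS => ?_) (fun y hy hyS => ?_) x ⟨hx, ?_⟩
    · have h1 : y ∉ S := fun h => hyS (Or.inl h)
      have h2 : ‖y‖ < ρ' := not_le.mp fun h => hyS (Or.inr h)
      refine ⟨hvh y hy.1 h1, inter_mem (h y hy.1 h1).2 ?_⟩
      exact mem_of_superset (Metric.isOpen_ball.mem_nhds (mem_ball_zero_iff.mpr h2))
        Metric.ball_subset_closedBall
    · rcases hyS with h1 | h1
      · exact hvm y hy.1 h1
      · exact hρ ‖y‖ ((le_max_left _ _).trans h1) y rfl hy.1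
    · rw [mem_closedBall_zero_iff]
      exact (by linarith : ‖x‖ ≤ ‖x‖ + 1).trans (le_max_right _ _)
  by_cases h2 : n = 2
  · intro x hx
    have hxa : ∀ y ∈ C, 0 < dist y a := fun y hy => hr.trans_le (ha y hy)
    -- In the plane u is only known to be bounded at infinity. L is harmonic on C, nonnegative there
    -- because C omits the disk of radius r about a, and tends to infinity. So u - ηL falls below m
    -- far out, and η is then sent to zero.
    set L : EuclideanSpace ℝ (Fin n) → ℝ := fun y => Real.log ‖y - a‖ - Real.log r with hL
    have hL0 : ∀ y ∈ C, 0 ≤ L y := fun y hy => by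
      have := Real.log_le_log hr (ha y hy)
      rw [dist_eq_norm] at this
      simp only [hL]; linarith
    have hLh : ∀ y ∈ C, HarmonicAt L y := fun y hy => by
      have hy0 : y - a ≠ 0 := by rw [← norm_pos_iff, ← dist_eq_norm]; exact hxa y hy
      exact (harmonicAt_comp_sub_right
        (harmonicAt_log_norm_of_finrank_eq_two (hd.trans h2) hy0)).sub (harmonicAt_const _)
    have hLt : Tendsto L (Bornology.cobounded (EuclideanSpace ℝ (Fin n))) atTop := by
      have h1 : Tendsto (fun y : EuclideanSpace ℝ (Fin n) => ‖y - a‖)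
          (Bornology.cobounded (EuclideanSpace ℝ (Fin n))) atTop :=
        tendsto_atTop_mono (fun y => norm_sub_norm_le y a)
          (tendsto_atTop_add_const_right _ (-‖a‖) tendsto_norm_cobounded_atTop)
      exact tendsto_atTop_add_const_right _ _ (Real.tendsto_log_atTop.comp h1)
    obtain ⟨M, hM⟩ := hinf.bound
    have hM : ∀ᶠ y in Bornology.cobounded (EuclideanSpace ℝ (Fin n)) ⊓ 𝓟 C, u y ≤ M := by
      filter_upwards [hM] with y hy
      rw [show n - 2 = 0 by omega] at hy
      simp only [pow_zero, inv_one, norm_one, mul_one] at hy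
      exact (le_abs_self _).trans hy
    have hη : ∀ η > 0, u x ≤ m + η * L x := by
      intro η hη
      have := key (u - η • L) m (hc.sub fun y hy =>
        ((hLh y hy).1.continuousAt.const_smul η).continuousWithinAt)
        (fun y hy hyS => (h y hy hyS).1.sub (hLh y hy).const_smul)
        (fun y hy hyS => by
          have h1 := hm y hy hyS
          have h2 := mul_nonneg hη.le (hL0 y hy)
          simp only [Pi.sub_apply, Pi.smul_apply, smul_eq_mul]
          linarith)
        (by
          have h1 : ∀ᶠ y in Bornology.cobounded (EuclideanSpace ℝ (Fin n)) ⊓ 𝓟 C,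
              (M - m) / η ≤ L y :=
            (hLt.eventually (eventually_ge_atTop _)).filter_mono inf_le_left
          filter_upwards [h1, hM] with y hy1 hy2
          rw [div_le_iff₀ hη] at hy1
          simp only [Pi.sub_apply, Pi.smul_apply, smul_eq_mul]
          linarith) x hx
      simp only [Pi.sub_apply, Pi.smul_apply, smul_eq_mul] at this
      linarith
    refine le_of_forall_pos_le_add fun δ hδ => (hη (δ / (L x + 1)) (by
      have := hL0 x hx; positivity)).trans ?_
    have := hL0 x hx
    gcongr
    rw [div_mul_eq_mul_div, div_le_iff₀ (by positivity)]
    nlinarith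
  · intro x hx
    refine le_of_forall_pos_le_add fun δ hδ => ?_
    -- For n ≥ 3 the bound itself decays, so u ≤ m + δ far out; this uses 0 ≤ m.
    have hz : Tendsto (fun y : EuclideanSpace ℝ (Fin n) => (‖y‖ ^ (n - 2))⁻¹)
        (Bornology.cobounded (EuclideanSpace ℝ (Fin n)) ⊓ 𝓟 C) (𝓝 0) :=
      (tendsto_inv_atTop_zero.comp ((tendsto_pow_atTop (by omega)).comp
        tendsto_norm_cobounded_atTop)).mono_left inf_le_left
    refine key u (m + δ) hc (fun y hy hyS => (h y hy hyS).1)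
      (fun y hy hyS => (hm y hy hyS).trans (by linarith)) ?_ x hx
    filter_upwards [(hinf.trans_tendsto hz).eventually (gt_mem_nhds (by linarith : (0:ℝ) < m + δ))]
      with y hy using hy.le

theorem abs_le_of_harmonic_of_isBigO (hn : 2 ≤ n) {u : EuclideanSpace ℝ (Fin n) → ℝ}
    {C S : Set (EuclideanSpace ℝ (Fin n))} (hC : IsClosed C)
    (hc : ContinuousOn u C) (h : ∀ x ∈ C, x ∉ S → HarmonicAt u x ∧ C ∈ 𝓝 x) {m : ℝ} (hm0 : 0 ≤ m)
    (hm : ∀ x ∈ C, x ∈ S → |u x| ≤ m) {a : EuclideanSpace ℝ (Fin n)} {r : ℝ} (hr : 0 < r)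
    (ha : ∀ x ∈ C, r ≤ dist x a)
    (hinf : u =O[Bornology.cobounded (EuclideanSpace ℝ (Fin n)) ⊓ 𝓟 C]
      fun x => (‖x‖ ^ (n - 2))⁻¹) : ∀ x ∈ C, |u x| ≤ m := by
  intro x hx
  refine abs_le'.mpr ⟨le_of_harmonic_of_isBigO hn hC hc h hm0
    (fun y hy hyS => (le_abs_self _).trans (hm y hy hyS)) hr ha hinf x hx, ?_⟩
  exact le_of_harmonic_of_isBigO (u := -u) hn hC hc.neg
    (fun y hy hyS => ⟨(h y hy hyS).1.neg, (h y hy hyS).2⟩) hm0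
    (fun y hy hyS => (neg_le_abs _).trans (hm y hy hyS)) hr ha hinf.neg_left x hx

end Euclidean

end FundamentalSolution
end


/-! ### Topology of the moving boundary. -/

noncomputable section
section MovingBoundary

open scoped Laplacian ContDiff

theorem frequently_lt_of_fderiv_ne_zero {E : Type*} [NormedAddCommGroup E] [NormedSpace ℝ E]
    {f : E → ℝ} {x : E} (h : fderiv ℝ f x ≠ 0) : ∃ᶠ y in 𝓝 x, f y < f x := by
  intro h'
  exact h (IsLocalMin.fderiv_eq_zero (h'.mono fun y hy => not_lt.1 hy))

theorem frequently_gt_of_fderiv_ne_zero {E : Type*} [NormedAddCommGroup E] [NormedSpace ℝ E]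
    {f : E → ℝ} {x : E} (h : fderiv ℝ f x ≠ 0) : ∃ᶠ y in 𝓝 x, f x < f y := by
  intro h'
  exact h (IsLocalMax.fderiv_eq_zero (h'.mono fun y hy => not_lt.1 hy))

theorem hasFDerivAt_slice {E F : Type*} [NormedAddCommGroup E] [NormedSpace ℝ E]
    [NormedAddCommGroup F] [NormedSpace ℝ F] {φ : ℝ × E → F} {t : ℝ} {x : E}
    (h : DifferentiableAt ℝ φ (t, x)) :
    HasFDerivAt (fun y => φ (t, y)) ((fderiv ℝ φ (t, x)).comp (.inr ℝ ℝ E)) x :=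
  h.hasFDerivAt.comp x (hasFDerivAt_prodMk_right t x)

theorem fderiv_slice_apply {E F : Type*} [NormedAddCommGroup E] [NormedSpace ℝ E]
    [NormedAddCommGroup F] [NormedSpace ℝ F] {φ : ℝ × E → F} {t : ℝ} {x : E}
    (h : DifferentiableAt ℝ φ (t, x)) (v : E) :
    fderiv ℝ (fun y => φ (t, y)) x v = fderiv ℝ φ (t, x) (0, v) := by
  rw [(hasFDerivAt_slice h).fderiv]; simp

theorem hasDerivAt_slice {E F : Type*} [NormedAddCommGroup E] [NormedSpace ℝ E]
    [NormedAddCommGroup F] [NormedSpace ℝ F] {φ : ℝ × E → F} {t : ℝ} {x : E}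
    (h : DifferentiableAt ℝ φ (t, x)) :
    HasDerivAt (fun τ => φ (τ, x)) (fderiv ℝ φ (t, x) (1, 0)) t := by
  have := (HasFDerivAt.comp (f := fun τ : ℝ => (τ, x)) t h.hasFDerivAt
    (hasFDerivAt_prodMk_left t x)).hasDerivAt
  simpa [Function.comp_def] using this

variable {E : Type*} [NormedAddCommGroup E] [InnerProductSpace ℝ E] [CompleteSpace E]

theorem gradient_ne_zero_iff {f : E → ℝ} {x : E} : gradient f x ≠ 0 ↔ fderiv ℝ f x ≠ 0 := by
  simp [gradient]

/-- From each point of an open set which is not everything, a nearest point of the complement is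
a boundary point. -/
theorem exists_frontier_ball_subset {X : Type*} [NormedAddCommGroup X] [NormedSpace ℝ X]
    [ProperSpace X] {U : Set X} (hU : IsOpen U) {x z : X}
    (hx : x ∈ U) (hz : z ∉ U) :
    ∃ y ∈ frontier U, dist x y ≤ dist x z ∧ 0 < dist x y ∧ Metric.ball x (dist x y) ⊆ U := by
  obtain ⟨y, hy, hxy⟩ := hU.isClosed_compl.exists_infDist_eq_dist ⟨z, hz⟩ x
  have hne : x ≠ y := fun h => hy (h ▸ hx)
  have hsub : Metric.ball x (dist x y) ⊆ U := by
    intro p hp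
    by_contra hpU
    have := Metric.infDist_le_dist_of_mem (x := x) (show p ∈ Uᶜ from hpU)
    rw [hxy, dist_comm x p] at this
    exact absurd hp (by simpa using this)
  refine ⟨y, ?_, ?_, dist_pos.2 hne, hsub⟩
  · rw [hU.frontier_eq]
    refine ⟨closure_mono hsub ?_, hy⟩
    rw [closure_ball x (dist_pos.2 hne).ne', Metric.mem_closedBall, dist_comm]
  · rw [← hxy]; exact Metric.infDist_le_dist_of_mem hz

variable {n : ℕ} {I : Set ℝ} {Ω : ℝ → Set (EuclideanSpace ℝ (Fin n))}
  {φ : ℝ × EuclideanSpace ℝ (Fin n) → ℝ} {t : ℝ} {y : EuclideanSpace ℝ (Fin n)}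

namespace IsDefiningFunction

theorem contDiffAt (h : IsDefiningFunction Ω φ t y) {k : WithTop ℕ∞} : ContDiffAt ℝ k φ (t, y) :=
  h.analytic.contDiffAt

theorem fderiv_slice_ne_zero (h : IsDefiningFunction Ω φ t y) :
    fderiv ℝ (fun x => φ (t, x)) y ≠ 0 :=
  gradient_ne_zero_iff.1 h.gradient_ne_zero

theorem mem_iff_self (h : IsDefiningFunction Ω φ t y) : y ∈ Ω t ↔ φ (t, y) < 0 :=
  h.mem_iff.self_of_nhds

theorem eventually_mem_iff (h : IsDefiningFunction Ω φ t y) :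
    ∀ᶠ x in 𝓝 y, x ∈ Ω t ↔ φ (t, x) < 0 :=
  (show ContinuousAt (fun x => (t, x)) y by fun_prop).eventually h.mem_iff

/-- A nonzero spatial derivative stays nonzero nearby, so one φ serves at all neighbouring
space-time points; this permits differentiation along the moving boundary. -/
theorem eventually (h : IsDefiningFunction Ω φ t y) :
    ∀ᶠ p in 𝓝 (t, y), IsDefiningFunction Ω φ p.1 p.2 := by
  have h1 : ∃ v, fderiv ℝ φ (t, y) (0, v) ≠ 0 := by
    by_contra! hv
    refine h.fderiv_slice_ne_zero (ContinuousLinearMap.ext fun v => ?_)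
    rw [fderiv_slice_apply h.analytic.differentiableAt, hv]; rfl
  obtain ⟨v, hv⟩ := h1
  have h2 : ContinuousAt (fun p => fderiv ℝ φ p (0, v)) (t, y) :=
    (h.contDiffAt.continuousAt_fderiv (n := 1) one_ne_zero).clm_apply continuousAt_const
  filter_upwards [h.analytic.eventually_analyticAt, h2.eventually_ne hv,
    h.mem_iff.eventually_nhds] with p hp1 hp2 hp3
  refine ⟨hp1, gradient_ne_zero_iff.2 fun h0 => hp2 ?_, hp3⟩
  rw [← fderiv_slice_apply (t := p.1) (x := p.2) hp1.differentiableAt, h0]; rfl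

/-- Where φ ≠ 0 its sign is locally constant, so the point is interior or exterior. Where φ = 0 the
nonzero derivative produces nearby points with φ < 0, while the point itself is not in the domain.
-/
theorem mem_frontier_iff (h : IsDefiningFunction Ω φ t y) :
    y ∈ frontier (Ω t) ↔ φ (t, y) = 0 := by
  have hc : ContinuousAt (fun x => φ (t, x)) y :=
    ContinuousAt.comp (f := fun x => (t, x)) h.analytic.continuousAt (by fun_prop)
  rw [frontier, Set.mem_sdiff]
  constructor
  · rintro ⟨hcl, hint⟩
    rw [mem_closure_iff_frequently] at hcl
    rw [mem_interior_iff_mem_nhds] at hint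
    rcases lt_trichotomy (φ (t, y)) 0 with hlt | heq | hgt
    · refine absurd ?_ hint
      filter_upwards [h.eventually_mem_iff, hc.eventually_lt continuousAt_const hlt]
        with x hx hx' using hx.2 hx'
    · exact heq
    · obtain ⟨x, hx1, hx2, hx3⟩ := (hcl.and_eventually (h.eventually_mem_iff.and
        ((continuousAt_const (y := (0 : ℝ))).eventually_lt hc hgt))).exists
      exact absurd (hx2.1 hx1) (not_lt.2 (le_of_lt hx3))
  · intro h0
    constructor
    · rw [mem_closure_iff_frequently]
      refine ((frequently_lt_of_fderiv_ne_zero h.fderiv_slice_ne_zero).and_eventually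
        h.eventually_mem_iff).mono fun x hx => hx.2.2 (h0 ▸ hx.1)
    · intro hint
      have := interior_subset hint
      exact absurd (h.mem_iff_self.1 this) (by simp [h0])

theorem frequently_pos (h : IsDefiningFunction Ω φ t y) (hy : y ∈ frontier (Ω t)) :
    ∃ᶠ x in 𝓝 y, 0 < φ (t, x) := by
  simpa [h.mem_frontier_iff.1 hy] using frequently_gt_of_fderiv_ne_zero h.fderiv_slice_ne_zero

end IsDefiningFunction

namespace IsAnalyticFamily

theorem mem_frontier_spaceTime (hΩ : IsAnalyticFamily I Ω) (ht : t ∈ I)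
    (hy : y ∈ frontier (Ω t)) : (t, y) ∈ frontier (spaceTime I Ω) := by
  rw [(hΩ.isOpen t ht).frontier_eq] at hy
  have hc : Continuous (fun x : EuclideanSpace ℝ (Fin n) => (t, x)) := by fun_prop
  refine ⟨closure_mono ?_ (image_closure_subset_closure_image hc ⟨y, hy.1, rfl⟩),
    fun h => hy.2 (interior_subset h).2⟩
  rintro _ ⟨x, hx, rfl⟩
  exact ⟨ht, hx⟩

theorem exists_defining' (hΩ : IsAnalyticFamily I Ω) (ht : t ∈ I)
    (hy : y ∈ frontier (Ω t)) : ∃ φ, IsDefiningFunction Ω φ t y :=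
  hΩ.exists_defining t ht y (hΩ.mem_frontier_spaceTime ht hy)

/-- Points cannot be lost abruptly. A failure would put (t, y) on the frontier of the space-time
region, where a defining function exists; it is negative at (t, y), hence negative nearby. -/
theorem eventually_mem (hΩ : IsAnalyticFamily I Ω) (ht : t ∈ I) (hy : y ∈ Ω t) :
    ∀ᶠ p in 𝓝 (t, y), p.2 ∈ Ω p.1 := by
  by_contra hcon
  have : (t, y) ∈ frontier (spaceTime I Ω) := by
    refine ⟨subset_closure ⟨ht, hy⟩, fun h => hcon ?_⟩
    filter_upwards [mem_interior_iff_mem_nhds.1 h] with p hp using hp.2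
  obtain ⟨φ, hφ⟩ := hΩ.exists_defining t ht y this
  refine hcon ?_
  filter_upwards [hφ.mem_iff, hφ.analytic.continuousAt.eventually_lt continuousAt_const
    (hφ.mem_iff_self.1 hy)] with p hp hp' using hp.2 hp'

/-- The counterpart for exterior points: no new piece of the domain appears abruptly. A frontier
point of the space-time region over t would have φ < 0, φ = 0 or φ > 0, and each case contradicts
either y ∉ closure (Ω t) or membership in the closure of the region. -/
theorem eventually_notMem_closure (hΩ : IsAnalyticFamily I Ω) (hI : IsOpen I) (ht : t ∈ I)
    (hy : y ∉ closure (Ω t)) : ∀ᶠ p in 𝓝 (t, y), p.2 ∉ closure (Ω p.1) := by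
  have h1 : (t, y) ∉ closure (spaceTime I Ω) := by
    intro hcl
    have hfr : (t, y) ∈ frontier (spaceTime I Ω) :=
      ⟨hcl, fun h => hy (subset_closure (interior_subset h).2)⟩
    obtain ⟨φ, hφ⟩ := hΩ.exists_defining t ht y hfr
    rcases lt_trichotomy (φ (t, y)) 0 with hlt | heq | hgt
    · exact hy (subset_closure (hφ.mem_iff_self.2 hlt))
    · exact hy (frontier_subset_closure (hφ.mem_frontier_iff.2 heq))
    · rw [mem_closure_iff_frequently] at hcl
      obtain ⟨p, hp1, hp2, hp3⟩ := (hcl.and_eventually (hφ.mem_iff.and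
        ((continuousAt_const (y := (0 : ℝ))).eventually_lt hφ.analytic.continuousAt hgt))).exists
      exact absurd (hp2.1 hp1.2) (not_lt.2 (le_of_lt hp3))
  have h2 : ∀ᶠ p in 𝓝 (t, y), p.1 ∈ I ∧ p ∉ spaceTime I Ω :=
    (continuousAt_fst.eventually (hI.mem_nhds ht)).and
      (Filter.Eventually.mono (isClosed_closure.isOpen_compl.mem_nhds h1) fun p hp hp2 => hp (subset_closure hp2))
  filter_upwards [h2.eventually_nhds] with p hp hcl
  rw [mem_closure_iff_frequently] at hcl
  obtain ⟨x, hx, hx'⟩ := (hcl.and_eventually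
    ((show ContinuousAt (fun x => (p.1, x)) p.2 by fun_prop).eventually hp)).exists
  exact hx'.2 ⟨hx'.1, hx⟩

end IsAnalyticFamily

end MovingBoundary
end


/-! ### Cauchy data of the time derivative of the Schwarz potential. -/

noncomputable section
section CauchyDataInTime

open scoped Laplacian ContDiff

/-- Lagrange multipliers: f is constant on the regular level set of φ, so p is a constrained
extremum. -/
theorem exists_fderiv_eq_smul_of_eq_zero {X : Type*} [NormedAddCommGroup X] [NormedSpace ℝ X]
    [CompleteSpace X] {f φ : X → ℝ} {p : X} (hf : ContDiffAt ℝ 1 f p) (hφ : ContDiffAt ℝ 1 φ p)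
    (h0 : φ p = 0) (hne : fderiv ℝ φ p ≠ 0) (h : ∀ᶠ q in 𝓝 p, φ q = 0 → f q = 0) :
    ∃ c : ℝ, fderiv ℝ f p = c • fderiv ℝ φ p := by
  have hext : IsLocalExtrOn f {x | φ x = φ p} p := by
    refine Or.inl ?_
    filter_upwards [h.filter_mono nhdsWithin_le_nhds, self_mem_nhdsWithin] with q hq hq'
    rw [h.self_of_nhds h0, hq (hq'.trans h0)]
  obtain ⟨a, b, hab, hlin⟩ := hext.exists_multipliers_of_hasStrictFDerivAt_1d
    (hφ.hasStrictFDerivAt one_ne_zero) (hf.hasStrictFDerivAt one_ne_zero)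
  have hb : b ≠ 0 := by
    rintro rfl
    rw [zero_smul, add_zero, smul_eq_zero] at hlin
    rcases hlin with rfl | hlin
    · exact hab rfl
    · exact hne hlin
  refine ⟨-(a / b), ContinuousLinearMap.ext fun v => ?_⟩
  have := congrArg (fun L => L v) hlin
  simp only [add_apply, smul_apply, smul_eq_mul, zero_apply] at this ⊢
  field_simp
  linarith

variable {E : Type*} [NormedAddCommGroup E] [InnerProductSpace ℝ E] [FiniteDimensional ℝ E]
  [MeasurableSpace E] [BorelSpace E]

/-- If `f` and its spatial derivative vanish on a moving hypersurface `φ = 0`, then the whole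
derivative of `f` vanishes there, and the second derivative is a multiple of `Dφ ⊗ Dφ`. -/
theorem exists_second_fderiv_eq {f φ : ℝ × E → ℝ} {p : ℝ × E} (hf : ContDiffAt ℝ 2 f p)
    (hφ : ContDiffAt ℝ 2 φ p) (h0 : φ p = 0) {e : E} (he : fderiv ℝ φ p (0, e) ≠ 0)
    (h : ∀ᶠ q in 𝓝 p, φ q = 0 → f q = 0 ∧ ∀ v, fderiv ℝ f q (0, v) = 0) :
    fderiv ℝ f p = 0 ∧ ∃ c : ℝ, ∀ u v,
      fderiv ℝ (fderiv ℝ f) p u v = c * (fderiv ℝ φ p u * fderiv ℝ φ p v) := by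
  -- Df is a multiple of Dφ. Evaluated at (0, e), the former vanishes and the latter does not, so
  -- the multiple is zero.
  have hD : ∀ᶠ q in 𝓝 p, φ q = 0 → fderiv ℝ f q = 0 := by
    have hcont : ContinuousAt (fun q => fderiv ℝ φ q (0, e)) p :=
      (hφ.continuousAt_fderiv two_ne_zero).clm_apply continuousAt_const
    filter_upwards [h.eventually_nhds, h, hcont.eventually_ne he, hf.eventually (by simp),
      hφ.eventually (by simp)] with q hq1 hq2 hq3 hq4 hq5 hq0
    have hne : fderiv ℝ φ q ≠ 0 := fun h => hq3 (by rw [h]; rfl)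
    obtain ⟨c, hc⟩ := exists_fderiv_eq_smul_of_eq_zero (hq4.of_le one_le_two)
      (hq5.of_le one_le_two) hq0 hne (hq1.mono fun z hz hz0 => (hz hz0).1)
    have := (hq2 hq0).2 e
    rw [hc, smul_apply, smul_eq_mul, mul_eq_zero, or_iff_left hq3] at this
    rw [hc, this, zero_smul]
  have hne : fderiv ℝ φ p ≠ 0 := fun h => he (by rw [h]; rfl)
  refine ⟨hD.self_of_nhds h0, ?_⟩
  -- The multiplier argument applied to each component of Df gives D²f(v, u) = l(u) Dφ(v); symmetry
  -- of D²f then makes l a multiple of Dφ.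
  have key : ∀ u, ∃ c : ℝ, ∀ v, fderiv ℝ (fderiv ℝ f) p v u = c * fderiv ℝ φ p v := by
    intro u
    obtain ⟨c, hc⟩ := exists_fderiv_eq_smul_of_eq_zero (f := fun q => fderiv ℝ f q u)
      (hf.contDiffAt_fderiv_apply u) (hφ.of_le one_le_two) h0 hne
      (hD.mono fun q hq hq0 => by rw [hq hq0]; rfl)
    refine ⟨c, fun v => ?_⟩
    rw [← fderiv_fderiv_apply_eq hf, hc]; rfl
  choose l hl using key
  have hsymm := hf.isSymmSndFDerivAt (by simp)
  refine ⟨l (0, e) / fderiv ℝ φ p (0, e), fun u v => ?_⟩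
  have h1 := hsymm.eq (0, e) v
  rw [hl, hl] at h1
  rw [hl]
  field_simp
  linear_combination (fderiv ℝ φ p u) * h1

variable {F φ : ℝ × E → ℝ} {t : ℝ} {y : E}

theorem fderiv_sub_half_normSq {q : ℝ × E} (hF : DifferentiableAt ℝ F q) (u : ℝ × E) :
    fderiv ℝ (fun p : ℝ × E => F p - ‖p.2‖ ^ 2 / 2) q u = fderiv ℝ F q u - ⟪q.2, u.2⟫_ℝ := by
  have h1 : HasFDerivAt (fun p : ℝ × E => ‖p.2‖ ^ 2) _ q :=
    (hasFDerivAt_snd (𝕜 := ℝ) (p := q)).norm_sq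
  have h2 := hF.hasFDerivAt.fun_sub (h1.mul_const (2⁻¹ : ℝ))
  have h3 : fderiv ℝ (fun p : ℝ × E => F p - ‖p.2‖ ^ 2 / 2) q = _ :=
    HasFDerivAt.fderiv (by simpa only [div_eq_mul_inv] using h2)
  rw [h3]
  simp

/-- The Cauchy data of the time derivative of the Schwarz potential. -/
theorem time_derivative_cauchy_data (hF : ContDiffAt ℝ 2 F (t, y)) (hφ : ContDiffAt ℝ 2 φ (t, y))
    (h0 : φ (t, y) = 0) (hne : fderiv ℝ (fun x => φ (t, x)) y ≠ 0)
    (h : ∀ᶠ q in 𝓝 (t, y), φ q = 0 → F q = ‖q.2‖ ^ 2 / 2 ∧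
      ∀ v, fderiv ℝ F q (0, v) = ⟪q.2, v⟫_ℝ)
    (hΔ : Δ (fun x => F (t, x)) y = 0) :
    fderiv ℝ F (t, y) (1, 0) = 0 ∧
    ∀ v, fderiv ℝ (fun x => fderiv ℝ F (t, x) (1, 0)) y v =
      (Module.finrank ℝ E : ℝ) *
        ⟪-(deriv (fun τ => φ (τ, y)) t / ‖gradient (fun x => φ (t, x)) y‖ ^ 2) •
          gradient (fun x => φ (t, x)) y, v⟫_ℝ := by
  have hφd : DifferentiableAt ℝ φ (t, y) := hφ.differentiableAt two_ne_zero
  have hFd : ∀ᶠ q in 𝓝 (t, y), DifferentiableAt ℝ F q :=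
    (hF.eventually (by simp)).mono fun q hq => hq.differentiableAt two_ne_zero
  set N : ℝ × E → ℝ := fun p => ‖p.2‖ ^ 2 / 2 with hN
  have hNc : ContDiff ℝ 2 N := (contDiff_snd.norm_sq ℝ).div_const 2
  have hfc : ContDiffAt ℝ 2 (fun p => F p - N p) (t, y) := hF.sub hNc.contDiffAt
  obtain ⟨e, he⟩ : ∃ e, fderiv ℝ φ (t, y) (0, e) ≠ 0 := by
    by_contra! hv
    refine hne (ContinuousLinearMap.ext fun v => ?_)
    rw [fderiv_slice_apply hφd, hv]; rfl
  obtain ⟨hD, c, hc⟩ := exists_second_fderiv_eq hfc hφ h0 he (by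
    filter_upwards [h, hFd] with q hq hqd hq0
    refine ⟨by simp [hN, (hq hq0).1], fun v => ?_⟩
    rw [fderiv_sub_half_normSq hqd, (hq hq0).2 v]; simp)
  have hgrad : ∀ v, fderiv ℝ φ (t, y) (0, v) = ⟪gradient (fun x => φ (t, x)) y, v⟫_ℝ := fun v => by
    rw [inner_gradient_left, fderiv_slice_apply hφd]
  set g := gradient (fun x => φ (t, x)) y with hg
  have hg0 : g ≠ 0 := gradient_ne_zero_iff.2 hne
  have hslice : ∀ {G : ℝ × E → ℝ}, ContDiffAt ℝ 2 G (t, y) →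
      ContDiffAt ℝ 2 (fun x => G (t, x)) y := fun hG =>
    ContDiffAt.comp (f := fun x : E => (t, x)) y hG (by fun_prop)
  -- The spatial trace of c Dφ ⊗ Dφ is c|∇φ|². It must equal 0 minus the dimension, as F is harmonic
  -- at y and ‖x‖²/2 has Laplacian equal to the dimension.
  have hlap : c * ‖g‖ ^ 2 = -(Module.finrank ℝ E : ℝ) := by
    have h1 : Δ (fun x => F (t, x) - N (t, x)) y = -(Module.finrank ℝ E : ℝ) := by
      have h2 : (fun x => N (t, x)) = (2⁻¹ : ℝ) • fun x : E => ‖x‖ ^ 2 := by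
        ext x; simp [hN]; ring
      have h3 := (hslice hF).laplacian_sub (hslice hNc.contDiffAt)
      have h4 : Δ (fun x => F (t, x) - N (t, x)) y = _ := h3
      rw [h4, hΔ, h2, laplacian_smul _ (contDiff_norm_sq ℝ).contDiffAt,
        laplacian_normSq]
      simp
    have b := stdOrthonormalBasis ℝ E
    rw [laplacian_eq_sum_fderiv b (hslice hfc)] at h1
    rw [← h1, ← b.sum_sq_inner_left g, Finset.mul_sum]
    refine Finset.sum_congr rfl fun i _ => ?_
    have h5 : (fun x => fderiv ℝ (fun x => F (t, x) - N (t, x)) x (b i)) =ᶠ[𝓝 y]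
        fun x => fderiv ℝ (fun p => F p - N p) (t, x) (0, b i) := by
      filter_upwards [(show ContinuousAt (fun x => (t, x)) y by fun_prop).eventually
        (hfc.eventually (by simp))] with x hx
      exact fderiv_slice_apply (φ := fun p => F p - N p) (hx.differentiableAt two_ne_zero) _
    rw [h5.fderiv_eq, fderiv_slice_apply (φ := fun p => fderiv ℝ (fun p => F p - N p) p (0, b i))
      (hfc.differentiableAt_fderiv_apply _), fderiv_fderiv_apply_eq hfc, hc, hgrad]
    ring
  constructor
  · have := fderiv_sub_half_normSq hFd.self_of_nhds (1, 0)
    rw [show (fun p : ℝ × E => F p - ‖p.2‖ ^ 2 / 2) = fun p => F p - N p from rfl, hD] at this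
    simpa using this.symm
  · intro v
    have h6 : (fun q => fderiv ℝ F q (1, 0)) =ᶠ[𝓝 (t, y)]
        fun q => fderiv ℝ (fun p => F p - N p) q (1, 0) := by
      filter_upwards [hFd] with q hq
      rw [fderiv_sub_half_normSq hq]; simp
    rw [fderiv_slice_apply (φ := fun q => fderiv ℝ F q (1, 0))
      (hF.differentiableAt_fderiv_apply _), h6.fderiv_eq, fderiv_fderiv_apply_eq hfc, hc, hgrad,
      (hasDerivAt_slice hφd).deriv, inner_smul_left]
    have : ‖g‖ ≠ 0 := norm_ne_zero_iff.2 hg0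
    simp only [conj_trivial]
    field_simp
    linear_combination (fderiv ℝ φ (t, y) (1, 0)) * ⟪g, v⟫_ℝ * hlap

variable {n : ℕ} {I : Set ℝ} {Ω : ℝ → Set (EuclideanSpace ℝ (Fin n))}

/-- The time derivative of a function on space-time. -/
def timeDeriv (w : ℝ → EuclideanSpace ℝ (Fin n) → ℝ) (τ : ℝ) (x : EuclideanSpace ℝ (Fin n)) : ℝ :=
  fderiv ℝ (fun p : ℝ × EuclideanSpace ℝ (Fin n) => w p.1 p.2) (τ, x) (1, 0)

namespace IsSchwarzPotential

variable {w : ℝ → EuclideanSpace ℝ (Fin n) → ℝ} {t : ℝ} {y : EuclideanSpace ℝ (Fin n)}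

/-- The bridge between w and the motion: kinematics alone fixes these data, before any law for the
velocity is imposed. It holds for every admissible v, whatever defining function was used to compute
it. -/
theorem timeDeriv_cauchy_data (hw : IsSchwarzPotential I Ω w) (hI : IsOpen I) (ht : t ∈ I)
    (hy : y ∈ frontier (Ω t)) {v : EuclideanSpace ℝ (Fin n)} (hv : IsNormalVelocity Ω t y v) :
    timeDeriv w t y = 0 ∧ gradient (timeDeriv w t) y = (n : ℝ) • v := by
  obtain ⟨φ, hφ, rfl⟩ := hv
  have hC := hw.contDiffAt t ht y hy
  obtain ⟨h1, h2⟩ := time_derivative_cauchy_data (F := fun p => w p.1 p.2) hC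
    (hφ.contDiffAt (k := 2)) (hφ.mem_frontier_iff.1 hy) hφ.fderiv_slice_ne_zero (by
      filter_upwards [hφ.eventually, continuousAt_fst.eventually (hI.mem_nhds ht),
        hC.eventually (by simp)] with q hq hqI hqC hq0
      have hqf := hq.mem_frontier_iff.2 hq0
      refine ⟨hw.value _ hqI _ hqf, fun v => ?_⟩
      rw [← fderiv_slice_apply (φ := fun p : ℝ × EuclideanSpace ℝ (Fin n) => w p.1 p.2)
        (t := q.1) (x := q.2) (hqC.differentiableAt two_ne_zero), ← inner_gradient_left]
      exact congrArg (fun a => ⟪a, v⟫_ℝ) (hw.gradient_eq _ hqI _ hqf))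
    (hw.harmonic t ht y hy).self_of_nhds.2.self_of_nhds
  refine ⟨h1, ext_inner_right ℝ fun u => ?_⟩
  rw [inner_gradient_left, inner_smul_left]
  have h3 := h2 u
  rw [finrank_euclideanSpace_fin] at h3
  exact h3

end IsSchwarzPotential

end CauchyDataInTime
end


/-! ### Equivalence of Laplacian growth and the equation ∂w/∂t = -nP. -/

noncomputable section
section LaplacianGrowth

open scoped Laplacian ContDiff

variable {n : ℕ} {I : Set ℝ} {Ω : ℝ → Set (EuclideanSpace ℝ (Fin n))}
  {w P : ℝ → EuclideanSpace ℝ (Fin n) → ℝ} {t : ℝ} {y x₀ : EuclideanSpace ℝ (Fin n)} {Q : ℝ}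

theorem hasDerivAt_timeDeriv
    (h : ContDiffAt ℝ 2 (fun p : ℝ × EuclideanSpace ℝ (Fin n) => w p.1 p.2) (t, y)) :
    HasDerivAt (fun τ => w τ y) (timeDeriv w t y) t :=
  hasDerivAt_slice (φ := fun p : ℝ × EuclideanSpace ℝ (Fin n) => w p.1 p.2)
    (h.differentiableAt two_ne_zero)

theorem contDiffAt_timeDeriv
    (h : ContDiffAt ℝ 2 (fun p : ℝ × EuclideanSpace ℝ (Fin n) => w p.1 p.2) (t, y)) :
    ContDiffAt ℝ 1 (fun p : ℝ × EuclideanSpace ℝ (Fin n) => timeDeriv w p.1 p.2) (t, y) :=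
  h.contDiffAt_fderiv_apply (1, 0)

theorem contDiffAt_timeDeriv_slice
    (h : ContDiffAt ℝ 2 (fun p : ℝ × EuclideanSpace ℝ (Fin n) => w p.1 p.2) (t, y)) :
    ContDiffAt ℝ 1 (timeDeriv w t) y :=
  ContDiffAt.comp (f := fun x => (t, x)) y (contDiffAt_timeDeriv h) (by fun_prop)

theorem continuousAt_gradient {E : Type*} [NormedAddCommGroup E] [InnerProductSpace ℝ E]
    [CompleteSpace E] {f : E → ℝ} {x : E} (h : ContDiffAt ℝ 1 f x) :
    ContinuousAt (gradient f) x :=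
  (toDual ℝ E).symm.continuous.continuousAt.comp (h.continuousAt_fderiv one_ne_zero)

/-- Near a boundary point, everything is regular in a product neighbourhood. -/
theorem IsSchwarzPotential.exists_ball (hw : IsSchwarzPotential I Ω w) (hI : IsOpen I)
    (ht : t ∈ I) (hy : y ∈ frontier (Ω t)) {p : ℝ × EuclideanSpace ℝ (Fin n) → Prop}
    (hp : ∀ᶠ q in 𝓝 (t, y), p q) :
    ∃ r > 0, ∀ τ ∈ Metric.ball t r, ∀ x ∈ Metric.ball y r, τ ∈ I ∧
      ContDiffAt ℝ 2 (fun p : ℝ × EuclideanSpace ℝ (Fin n) => w p.1 p.2) (τ, x) ∧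
      HarmonicAt (w τ) x ∧ p (τ, x) := by
  have h := (continuousAt_fst.eventually (hI.mem_nhds ht)).and
    (((hw.contDiffAt t ht y hy).eventually (by simp)).and ((hw.harmonic t ht y hy).and hp))
  obtain ⟨r, hr, h⟩ := Metric.eventually_nhds_iff_ball.1 h
  refine ⟨r, hr, fun τ hτ x hx => h (τ, x) ?_⟩
  rw [← ball_prod_same]
  exact ⟨hτ, hx⟩

theorem harmonicOnNhd_timeDeriv [NeZero n] {J : Set ℝ} {B : Set (EuclideanSpace ℝ (Fin n))} (hJ : IsOpen J)
    (hB : IsOpen B) (hc : ∀ τ ∈ J, ∀ x ∈ B,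
      ContDiffAt ℝ 2 (fun p : ℝ × EuclideanSpace ℝ (Fin n) => w p.1 p.2) (τ, x))
    (hh : ∀ τ ∈ J, HarmonicOnNhd (w τ) B) {τ : ℝ} (hτ : τ ∈ J) :
    HarmonicOnNhd (timeDeriv w τ) B :=
  harmonicOnNhd_time_derivative (F := fun p => w p.1 p.2) hJ hB hc hh hτ

theorem IsDefiningFunction.nhdsWithin_eq {φ : ℝ × EuclideanSpace ℝ (Fin n) → ℝ}
    (h : IsDefiningFunction Ω φ t y) : 𝓝[{x | φ (t, x) < 0}] y = 𝓝[Ω t] y := by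
  refine nhdsWithin_eq_iff_eventuallyEq.2 ?_
  filter_upwards [h.eventually_mem_iff] with x hx
  exact propext hx.symm

/-- The function `∂w/∂t + nP`, extended by zero, is harmonic across the moving boundary. -/
theorem SolvesLaplacianGrowth.harmonicAt_indicator (hn : 2 ≤ n) (hI : IsOpen I)
    (hw : IsSchwarzPotential I Ω w) (h : SolvesLaplacianGrowth I Ω x₀ Q P) (ht : t ∈ I)
    (hy : y ∈ frontier (Ω t)) {φ : ℝ × EuclideanSpace ℝ (Fin n) → ℝ}
    (hφ : IsDefiningFunction Ω φ t y) (hΩ : IsOpen (Ω t))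
    (hW : HarmonicAt (timeDeriv w t) y) :
    HarmonicAt ((Ω t).indicator fun x => timeDeriv w t x + n * P t x) y := by
  have : NeZero n := ⟨by omega⟩
  have hyΩ : y ∉ Ω t := fun hy' => (hΩ.frontier_eq ▸ hy).2 hy'
  have hx₀ : ∀ᶠ x in 𝓝 y, x ≠ x₀ :=
    eventually_ne_nhds fun h' => hyΩ (h' ▸ h.pressure.sink_mem t ht)
  have hWe : ∀ᶠ x in 𝓝 y, HarmonicAt (timeDeriv w t) x := hW.eventually
  have hPh : ∀ x ∈ Ω t, x ≠ x₀ → HarmonicAt (P t) x := fun x hx hx' =>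
    h.pressure.harmonic t ht x ⟨hx, hx'⟩
  have hφe : ∀ᶠ x in 𝓝 y, IsDefiningFunction Ω φ t x :=
    (show ContinuousAt (fun x => (t, x)) y by fun_prop).eventually hφ.eventually
  have heq : ∀ x ∈ Ω t, ((Ω t).indicator fun x => timeDeriv w t x + n * P t x) =ᶠ[𝓝 x]
      fun x => timeDeriv w t x + n * P t x := fun x hx => by
    filter_upwards [hΩ.mem_nhds hx] with z hz using indicator_of_mem hz _
  refine harmonicAt_of_zero_cauchy_data (φ := fun x => φ (t, x))
    (ContDiffAt.comp (f := fun x => (t, x)) y hφ.contDiffAt (by fun_prop))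
    hφ.fderiv_slice_ne_zero ?_ ?_ ?_
  · filter_upwards [hφ.eventually_mem_iff, hx₀, hWe] with x hx hx' hWx hneg
    have hxΩ := hx.2 hneg
    rw [harmonicAt_congr_nhds (heq x hxΩ)]
    exact hWx.add ((hPh x hxΩ hx').const_smul (c := (n : ℝ)))
  · filter_upwards [hφ.eventually_mem_iff] with x hx hpos
    exact indicator_of_notMem (fun h' => absurd (hx.1 h') (not_lt.2 hpos)) _
  · filter_upwards [hφe, hx₀.eventually_nhds, hWe] with z hz hzx hWz hz0
    have hzf := hz.mem_frontier_iff.2 hz0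
    -- From inside, ∂w/∂t and its gradient tend to 0 and n v, while nP and its gradient tend to 0
    -- and -n v; the sums have zero Cauchy data.
    obtain ⟨v, hv, hlim⟩ := h.velocity t ht z hzf
    obtain ⟨h0, h1⟩ := hw.timeDeriv_cauchy_data hI ht hzf hv
    rw [hz.nhdsWithin_eq]
    have hΩe : ∀ᶠ x in 𝓝[Ω t] z, x ∈ Ω t := self_mem_nhdsWithin
    have hxe : ∀ᶠ x in 𝓝[Ω t] z, x ≠ x₀ := hzx.filter_mono nhdsWithin_le_nhds
    have hWe' : ∀ᶠ x in 𝓝[Ω t] z, HarmonicAt (timeDeriv w t) x :=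
      hWz.eventually.filter_mono nhdsWithin_le_nhds
    constructor
    · have h2 : Tendsto (fun x => timeDeriv w t x + n * P t x) (𝓝[Ω t] z) (𝓝 (0 + n * 0)) := by
        refine Tendsto.add ?_ ((h.pressure.boundary_lim t ht z hzf).const_mul _)
        rw [← h0]
        exact hWz.1.continuousAt.mono_left nhdsWithin_le_nhds
      rw [mul_zero, add_zero] at h2
      refine h2.congr' ?_
      filter_upwards [hΩe] with x hx
      exact (indicator_of_mem hx (fun x => timeDeriv w t x + n * P t x)).symm
    · have h2 : Tendsto (fun x => toDual ℝ _ (gradient (timeDeriv w t) x -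
          (n : ℝ) • -gradient (P t) x)) (𝓝[Ω t] z) (𝓝 (toDual ℝ _ ((n : ℝ) • v - (n : ℝ) • v))) := by
        refine ((toDual ℝ _).continuous.tendsto _).comp (Tendsto.sub ?_ (hlim.const_smul _))
        rw [← h1]
        exact (continuousAt_gradient (hWz.1.of_le one_le_two)).mono_left nhdsWithin_le_nhds
      rw [sub_self, map_zero] at h2
      refine h2.congr' ?_
      filter_upwards [hΩe, hxe, hWe'] with x hx hx' hWx
      rw [(heq x hx).fderiv_eq]
      have h3 : fderiv ℝ (fun x => timeDeriv w t x + n * P t x) x = _ :=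
        ((hWx.1.differentiableAt two_ne_zero).hasFDerivAt.add
        (((hPh x hx hx').1.differentiableAt two_ne_zero).hasFDerivAt.const_mul (n : ℝ))).fderiv
      rw [h3]
      simp [gradient]

/-- In a Laplacian growth, the time derivative of the Schwarz potential is `-nP`. -/
theorem SolvesLaplacianGrowth.eventually_timeDeriv_eq (hn : 2 ≤ n) (hI : IsOpen I)
    (hΩ : IsAnalyticFamily I Ω) (hw : IsSchwarzPotential I Ω w)
    (h : SolvesLaplacianGrowth I Ω x₀ Q P) (ht : t ∈ I) (hy : y ∈ frontier (Ω t)) :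
    ∀ᶠ p in 𝓝 (t, y), p.2 ∈ closure (Ω p.1) → timeDeriv w p.1 p.2 = -(n : ℝ) * P p.1 p.2 := by
  have : NeZero n := ⟨by omega⟩
  have hyΩ : y ∉ Ω t := fun hy' => ((hΩ.isOpen t ht).frontier_eq ▸ hy).2 hy'
  obtain ⟨φ, hφ⟩ := hΩ.exists_defining' ht hy
  have hx₀ : ∀ᶠ p : ℝ × EuclideanSpace ℝ (Fin n) in 𝓝 (t, y), p.2 ≠ x₀ :=
    (continuousAt_snd (p := (t, y))).eventually (p := (· ≠ x₀)) (eventually_ne_nhds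
      fun (h' : y = x₀) => hyΩ (h' ▸ h.pressure.sink_mem t ht))
  obtain ⟨r, hr, hreg⟩ := hw.exists_ball hI ht hy (hφ.eventually.and (hφ.mem_iff.and hx₀))
  -- One exterior point in the fixed ball, still exterior for all τ near t. For each such τ the
  -- extended function vanishes near it, and so on the whole ball by the identity theorem.
  obtain ⟨x₁, hx₁, hx₁B⟩ := ((hφ.frequently_pos hy).and_eventually
    (Metric.ball_mem_nhds y hr)).exists
  have hx₁c : ∀ᶠ τ in 𝓝 t, 0 < φ (τ, x₁) :=
    continuousAt_const.eventually_lt (ContinuousAt.comp (f := fun τ => (τ, x₁))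
      (hreg t (Metric.mem_ball_self hr) x₁ hx₁B).2.2.2.1.analytic.continuousAt (by fun_prop)) hx₁
  filter_upwards [continuousAt_fst.eventually (hx₁c.and (Metric.ball_mem_nhds t hr)),
    continuousAt_snd.eventually (Metric.ball_mem_nhds y hr)] with p hp hpB hpcl
  obtain ⟨τ, x⟩ := p
  obtain ⟨hτ₁, hτ⟩ := hp
  have hτI : τ ∈ I := (hreg τ hτ x hpB).1
  have hW : HarmonicOnNhd (timeDeriv w τ) (Metric.ball y r) :=
    harmonicOnNhd_timeDeriv Metric.isOpen_ball Metric.isOpen_ball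
      (fun σ hσ z hz => (hreg σ hσ z hz).2.1) (fun σ hσ z hz => (hreg σ hσ z hz).2.2.1) hτ
  have hop := hΩ.isOpen τ hτI
  have hq : HarmonicOnNhd ((Ω τ).indicator fun x => timeDeriv w τ x + n * P τ x)
      (Metric.ball y r) := by
    intro z hz
    by_cases hzΩ : z ∈ Ω τ
    · have heq : ((Ω τ).indicator fun x => timeDeriv w τ x + n * P τ x) =ᶠ[𝓝 z]
          fun x => timeDeriv w τ x + n * P τ x := by
        filter_upwards [hop.mem_nhds hzΩ] with a ha using indicator_of_mem ha _
      rw [harmonicAt_congr_nhds heq]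
      exact (hW z hz).add ((h.pressure.harmonic τ hτI z
        ⟨hzΩ, (hreg τ hτ z hz).2.2.2.2.2⟩).const_smul (c := (n : ℝ)))
    · by_cases hzf : z ∈ frontier (Ω τ)
      · exact h.harmonicAt_indicator hn hI hw hτI hzf (hreg τ hτ z hz).2.2.2.1 hop (hW z hz)
      · have hzcl : z ∉ closure (Ω τ) := fun hc => hzf (hop.frontier_eq ▸ ⟨hc, hzΩ⟩)
        have heq : ((Ω τ).indicator fun x => timeDeriv w τ x + n * P τ x) =ᶠ[𝓝 z]
            fun _ => 0 := by
          filter_upwards [isClosed_closure.isOpen_compl.mem_nhds hzcl] with a ha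
          exact indicator_of_notMem (fun h' => ha (subset_closure h')) _
        rw [harmonicAt_congr_nhds heq]
        exact harmonicAt_const 0
  have hzero : ((Ω τ).indicator fun x => timeDeriv w τ x + n * P τ x) =ᶠ[𝓝 x₁] 0 := by
    have hd := (hreg τ hτ x₁ hx₁B).2.2.2.1
    have hc : ContinuousAt (fun x => φ (τ, x)) x₁ :=
      ContinuousAt.comp (f := fun x => (τ, x)) hd.analytic.continuousAt (by fun_prop)
    filter_upwards [hd.eventually_mem_iff, continuousAt_const.eventually_lt hc hτ₁] with a ha ha'
    exact indicator_of_notMem (fun h' => absurd (ha.1 h') (not_lt.2 (le_of_lt ha'))) _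
  have hall := (hq.eventuallyEq_zero_of_isPreconnected Metric.isPreconnected_ball hx₁B hzero
    hpB).self_of_nhds
  by_cases hxΩ : x ∈ Ω τ
  · rw [indicator_of_mem hxΩ] at hall
    simp only [Pi.zero_apply] at hall
    linarith
  · have hxf : x ∈ frontier (Ω τ) := hop.frontier_eq ▸ ⟨hpcl, hxΩ⟩
    obtain ⟨v, hv, -⟩ := h.velocity τ hτI x hxf
    simp only
    rw [(hw.timeDeriv_cauchy_data hI hτI hxf hv).1, h.pressure.boundary_eq τ hτI x hxf, mul_zero]

theorem SolvesLaplacianGrowth.eventually_hasDerivAt (hn : 2 ≤ n) (hI : IsOpen I)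
    (hΩ : IsAnalyticFamily I Ω) (hw : IsSchwarzPotential I Ω w)
    (h : SolvesLaplacianGrowth I Ω x₀ Q P) (ht : t ∈ I) (hy : y ∈ frontier (Ω t)) :
    ∀ᶠ p in 𝓝 (t, y), p.2 ∈ closure (Ω p.1) →
      HasDerivAt (fun τ => w τ p.2) (-(n : ℝ) * P p.1 p.2) p.1 := by
  filter_upwards [h.eventually_timeDeriv_eq hn hI hΩ hw ht hy,
    (hw.contDiffAt t ht y hy).eventually (by simp)] with p hp hpc hcl
  rw [← hp hcl]
  exact hasDerivAt_timeDeriv hpc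

/-- The equation `∂w/∂t = -nP` near the moving boundary implies Laplacian growth. -/
theorem solvesLaplacianGrowth_of_hasDerivAt (hn : 2 ≤ n) (hI : IsOpen I)
    (hΩ : IsAnalyticFamily I Ω) (hw : IsSchwarzPotential I Ω w) (hP : IsPressure I Ω x₀ Q P)
    (h : ∀ t ∈ I, ∀ y ∈ frontier (Ω t), ∀ᶠ p in 𝓝 (t, y), p.2 ∈ closure (Ω p.1) →
      HasDerivAt (fun τ => w τ p.2) (-(n : ℝ) * P p.1 p.2) p.1) :
    SolvesLaplacianGrowth I Ω x₀ Q P := by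
  refine ⟨hP, fun t ht y hy => ?_⟩
  obtain ⟨φ, hφ⟩ := hΩ.exists_defining' ht hy
  refine ⟨_, ⟨φ, hφ, rfl⟩, ?_⟩
  set v := -(deriv (fun τ => φ (τ, y)) t / ‖gradient (fun x => φ (t, x)) y‖ ^ 2) •
      gradient (fun x => φ (t, x)) y with hv
  have hg := (hw.timeDeriv_cauchy_data hI ht hy ⟨φ, hφ, hv⟩).2
  have hC := hw.contDiffAt t ht y hy
  have hn0 : (n : ℝ) ≠ 0 := by positivity
  have hev : ∀ᶠ x in 𝓝 y, x ∈ closure (Ω t) → P t x = -(n : ℝ)⁻¹ * timeDeriv w t x := by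
    filter_upwards [(show ContinuousAt (fun x => (t, x)) y by fun_prop).eventually
      ((h t ht y hy).and (hC.eventually (by simp)))] with x hx hcl
    have := (hx.1 hcl).unique (hasDerivAt_timeDeriv hx.2)
    rw [← this]
    field_simp
  -- Inside Ω_t the pressure is -1/n times ∂w/∂t. The gradient of the latter is continuous across
  -- the boundary with value n v, so the limit of -∇P exists and equals v.
  have hev' : ∀ᶠ x in 𝓝[Ω t] y, (n : ℝ)⁻¹ • gradient (timeDeriv w t) x = -gradient (P t) x := by
    have hCx : ∀ᶠ x in 𝓝 y, DifferentiableAt ℝ (timeDeriv w t) x :=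
      ((contDiffAt_timeDeriv_slice hC).eventually (by simp)).mono
        fun x hx => hx.differentiableAt one_ne_zero
    filter_upwards [self_mem_nhdsWithin, hev.eventually_nhds.filter_mono nhdsWithin_le_nhds,
      hCx.filter_mono nhdsWithin_le_nhds] with x hx hx' hxd
    have heq : P t =ᶠ[𝓝 x] fun z => -(n : ℝ)⁻¹ * timeDeriv w t z := by
      filter_upwards [hx', (hΩ.isOpen t ht).mem_nhds hx] with z hz hz'
        using hz (subset_closure hz')
    rw [gradient, gradient, heq.fderiv_eq, fderiv_const_mul hxd, map_smulₛₗ]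
    simp
  refine Tendsto.congr' hev' ?_
  have h1 := ((continuousAt_gradient (contDiffAt_timeDeriv_slice hC)).mono_left
    (nhdsWithin_le_nhds (s := Ω t))).const_smul (n : ℝ)⁻¹
  rwa [hg, inv_smul_smul₀ hn0] at h1

end LaplacianGrowth
end


/-! ### Regular part of the pressure and a fixed collar of the boundary. -/

noncomputable section
section Collar

open scoped Laplacian ContDiff

variable {n : ℕ} {I : Set ℝ} {Ω : ℝ → Set (EuclideanSpace ℝ (Fin n))}
  {w P : ℝ → EuclideanSpace ℝ (Fin n) → ℝ} {t : ℝ} {y x₀ : EuclideanSpace ℝ (Fin n)} {Q : ℝ}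
  {A : Set (EuclideanSpace ℝ (Fin n))}

/-- The regular part of the pressure. -/
theorem IsPressure.exists_regular_part (hn : 2 ≤ n) (hP : IsPressure I Ω x₀ Q P) (hQ : Q ≠ 0)
    (ht : t ∈ I) (hΩ : IsOpen (Ω t)) :
    ∃ H : EuclideanSpace ℝ (Fin n) → ℝ, HarmonicOnNhd H (Ω t) ∧
      ∀ x ≠ x₀, H x = P t x + Q * fundamentalSolution n (x - x₀) := by
  have : NeZero n := ⟨by omega⟩
  set K := fundamentalSolution n with hK
  have hx₀ := hP.sink_mem t ht
  have hadd : Tendsto (fun y : EuclideanSpace ℝ (Fin n) => y + x₀) (𝓝[≠] 0) (𝓝[≠] x₀) := by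
    refine tendsto_nhdsWithin_iff.2 ⟨?_, ?_⟩
    · have : Continuous fun y : EuclideanSpace ℝ (Fin n) => y + x₀ := by fun_prop
      exact (this.tendsto' 0 x₀ (zero_add _)).mono_left nhdsWithin_le_nhds
    · filter_upwards [self_mem_nhdsWithin] with y hy
      simpa using hy
  have hsub : Tendsto (fun y : EuclideanSpace ℝ (Fin n) => y - x₀) (𝓝[≠] x₀) (𝓝[≠] 0) := by
    refine tendsto_nhdsWithin_iff.2 ⟨?_, ?_⟩
    · have : Continuous fun y : EuclideanSpace ℝ (Fin n) => y - x₀ := by fun_prop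
      exact (this.tendsto' x₀ 0 (sub_self _)).mono_left nhdsWithin_le_nhds
    · filter_upwards [self_mem_nhdsWithin] with y hy
      simpa [sub_eq_zero] using hy
  have hharm : ∀ x ∈ Ω t, x ≠ x₀ → HarmonicAt (fun x => P t x + Q * K (x - x₀)) x :=
    fun x hx hx' => (hP.harmonic t ht x ⟨hx, hx'⟩).add
      ((harmonicAt_comp_sub_right (harmonicAt_fundamentalSolution hn
        (sub_ne_zero.2 hx'))).const_smul (c := Q))
  -- The asymptotics of P at the sink make P + Q K(x - x₀) of order o(K), hence its singularity
  -- removable.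
  obtain ⟨g, hg, hvg⟩ := exists_harmonicAt_extension (K := K)
    (v := fun y => P t (y + x₀) + Q * K y)
    (fun x hx => harmonicAt_fundamentalSolution hn hx) (tendsto_fundamentalSolution hn)
    (tendsto_norm_pow_mul_fundamentalSolution hn) (by
      filter_upwards [hadd.eventually (inter_mem_nhdsWithin _ (hΩ.mem_nhds hx₀))] with y hy
      have h1 := hharm (y + x₀) hy.2 hy.1
      have h2 : HarmonicAt (fun z => (fun x => P t x + Q * K (x - x₀)) (z - -x₀)) y :=
        harmonicAt_comp_sub_right (f := fun x => P t x + Q * K (x - x₀)) (by simpa using h1)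
      simpa using h2) (by
      have h1 : (P t - fun x => -Q * K (x - x₀)) =o[𝓝[≠] x₀] fun x => -Q * K (x - x₀) :=
        hP.sink t ht
      have h2 := (h1.comp_tendsto hadd).trans_isBigO
        (isBigO_refl _ _ : (fun y => -Q * K (y + x₀ - x₀)) =O[𝓝[≠] 0] _)
      have h3 : (fun y => P t (y + x₀) + Q * K y) =o[𝓝[≠] 0] fun y => -Q * K y := by
        refine (h2.congr (fun y => ?_) fun y => ?_)
        · simp
        · simp
      exact (isLittleO_const_mul_right_iff (neg_ne_zero.2 hQ)).1 h3)
  refine ⟨Function.update (fun x => P t x + Q * K (x - x₀)) x₀ (g 0), fun x hx => ?_,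
    fun x hx => Function.update_of_ne hx _ _⟩
  by_cases hxx : x = x₀
  · subst hxx
    have h1 : Function.update (fun z => P t z + Q * K (z - x)) x (g 0) =ᶠ[𝓝 x]
        fun z => g (z - x) := by
      have h2 := hsub.eventually hvg
      rw [eventually_nhdsWithin_iff] at h2
      filter_upwards [h2] with z hz
      by_cases hzx : z = x
      · subst hzx; simp
      · rw [Function.update_of_ne hzx, ← hz hzx]; simp
    rw [harmonicAt_congr_nhds h1]
    exact harmonicAt_comp_sub_right (by simpa using hg)
  · have h1 : Function.update (fun z => P t z + Q * K (z - x₀)) x₀ (g 0) =ᶠ[𝓝 x]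
        fun z => P t z + Q * K (z - x₀) := by
      filter_upwards [eventually_ne_nhds hxx] with z hz using Function.update_of_ne hz _ _
    rw [harmonicAt_congr_nhds h1]
    exact hharm x hx hxx

/-- A two-sided neighbourhood `{infDist · Γ < 5ρ}` of the compact boundary `Γ` of `Ω t₀` in which
everything is regular for `t` in `J`, and outside of which the domains do not change. -/
structure IsCollar (Ω : ℝ → Set (EuclideanSpace ℝ (Fin n)))
    (w P : ℝ → EuclideanSpace ℝ (Fin n) → ℝ) (A : Set (EuclideanSpace ℝ (Fin n))) (J I : Set ℝ)
    (U Γ : Set (EuclideanSpace ℝ (Fin n))) (ρ : ℝ) : Prop where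
  pos : 0 < ρ
  isCompact : IsCompact Γ
  nonempty : Γ.Nonempty
  isOpen : IsOpen U
  frontier_eq : frontier U = Γ
  subset : J ⊆ I
  contDiffAt : ∀ σ ∈ J, ∀ x, Metric.infDist x Γ < 5 * ρ →
    ContDiffAt ℝ 2 (fun p : ℝ × EuclideanSpace ℝ (Fin n) => w p.1 p.2) (σ, x)
  harmonicAt : ∀ σ ∈ J, ∀ x, Metric.infDist x Γ < 5 * ρ → HarmonicAt (w σ) x
  timeDeriv_eq : ∀ σ ∈ J, ∀ x, Metric.infDist x Γ < 5 * ρ → x ∈ closure (Ω σ) →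
    timeDeriv w σ x = -(n : ℝ) * P σ x
  notMem : ∀ x, Metric.infDist x Γ < 5 * ρ → x ∉ A
  notMem_frontier : ∀ σ ∈ J, ∀ x, ρ ≤ Metric.infDist x Γ → x ∉ frontier (Ω σ)
  mem_iff : ∀ σ ∈ J, ∀ x, ρ ≤ Metric.infDist x Γ → (x ∈ Ω σ ↔ x ∈ U)
  exists_notMem : ∀ σ ∈ J, ∀ y ∈ Γ, ∃ x, dist x y < ρ ∧ x ∉ Ω σ

theorem IsPreconnected.mem_iff_of_disjoint_frontier {X : Type*} [TopologicalSpace X]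
    {s U : Set X} (hs : IsPreconnected s) (hU : Disjoint s (frontier U)) {x y : X} (hx : x ∈ s)
    (hy : y ∈ s) : x ∈ U ↔ y ∈ U := by
  have key : ∀ {x y : X}, x ∈ s → y ∈ s → x ∈ U → y ∈ U := by
    intro x y hx hy hxU
    by_contra hyU
    have hcov : s ⊆ interior U ∪ interior Uᶜ := fun z hz => by
      by_contra h
      rw [mem_union, not_or, interior_compl, mem_compl_iff, not_not] at h
      exact (disjoint_left.1 hU hz) ⟨h.2, h.1⟩
    obtain ⟨z, -, hz1, hz2⟩ := hs _ _ isOpen_interior isOpen_interior hcov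
      ⟨x, hx, (hcov hx).resolve_right fun h => interior_subset h hxU⟩
      ⟨y, hy, (hcov hy).resolve_left fun h => hyU (interior_subset h)⟩
    exact interior_subset hz2 (interior_subset hz1)
  exact ⟨key hx hy, key hy hx⟩

/-- The radial segment from x down to the sphere of radius R avoids the open ball and hence the
frontier. Thus membership of far points is decided on a compact sphere, which also covers unbounded
domains. -/
theorem mem_iff_of_frontier_subset_ball {E : Type*} [NormedAddCommGroup E] [NormedSpace ℝ E]
    {U : Set E} {R : ℝ} (hR : 0 < R) (hU : frontier U ⊆ Metric.ball 0 R) {x : E} (hx : R ≤ ‖x‖) :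
    x ∈ U ↔ (R / ‖x‖) • x ∈ U := by
  have hx0 : 0 < ‖x‖ := hR.trans_le hx
  refine (convex_segment (𝕜 := ℝ) x ((R / ‖x‖) • x)).isPreconnected.mem_iff_of_disjoint_frontier ?_
    (left_mem_segment ..) (right_mem_segment ..)
  rw [disjoint_left]
  rintro z ⟨a, b, ha, hb, hab, rfl⟩ hz
  have h1 := hU hz
  rw [mem_ball_zero_iff, smul_smul, ← add_smul, norm_smul, Real.norm_eq_abs,
    abs_of_nonneg (by positivity), add_mul, mul_assoc, div_mul_cancel₀ _ hx0.ne'] at h1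
  nlinarith

/-- Everything holds pointwise near (t, y) by regularity of the motion; compactness of the boundary
makes it uniform in space for a short time. The boundaries stay within ρ of Γ, while the regular
zone is 5ρ wide, leaving room for identity-theorem balls. -/
theorem exists_isCollar (hn : 2 ≤ n) (hI : IsOpen I) (hΩ : IsAnalyticFamily I Ω)
    (hw : IsSchwarzPotential I Ω w) (h : SolvesLaplacianGrowth I Ω x₀ Q P) (ht : t ∈ I)
    (hbd : ∃ R : ℝ, ∀ᶠ τ in 𝓝 t, frontier (Ω τ) ⊆ Metric.ball 0 R)
    (hne : (frontier (Ω t)).Nonempty) (hA : IsClosed A) (hAΩ : A ⊆ Ω t) :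
    ∃ ρ, ∃ δ > 0, IsCollar Ω w P A (Metric.ball t δ) I (Ω t) (frontier (Ω t)) ρ := by
  set Γ := frontier (Ω t) with hΓ
  have hop := hΩ.isOpen t ht
  obtain ⟨R, hR⟩ := hbd
  have hΓR : Γ ⊆ Metric.ball 0 R := hR.self_of_nhds
  have hΓc : IsCompact Γ := (Metric.isBounded_ball.subset hΓR).isCompact_closure.of_isClosed_subset
    isClosed_frontier subset_closure
  have hR0 : 0 < R := by
    obtain ⟨y, hy⟩ := hne
    exact (norm_nonneg y).trans_lt (mem_ball_zero_iff.1 (hΓR hy))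
  have hregp : ∀ y ∈ Γ, ∀ᶠ p : ℝ × EuclideanSpace ℝ (Fin n) in 𝓝 (t, y),
      ContDiffAt ℝ 2 (fun p : ℝ × EuclideanSpace ℝ (Fin n) => w p.1 p.2) p ∧
      HarmonicAt (w p.1) p.2 ∧
      (p.2 ∈ closure (Ω p.1) → timeDeriv w p.1 p.2 = -(n : ℝ) * P p.1 p.2) ∧ p.2 ∉ A := by
    intro y hy
    have hyA : ∀ᶠ x in 𝓝 y, x ∉ A := hA.isOpen_compl.mem_nhds
      fun hyA => (hop.frontier_eq ▸ hy : y ∈ closure (Ω t) \ Ω t).2 (hAΩ hyA)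
    filter_upwards [(hw.contDiffAt t ht y hy).eventually (by simp), hw.harmonic t ht y hy,
      h.eventually_timeDeriv_eq hn hI hΩ hw ht hy, continuousAt_snd.eventually hyA]
      with p h1 h2 h3 h4 using ⟨h1, h2, h3, h4⟩
  obtain ⟨ε, hε, hreg⟩ : ∃ ε > 0, ∀ᶠ σ in 𝓝 t, ∀ x, Metric.infDist x Γ < ε →
      ContDiffAt ℝ 2 (fun p : ℝ × EuclideanSpace ℝ (Fin n) => w p.1 p.2) (σ, x) ∧
      HarmonicAt (w σ) x ∧ (x ∈ closure (Ω σ) → timeDeriv w σ x = -(n : ℝ) * P σ x) ∧ x ∉ A := by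
    -- Tube lemma: neighbourhoods of the compact set {t} × Γ contain products of a time interval and
    -- a thickening of Γ.
    have h1 : ∀ᶠ p : ℝ × EuclideanSpace ℝ (Fin n) in 𝓝ˢ ({t} ×ˢ Γ),
        ContDiffAt ℝ 2 (fun p : ℝ × EuclideanSpace ℝ (Fin n) => w p.1 p.2) p ∧
        HarmonicAt (w p.1) p.2 ∧
        (p.2 ∈ closure (Ω p.1) → timeDeriv w p.1 p.2 = -(n : ℝ) * P p.1 p.2) ∧ p.2 ∉ A := by
      rw [eventually_nhdsSet_iff_forall]
      rintro ⟨σ, y⟩ ⟨hσ, hy⟩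
      obtain rfl : σ = t := hσ
      exact hregp y hy
    rw [isCompact_singleton.nhdsSet_prod_eq hΓc, nhdsSet_singleton, eventually_prod_iff] at h1
    obtain ⟨pa, ha, pb, hb, hab⟩ := h1
    obtain ⟨V, hVo, hΓV, hV⟩ := mem_nhdsSet_iff_exists.1 hb
    obtain ⟨ε, hε, hεV⟩ := hΓc.exists_thickening_subset_open hVo hΓV
    refine ⟨ε, hε, ha.mono fun σ hσ x hx => ?_⟩
    exact hab hσ (hV (hεV ((Metric.mem_thickening_iff_infDist_lt hne).2 hx)))
  -- The bound 1 ensures that the sphere of radius R + 1, at distance at least 1 from Γ, lies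
  -- outside the ρ-neighbourhood.
  set ρ := min (ε / 5) 1 with hρ
  have hρ0 : 0 < ρ := by positivity
  have hρε : 5 * ρ ≤ ε := by
    have := min_le_left (ε / 5) 1
    linarith
  have hfarc : ∀ᶠ σ in 𝓝 t, ∀ x ∈ Metric.closedBall 0 (R + 1) ∩ {x | ρ ≤ Metric.infDist x Γ},
      x ∉ frontier (Ω σ) ∧ (x ∈ Ω σ ↔ x ∈ Ω t) := by
    refine ((isCompact_closedBall _ _).inter_right (isClosed_le continuous_const
      (Metric.continuous_infDist_pt Γ))).eventually_forall_of_forall_eventually fun x hx => ?_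
    have hxΓ : x ∉ Γ := fun hxΓ => by
      have : ρ ≤ Metric.infDist x Γ := hx.2
      rw [Metric.infDist_zero_of_mem hxΓ] at this
      linarith
    have hIe : ∀ᶠ p : ℝ × EuclideanSpace ℝ (Fin n) in 𝓝 (t, x), p.1 ∈ I :=
      continuousAt_fst.eventually (hI.mem_nhds ht)
    by_cases hxΩ : x ∈ Ω t
    · filter_upwards [hΩ.eventually_mem ht hxΩ, hIe,
        continuousAt_snd.eventually (hop.mem_nhds hxΩ)] with p hp hpI hp2
      refine ⟨fun hf => ?_, iff_of_true hp hp2⟩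
      rw [(hΩ.isOpen _ hpI).frontier_eq] at hf
      exact hf.2 hp
    · have hxcl : x ∉ closure (Ω t) := fun hc => hxΓ (by rw [hΓ, hop.frontier_eq]; exact ⟨hc, hxΩ⟩)
      filter_upwards [hΩ.eventually_notMem_closure hI ht hxcl,
        continuousAt_snd.eventually (isClosed_closure.isOpen_compl.mem_nhds hxcl)] with p hp hp2
      exact ⟨fun hf => hp (frontier_subset_closure hf),
        iff_of_false (fun h' => hp (subset_closure h')) fun h' => hp2 (subset_closure h')⟩
  -- Near each point of Γ there is an exterior point of Ω t, which stays exterior for a short time;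
  -- compactness of Γ makes this uniform.
  have hnear : ∀ᶠ σ in 𝓝 t, ∀ y ∈ Γ, ∃ x, dist x y < ρ ∧ x ∉ Ω σ := by
    refine hΓc.eventually_forall_of_forall_eventually fun y hy => ?_
    obtain ⟨φ, hφ⟩ := hΩ.exists_defining' ht hy
    obtain ⟨x, hx0, hxd, hφx⟩ := ((hφ.frequently_pos hy).and_eventually
      ((Metric.isOpen_ball.eventually_mem (Metric.mem_ball_self hρ0)).and
        ((show ContinuousAt (fun x => (t, x)) y by fun_prop).eventually hφ.eventually))).exists
    have hxcl : x ∉ closure (Ω t) := by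
      intro hc
      by_cases hxΩ : x ∈ Ω t
      · exact absurd (hφx.mem_iff_self.1 hxΩ) (not_lt.2 hx0.le)
      · exact hx0.ne' (hφx.mem_frontier_iff.1 (by rw [hop.frontier_eq]; exact ⟨hc, hxΩ⟩))
    have h1 : ∀ᶠ σ in 𝓝 t, x ∉ closure (Ω σ) :=
      (show ContinuousAt (fun σ => (σ, x)) t by fun_prop).eventually
        (hΩ.eventually_notMem_closure hI ht hxcl)
    have h2 : ∀ᶠ z in 𝓝 y, dist x z < ρ :=
      (continuous_const.dist continuous_id).continuousAt.eventually_lt continuousAt_const hxd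
    filter_upwards [continuousAt_fst.eventually h1, continuousAt_snd.eventually h2] with p h1 h2
    exact ⟨x, h2, fun h' => h1 (subset_closure h')⟩
  obtain ⟨δ, hδ, hall⟩ := Metric.eventually_nhds_iff_ball.1
    ((hI.eventually_mem ht).and (hreg.and (hfarc.and (hnear.and hR))))
  have hfar : ∀ σ ∈ Metric.ball t δ, ∀ x, ρ ≤ Metric.infDist x Γ →
      x ∉ frontier (Ω σ) ∧ (x ∈ Ω σ ↔ x ∈ Ω t) := by
    intro σ hσ x hx
    obtain ⟨-, -, hf, -, hfR⟩ := hall σ hσ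
    rcases le_total ‖x‖ (R + 1) with hxR | hxR
    · exact hf x ⟨mem_closedBall_zero_iff.2 hxR, hx⟩
    · have hR1 : ∀ {U : Set (EuclideanSpace ℝ (Fin n))}, U ⊆ Metric.ball 0 R →
          U ⊆ Metric.ball 0 (R + 1) := fun hU => hU.trans (Metric.ball_subset_ball (by linarith))
      refine ⟨fun hxf => ?_, ?_⟩
      · have := mem_ball_zero_iff.1 (hfR hxf)
        linarith
      · rw [mem_iff_of_frontier_subset_ball (by linarith) (hR1 hfR) hxR,
          mem_iff_of_frontier_subset_ball (by linarith) (hR1 hΓR) hxR]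
        have hnorm : ‖((R + 1) / ‖x‖) • x‖ = R + 1 := by
          rw [norm_smul, norm_div, norm_norm, div_mul_cancel₀ _ (by linarith), Real.norm_eq_abs,
            abs_of_pos (by linarith)]
        refine (hf _ ⟨mem_closedBall_zero_iff.2 hnorm.le, ?_⟩).2
        refine (min_le_right _ _).trans ((Metric.le_infDist hne).2 fun y hy => ?_)
        have h1 := mem_ball_zero_iff.1 (hΓR hy)
        have h2 := norm_sub_norm_le (((R + 1) / ‖x‖) • x) y
        rw [dist_eq_norm]
        linarith
  exact ⟨ρ, δ, hδ, hρ0, hΓc, hne, hop, hΓ.symm, fun σ hσ => (hall σ hσ).1,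
    fun σ hσ x hx => ((hall σ hσ).2.1 x (hx.trans_le hρε)).1,
    fun σ hσ x hx => ((hall σ hσ).2.1 x (hx.trans_le hρε)).2.1,
    fun σ hσ x hx => ((hall σ hσ).2.1 x (hx.trans_le hρε)).2.2.1,
    fun x hx => ((hall t (Metric.mem_ball_self hδ)).2.1 x (hx.trans_le hρε)).2.2.2,
    fun σ hσ x hx => (hfar σ hσ x hx).1, fun σ hσ x hx => (hfar σ hσ x hx).2,
    fun σ hσ => (hall σ hσ).2.2.2.1⟩

end Collar
end


/-! ### Continuation over a short time. -/

noncomputable section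
section Continuation

open scoped Laplacian ContDiff

variable {n : ℕ} {I J : Set ℝ} {Ω : ℝ → Set (EuclideanSpace ℝ (Fin n))}
  {w P H : ℝ → EuclideanSpace ℝ (Fin n) → ℝ} {x x₀ : EuclideanSpace ℝ (Fin n)} {Q ρ a b : ℝ}
  {A U Γ : Set (EuclideanSpace ℝ (Fin n))} {F : EuclideanSpace ℝ (Fin n) → ℝ}

namespace IsCollar

theorem mem_of_mem_closure (hc : IsCollar Ω w P A J I U Γ ρ) (hx : x ∈ closure U)
    (hxρ : ρ ≤ Metric.infDist x Γ) : x ∈ U := by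
  by_contra hxU
  have hxΓ : x ∈ Γ := by rw [← hc.frontier_eq, hc.isOpen.frontier_eq]; exact ⟨hx, hxU⟩
  rw [Metric.infDist_zero_of_mem hxΓ] at hxρ
  exact absurd hc.pos (not_lt.2 hxρ)

/-- Removing the points close to Γ = ∂U makes the open set U closed; this truncated domain is where
the maximum principle is applied. -/
theorem isClosed_inter (hc : IsCollar Ω w P A J I U Γ ρ) :
    IsClosed (U ∩ {x | ρ ≤ Metric.infDist x Γ}) := by
  have : U ∩ {x | ρ ≤ Metric.infDist x Γ} = closure U ∩ {x | ρ ≤ Metric.infDist x Γ} := by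
    ext x
    exact ⟨fun hx => ⟨subset_closure hx.1, hx.2⟩, fun hx => ⟨hc.mem_of_mem_closure hx.1 hx.2, hx.2⟩⟩
  rw [this]
  exact isClosed_closure.inter (isClosed_le continuous_const (Metric.continuous_infDist_pt Γ))

theorem isOpen_inter (hc : IsCollar Ω w P A J I U Γ ρ) :
    IsOpen (U ∩ {x | ρ < Metric.infDist x Γ}) :=
  hc.isOpen.inter (isOpen_lt continuous_const (Metric.continuous_infDist_pt Γ))

/-- A harmonic continuation agrees with the Schwarz potential in the whole collar. -/
theorem continuation_eq [NeZero n] (hc : IsCollar Ω w P A J I U Γ ρ) (ha : a ∈ J)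
    (hΩ : IsOpen (Ω a)) (hF : IsHarmonicContinuation (Ω a) A (w a) F) (hx : x ∈ Ω a)
    (hxρ : Metric.infDist x Γ < 2 * ρ) : F x = w a x := by
  obtain ⟨y, hy, hxy⟩ := (Metric.infDist_lt_iff hc.nonempty).1 hxρ
  obtain ⟨z, hzy, hz⟩ := hc.exists_notMem a ha y hy
  obtain ⟨z', hz', hd, hd0, hsub⟩ := exists_frontier_ball_subset hΩ hx hz
  -- x is within 2ρ of y and z within ρ of y, so B has radius below 3ρ and lies in the 5ρ collar. B
  -- touches the boundary of Ω a at z', near which F and w a agree; the identity theorem carries the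
  -- equality to the centre x.
  set B := Metric.ball x (dist x z') with hB
  have hBρ : ∀ p ∈ B, Metric.infDist p Γ < 5 * ρ := fun p hp => by
    have h1 : dist p x < dist x z' := hp
    have h2 := dist_triangle x y z
    have h3 := dist_comm z y
    have h4 := Metric.infDist_le_infDist_add_dist (s := Γ) (x := p) (y := x)
    linarith
  have hq : HarmonicOnNhd (F - w a) B := fun p hp =>
    (hF.1 p ⟨hsub hp, hc.notMem p (hBρ p hp)⟩).sub (hc.harmonicAt a ha p (hBρ p hp))
  have hzB : z' ∈ closure B := by
    rw [closure_ball x hd0.ne', Metric.mem_closedBall, dist_comm]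
  have hev : ∀ᶠ p in 𝓝 z', p ∈ Ω a → F p = w a p := eventually_nhdsWithin_iff.1 (hF.2 z' hz')
  obtain ⟨p, hpB, hp⟩ := ((mem_closure_iff_frequently.1 hzB).and_eventually
    hev.eventually_nhds).exists
  have h0 : F - w a =ᶠ[𝓝 p] 0 := by
    filter_upwards [hp, hΩ.mem_nhds (hsub hpB)] with q hq hqΩ
    simp [hq hqΩ]
  have := (hq.eventuallyEq_zero_of_isPreconnected Metric.isPreconnected_ball hpB h0
    (Metric.mem_ball_self hd0)).self_of_nhds
  simpa [sub_eq_zero] using this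

/-- The regular part of the pressure is controlled by its values on the inner edge of the
collar. -/
theorem abs_sub_le (hn : 2 ≤ n) (hc : IsCollar Ω w P A J I U Γ ρ)
    (hP : IsPressure I Ω x₀ Q P) (hH : ∀ σ ∈ J, HarmonicOnNhd (H σ) (Ω σ))
    (hHP : ∀ σ ∈ J, ∀ x ≠ x₀, H σ x = P σ x + Q * fundamentalSolution n (x - x₀))
    (ha : a ∈ J) (hb : b ∈ J) {m : ℝ} (hm0 : 0 ≤ m)
    (hm : ∀ x ∈ U, Metric.infDist x Γ = ρ → |H a x - H b x| ≤ m) :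
    ∀ x ∈ U, ρ ≤ Metric.infDist x Γ → |H a x - H b x| ≤ m := by
  obtain ⟨y, hy⟩ := hc.nonempty
  have hharm : ∀ x ∈ U ∩ {x | ρ ≤ Metric.infDist x Γ}, HarmonicAt (H a - H b) x := fun x hx =>
    (hH a ha x ((hc.mem_iff a ha x hx.2).2 hx.1)).sub (hH b hb x ((hc.mem_iff b hb x hx.2).2 hx.1))
  have hle : ∀ σ ∈ J, Bornology.cobounded (EuclideanSpace ℝ (Fin n)) ⊓
      𝓟 (U ∩ {x | ρ ≤ Metric.infDist x Γ}) ≤ Bornology.cobounded _ ⊓ 𝓟 (Ω σ) := fun σ hσ =>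
    inf_le_inf_left _ (principal_mono.2 fun x hx => (hc.mem_iff σ hσ x hx.2).2 hx.1)
  have hinf : (H a - H b) =O[Bornology.cobounded (EuclideanSpace ℝ (Fin n)) ⊓
      𝓟 (U ∩ {x | ρ ≤ Metric.infDist x Γ})] fun x => (‖x‖ ^ (n - 2))⁻¹ := by
    have h1 := ((hP.infinity a (hc.subset ha)).mono (hle a ha)).sub
      ((hP.infinity b (hc.subset hb)).mono (hle b hb))
    refine h1.congr' ?_ EventuallyEq.rfl
    have h2 : ∀ᶠ x in Bornology.cobounded (EuclideanSpace ℝ (Fin n)), x ≠ x₀ :=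
      Bornology.isBounded_def.1 (Bornology.isBounded_singleton (x := x₀))
    filter_upwards [h2.filter_mono inf_le_left] with x hx
    simp [hHP a ha x hx, hHP b hb x hx]
  intro x hx hxρ
  refine abs_le_of_harmonic_of_isBigO (u := H a - H b) (S := {x | Metric.infDist x Γ = ρ}) hn
    hc.isClosed_inter
    (fun z hz => (hharm z hz).1.continuousAt.continuousWithinAt) (fun z hz hzρ => ⟨hharm z hz, ?_⟩)
    hm0 (fun z hz hzρ => hm z hz.1 hzρ) (a := y) hc.pos
    (fun z hz => le_trans hz.2 (Metric.infDist_le_dist_of_mem hy)) hinf x ⟨hx, hxρ⟩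
  exact mem_of_superset (hc.isOpen_inter.mem_nhds ⟨hz.1, lt_of_le_of_ne hz.2 (Ne.symm hzρ)⟩)
    fun p hp => ⟨hp.1, le_of_lt (show ρ < Metric.infDist p Γ from hp.2)⟩

/-- In the collar the pressure is known through ∂w/∂t. This is the only source of regularity in time
for H, since nothing is assumed about how P depends on time. -/
theorem regular_part_eq (hc : IsCollar Ω w P A J I U Γ ρ) (hn : 2 ≤ n) (hx₀ : x₀ ∈ A)
    (hHP : ∀ σ ∈ J, ∀ x ≠ x₀, H σ x = P σ x + Q * fundamentalSolution n (x - x₀)) {σ : ℝ}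
    (hσ : σ ∈ J) (hx : x ∈ U) (hxρ : ρ ≤ Metric.infDist x Γ) (hx5 : Metric.infDist x Γ < 5 * ρ) :
    H σ x = -(n : ℝ)⁻¹ * timeDeriv w σ x + Q * fundamentalSolution n (x - x₀) := by
  have hn0 : (n : ℝ) ≠ 0 := by positivity
  rw [hc.timeDeriv_eq σ hσ x hx5 (subset_closure ((hc.mem_iff σ hσ x hxρ).2 hx)),
    hHP σ hσ x fun h => hc.notMem x hx5 (h ▸ hx₀)]
  field_simp

/-- On the compact inner edge infDist = ρ, `regular_part_eq` makes H uniformly continuous in time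
because ∂w/∂t is continuous. The maximum principle carries the bound into the domain, and spatial
continuity of a single H σ₀ does the rest. -/
theorem continuousOn_regular_part (hn : 2 ≤ n) (hc : IsCollar Ω w P A J I U Γ ρ) (hJ : IsOpen J)
    (hP : IsPressure I Ω x₀ Q P) (hx₀ : x₀ ∈ A) (hH : ∀ σ ∈ J, HarmonicOnNhd (H σ) (Ω σ))
    (hHP : ∀ σ ∈ J, ∀ x ≠ x₀, H σ x = P σ x + Q * fundamentalSolution n (x - x₀)) :
    ContinuousOn (fun p : ℝ × EuclideanSpace ℝ (Fin n) => H p.1 p.2)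
      (J ×ˢ (U ∩ {x | ρ < Metric.infDist x Γ})) := by
  rintro ⟨σ₀, z⟩ ⟨hσ₀, hzU, hzρ⟩
  refine ContinuousAt.continuousWithinAt ?_
  have hn0 : (0 : ℝ) < n := by positivity
  have hS : IsCompact {x | Metric.infDist x Γ = ρ} := by
    refine (hc.isCompact.cthickening (r := ρ)).of_isClosed_subset
      (isClosed_eq (Metric.continuous_infDist_pt Γ) continuous_const) fun x hx => ?_
    rw [hc.isCompact.cthickening_eq_biUnion_closedBall hc.pos.le]
    obtain ⟨y, hy, hxy⟩ := hc.isCompact.exists_infDist_eq_dist hc.nonempty x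
    have hx' : Metric.infDist x Γ = ρ := hx
    exact mem_biUnion hy (Metric.mem_closedBall.2 (by rw [← hxy, hx']))
  have hzc : ContinuousAt (H σ₀) z :=
    (hH σ₀ hσ₀ z ((hc.mem_iff σ₀ hσ₀ z hzρ.le).2 hzU)).1.continuousAt
  rw [Metric.continuousAt_iff']
  intro ε hε
  have hWe : ∀ᶠ σ in 𝓝 σ₀, ∀ x ∈ {x | Metric.infDist x Γ = ρ},
      |timeDeriv w σ x - timeDeriv w σ₀ x| < n * (ε / 2) := by
    refine hS.eventually_forall_of_forall_eventually fun x hx => ?_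
    have hx5 : Metric.infDist x Γ < 5 * ρ := by
      have := hc.pos
      rw [show Metric.infDist x Γ = ρ from hx]; linarith
    have h1 : ContinuousAt (fun p : ℝ × EuclideanSpace ℝ (Fin n) => timeDeriv w p.1 p.2) (σ₀, x) :=
      (contDiffAt_timeDeriv (hc.contDiffAt σ₀ hσ₀ x hx5)).continuousAt
    have h2 : ContinuousAt (fun p : ℝ × EuclideanSpace ℝ (Fin n) => timeDeriv w σ₀ p.2) (σ₀, x) :=
      ContinuousAt.comp (g := fun p : ℝ × EuclideanSpace ℝ (Fin n) => timeDeriv w p.1 p.2)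
        (f := fun p : ℝ × EuclideanSpace ℝ (Fin n) => (σ₀, p.2)) (x := (σ₀, x)) h1 (by fun_prop)
    refine (h1.sub h2).abs.eventually_lt continuousAt_const ?_
    change |timeDeriv w σ₀ x - timeDeriv w σ₀ x| < n * (ε / 2)
    rw [sub_self, abs_zero]
    positivity
  have hmem : ∀ᶠ x in 𝓝 z, x ∈ U ∩ {x | ρ < Metric.infDist x Γ} :=
    hc.isOpen_inter.mem_nhds ⟨hzU, hzρ⟩
  filter_upwards [continuousAt_fst.eventually (hWe.and (hJ.mem_nhds hσ₀)),
    continuousAt_snd.eventually (hmem.and (Metric.continuousAt_iff'.1 hzc (ε / 2) (half_pos hε)))]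
    with p hp1 hp2
  have h1 : |H p.1 p.2 - H σ₀ p.2| ≤ ε / 2 := by
    refine hc.abs_sub_le hn hP hH hHP hp1.2 hσ₀ (by positivity) (fun x hx hxρ => ?_) p.2
      hp2.1.1 (le_of_lt hp2.1.2)
    have hx5 : Metric.infDist x Γ < 5 * ρ := by
      have := hc.pos
      rw [hxρ]; linarith
    rw [hc.regular_part_eq hn hx₀ hHP hp1.2 hx hxρ.ge hx5,
      hc.regular_part_eq hn hx₀ hHP hσ₀ hx hxρ.ge hx5]
    have h3 := (hp1.1 x hxρ).le
    rw [show ∀ u v k : ℝ, -(n : ℝ)⁻¹ * u + k - (-(n : ℝ)⁻¹ * v + k) = -((n : ℝ)⁻¹ * (u - v)) by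
      intros; ring, abs_neg, abs_mul, abs_of_pos (inv_pos.2 hn0), inv_mul_le_iff₀ hn0]
    exact h3
  have h2 := hp2.2
  rw [Real.dist_eq] at h2 ⊢
  calc |H p.1 p.2 - H σ₀ z| ≤ |H p.1 p.2 - H σ₀ p.2| + |H σ₀ p.2 - H σ₀ z| := _root_.abs_sub_le _ _ _
    _ < ε := by linarith

/-- The evolution equation integrated in time in the inner part of the collar, with the pole at the
sink separated off; the right side makes sense far beyond the collar. -/
theorem sub_eq_integral (hn : 2 ≤ n) (hc : IsCollar Ω w P A J I U Γ ρ) (hx₀ : x₀ ∈ A)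
    (hHP : ∀ σ ∈ J, ∀ x ≠ x₀, H σ x = P σ x + Q * fundamentalSolution n (x - x₀))
    (hab : uIcc a b ⊆ J) (hx : x ∈ U) (hxρ : ρ ≤ Metric.infDist x Γ)
    (hx5 : Metric.infDist x Γ < 5 * ρ) :
    w b x - w a x = -(n : ℝ) * (∫ σ in a..b, H σ x) +
      n * Q * (b - a) * fundamentalSolution n (x - x₀) := by
  have hn0 : (n : ℝ) ≠ 0 := by positivity
  have hcont : ContinuousOn (fun σ => timeDeriv w σ x) (uIcc a b) := fun σ hσ =>
    (ContinuousAt.comp (f := fun σ => (σ, x))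
      (contDiffAt_timeDeriv (hc.contDiffAt σ (hab hσ) x hx5)).continuousAt
      (by fun_prop)).continuousWithinAt
  rw [← intervalIntegral.integral_eq_sub_of_hasDerivAt
    (fun σ hσ => hasDerivAt_timeDeriv (hc.contDiffAt σ (hab hσ) x hx5)) hcont.intervalIntegrable,
    intervalIntegral.integral_congr fun σ hσ =>
      hc.regular_part_eq hn hx₀ hHP (hab hσ) hx hxρ hx5,
    intervalIntegral.integral_add (hcont.intervalIntegrable.const_mul _)
      intervalIntegrable_const, intervalIntegral.integral_const_mul,
    intervalIntegral.integral_const, smul_eq_mul]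
  field_simp
  ring

/-- The singularities of the Schwarz potential do not move in a short time. -/
theorem exists_continuation (hn : 2 ≤ n) (hc : IsCollar Ω w P A J I U Γ ρ) (hJ : IsOpen J)
    (hP : IsPressure I Ω x₀ Q P) (hQ : Q ≠ 0) (hx₀ : x₀ ∈ A) (hΩ : ∀ σ ∈ J, IsOpen (Ω σ))
    (hab : uIcc a b ⊆ J) (hF : IsHarmonicContinuation (Ω a) A (w a) F) :
    ∃ G, IsHarmonicContinuation (Ω b) A (w b) G ∧ ∃ h, HarmonicOnNhd h (Ω a ∩ Ω b) ∧
      ∀ x ∈ (Ω a ∩ Ω b) \ A,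
        G x = F x + n * Q * (b - a) * fundamentalSolution n (x - x₀) + h x := by
  have : NeZero n := ⟨by omega⟩
  have ha : a ∈ J := hab left_mem_uIcc
  have hb : b ∈ J := hab right_mem_uIcc
  have hρ := hc.pos
  choose! H hH hHP using fun σ (hσ : σ ∈ J) =>
    hP.exists_regular_part hn hQ (hc.subset hσ) (hΩ σ hσ)
  set K := fun x => (n : ℝ) * Q * (b - a) * fundamentalSolution n (x - x₀) with hK
  -- The change of w over the time step apart from its pole, defined on the whole inner region.
  set h₀ : EuclideanSpace ℝ (Fin n) → ℝ := fun x => -(n : ℝ) * ∫ σ in a..b, H σ x with hh₀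
  have hh₀harm : HarmonicOnNhd h₀ (U ∩ {x | ρ < Metric.infDist x Γ}) := fun x hx =>
    (harmonicOnNhd_intervalIntegral hc.isOpen_inter
      ((hc.continuousOn_regular_part hn hJ hP hx₀ hH hHP).mono (prod_mono hab Subset.rfl))
      (fun σ hσ z hz => hH σ (hab hσ) z ((hc.mem_iff σ (hab hσ) z (le_of_lt hz.2)).2 hz.1))
      x hx).const_smul (c := -(n : ℝ))
  have hKharm : ∀ x ≠ x₀, HarmonicAt K x := fun x hx =>
    (harmonicAt_comp_sub_right (harmonicAt_fundamentalSolution hn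
      (sub_ne_zero.2 hx))).const_smul (c := (n : ℝ) * Q * (b - a))
  have hover : ∀ x ∈ U, ρ ≤ Metric.infDist x Γ → Metric.infDist x Γ < 5 * ρ →
      w b x - w a x = h₀ x + K x := fun x hx h1 h2 => hc.sub_eq_integral hn hx₀ hHP hab hx h1 h2
  have hnear : ∀ x, Metric.infDist x Γ ≤ ρ → ∀ᶠ z in 𝓝 x, Metric.infDist z Γ < 2 * ρ :=
    fun x hx => (Metric.continuous_infDist_pt Γ).continuousAt.eventually_lt continuousAt_const
      (by linarith)
  have hfar : ∀ x, ρ < Metric.infDist x Γ → ∀ᶠ z in 𝓝 x, ρ < Metric.infDist z Γ :=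
    fun x hx => continuousAt_const.eventually_lt (Metric.continuous_infDist_pt Γ).continuousAt hx
  have hne : ∀ x, Metric.infDist x Γ ≤ ρ → x ≠ x₀ := fun x hx h =>
    hc.notMem x (by linarith) (h ▸ hx₀)
  classical
  -- Two formulas for each of h and G: the integral inside, the potentials in the collar. By `hover`
  -- and `continuation_eq` they agree for ρ < infDist < 2ρ, so harmonicity survives the seam at
  -- infDist = ρ.
  set h : EuclideanSpace ℝ (Fin n) → ℝ := fun x =>
    if ρ < Metric.infDist x Γ then h₀ x else w b x - w a x - K x with hh
  set G : EuclideanSpace ℝ (Fin n) → ℝ := fun x =>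
    if ρ < Metric.infDist x Γ then F x + K x + h₀ x else w b x with hG
  have hGw : ∀ x ∈ Ω b, Metric.infDist x Γ < 2 * ρ → G x = w b x := fun x hx hxρ => by
    by_cases hx' : ρ < Metric.infDist x Γ
    · have hxU := (hc.mem_iff b hb x hx'.le).1 hx
      have h1 := hover x hxU hx'.le (by linarith)
      have h2 := hc.continuation_eq ha (hΩ a ha) hF ((hc.mem_iff a ha x hx'.le).2 hxU) hxρ
      simp only [hG, if_pos hx']
      linarith
    · simp only [hG, if_neg hx']
  refine ⟨G, ⟨fun x hx => ?_, fun y hy => ?_⟩, h, fun x hx => ?_, fun x hx => ?_⟩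
  · rcases lt_or_ge ρ (Metric.infDist x Γ) with hx' | hx'
    · have hxU := (hc.mem_iff b hb x hx'.le).1 hx.1
      have heq : G =ᶠ[𝓝 x] F + K + h₀ := by
        filter_upwards [hfar x hx'] with z hz
        simp [hG, if_pos hz]
      rw [harmonicAt_congr_nhds heq]
      exact ((hF.1 x ⟨(hc.mem_iff a ha x hx'.le).2 hxU, hx.2⟩).add
        (hKharm x fun h => hx.2 (h ▸ hx₀))).add (hh₀harm x ⟨hxU, hx'⟩)
    · have heq : G =ᶠ[𝓝 x] w b := by
        filter_upwards [hnear x hx', (hΩ b hb).mem_nhds hx.1] with z hz hzΩ using hGw z hzΩ hz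
      rw [harmonicAt_congr_nhds heq]
      exact hc.harmonicAt b hb x (by linarith)
  · have hyρ : Metric.infDist y Γ < ρ := by
      by_contra! hcon
      exact hc.notMem_frontier b hb y hcon hy
    filter_upwards [self_mem_nhdsWithin, (hnear y hyρ.le).filter_mono nhdsWithin_le_nhds]
      with z hz hz' using hGw z hz hz'
  · rcases lt_or_ge ρ (Metric.infDist x Γ) with hx' | hx'
    · have heq : h =ᶠ[𝓝 x] h₀ := by
        filter_upwards [hfar x hx'] with z hz
        simp [hh, if_pos hz]
      rw [harmonicAt_congr_nhds heq]
      exact hh₀harm x ⟨(hc.mem_iff b hb x hx'.le).1 hx.2, hx'⟩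
    · have heq : h =ᶠ[𝓝 x] w b - w a - K := by
        filter_upwards [hnear x hx', (hΩ b hb).mem_nhds hx.2] with z hz hzΩ
        by_cases hz' : ρ < Metric.infDist z Γ
        · have h1 := hover z ((hc.mem_iff b hb z hz'.le).1 hzΩ) hz'.le (by linarith)
          simp only [hh, if_pos hz', Pi.sub_apply]
          linarith
        · simp only [hh, if_neg hz', Pi.sub_apply]
      rw [harmonicAt_congr_nhds heq]
      exact ((hc.harmonicAt b hb x (by linarith)).sub (hc.harmonicAt a ha x (by linarith))).sub
        (hKharm x (hne x hx'))
  · rcases lt_or_ge ρ (Metric.infDist x Γ) with hx' | hx'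
    · simp only [hG, hh, if_pos hx', hK]
    · have h2 := hc.continuation_eq ha (hΩ a ha) hF hx.1.1 (by linarith)
      simp only [hG, hh, if_neg (not_lt.2 hx'), h2, hK]
      ring

end IsCollar

end Continuation
end


/-! ### From short times to arbitrary times. -/

noncomputable section
section Singularities

open scoped Laplacian ContDiff

variable {n : ℕ} {I : Set ℝ} {Ω : ℝ → Set (EuclideanSpace ℝ (Fin n))}
  {w P : ℝ → EuclideanSpace ℝ (Fin n) → ℝ} {s t : ℝ} {x₀ : EuclideanSpace ℝ (Fin n)} {Q : ℝ}
  {A : Set (EuclideanSpace ℝ (Fin n))}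

/-- If the boundary is empty at some time, then the domain is the whole space, and remains so. -/
theorem IsAnalyticFamily.eventually_eq_univ (hΩ : IsAnalyticFamily I Ω) (hI : IsOpen I)
    (ht : t ∈ I) (hbd : ∃ R : ℝ, ∀ᶠ τ in 𝓝 t, frontier (Ω τ) ⊆ Metric.ball 0 R)
    (he : frontier (Ω t) = ∅) : ∀ᶠ τ in 𝓝 t, Ω τ = univ := by
  obtain ⟨R, hR⟩ := hbd
  have huniv : Ω t = univ := (frontier_eq_empty_iff.1 he).resolve_left
    (hΩ.isConnected t ht).nonempty.ne_empty
  have hball : ∀ᶠ τ in 𝓝 t, ∀ x ∈ Metric.closedBall (0 : EuclideanSpace ℝ (Fin n)) R, x ∈ Ω τ :=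
    (isCompact_closedBall _ _).eventually_forall_of_forall_eventually fun x _ =>
      hΩ.eventually_mem ht (huniv ▸ mem_univ x)
  filter_upwards [hR, hball, hI.mem_nhds ht] with τ h1 h2 hτ
  refine (frontier_eq_empty_iff.1 (eq_empty_iff_forall_notMem.2 fun x hx => ?_)).resolve_left
    (hΩ.isConnected τ hτ).nonempty.ne_empty
  have h3 := h2 x (Metric.ball_subset_closedBall (h1 hx))
  rw [(hΩ.isOpen τ hτ).frontier_eq] at hx
  exact hx.2 h3

theorem SolvesLaplacianGrowth.exists_nhds_continuation (hn : 2 ≤ n) (hI : IsOpen I)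
    (hΩ : IsAnalyticFamily I Ω) (hw : IsSchwarzPotential I Ω w)
    (h : SolvesLaplacianGrowth I Ω x₀ Q P) (hQ : Q ≠ 0) (ht : t ∈ I)
    (hbd : ∃ R : ℝ, ∀ᶠ τ in 𝓝 t, frontier (Ω τ) ⊆ Metric.ball 0 R)
    (hA : IsClosed A) (hAΩ : A ⊆ Ω t) (hx₀ : x₀ ∈ A) :
    ∃ δ > 0, ∀ a ∈ Metric.ball t δ, ∀ b ∈ Metric.ball t δ,
      ∀ F, IsHarmonicContinuation (Ω a) A (w a) F →
        ∃ G, IsHarmonicContinuation (Ω b) A (w b) G ∧ ∃ k, HarmonicOnNhd k (Ω a ∩ Ω b) ∧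
          ∀ x ∈ (Ω a ∩ Ω b) \ A,
            G x = F x + n * Q * (b - a) * fundamentalSolution n (x - x₀) + k x := by
  rcases (frontier (Ω t)).eq_empty_or_nonempty with he | hne
  · obtain ⟨δ, hδ, hall⟩ := Metric.eventually_nhds_iff_ball.1
      (hΩ.eventually_eq_univ hI ht hbd he)
    refine ⟨δ, hδ, fun a ha b hb F hF => ?_⟩
    rw [hall a ha] at hF ⊢
    rw [hall b hb]
    -- Without boundary there is no potential to match: adding the change of the pole is enough,
    -- with zero harmonic remainder.
    refine ⟨F + fun x => n * Q * (b - a) * fundamentalSolution n (x - x₀), ⟨fun x hx => ?_, ?_⟩,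
      fun _ => 0, fun x _ => harmonicAt_const 0, fun x _ => by simp⟩
    · exact (hF.1 x hx).add ((harmonicAt_comp_sub_right (harmonicAt_fundamentalSolution hn
        (sub_ne_zero.2 (ne_of_mem_of_not_mem hx₀ hx.2).symm))).const_smul (c := (n : ℝ) * Q * (b - a)))
    · simp
  · obtain ⟨ρ, δ, hδ, hc⟩ := exists_isCollar hn hI hΩ hw h ht hbd hne hA hAΩ
    refine ⟨δ, hδ, fun a ha b hb F hF => ?_⟩
    refine hc.exists_continuation hn Metric.isOpen_ball h.pressure hQ hx₀
      (fun σ hσ => hΩ.isOpen σ (hc.subset hσ)) ?_ hF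
    rw [← segment_eq_uIcc]
    exact (convex_ball t δ).segment_subset ha hb

/-- Local steps are chained along the interval between s and t. The remainders are controlled only
on the set D common to all intermediate domains. D is an open neighbourhood of A, which suffices to
recover harmonicity on Ω s ∩ Ω t at the end. -/
theorem SolvesLaplacianGrowth.exists_continuation (hn : 2 ≤ n) (hI : IsOpen I)
    (hI' : I.OrdConnected) (hΩ : IsAnalyticFamily I Ω) (hw : IsSchwarzPotential I Ω w)
    (h : SolvesLaplacianGrowth I Ω x₀ Q P) (hQ : Q ≠ 0)
    (hbd : ∀ t ∈ I, ∃ R : ℝ, ∀ᶠ τ in 𝓝 t, frontier (Ω τ) ⊆ Metric.ball 0 R)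
    (hs : s ∈ I) (ht : t ∈ I) (hA : IsClosed A) (hAΩ : ∀ τ ∈ uIcc s t, A ⊆ Ω τ) (hx₀ : x₀ ∈ A)
    {F : EuclideanSpace ℝ (Fin n) → ℝ} (hF : IsHarmonicContinuation (Ω s) A (w s) F) :
    ∃ G, IsHarmonicContinuation (Ω t) A (w t) G ∧ ∃ k, HarmonicOnNhd k (Ω s ∩ Ω t) ∧
      ∀ x ∈ (Ω s ∩ Ω t) \ A,
        G x = F x + n * Q * (t - s) * fundamentalSolution n (x - x₀) + k x := by
  have hsub : uIcc s t ⊆ I := hI'.uIcc_subset hs ht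
  set D := {x | ∀ τ ∈ uIcc s t, x ∈ Ω τ} with hD
  have hDo : IsOpen D := isOpen_iff_mem_nhds.2 fun x hx =>
    isCompact_uIcc.eventually_forall_of_forall_eventually fun τ hτ =>
      (continuous_swap.tendsto (x, τ)).eventually (hΩ.eventually_mem (hsub hτ) (hx τ hτ))
  have hAD : A ⊆ D := fun x hx τ hτ => hAΩ τ hτ hx
  -- Induction on a connected set: the relation is transitive and holds locally in both directions
  -- of time, so it holds between any two times.
  obtain ⟨G, hG, k, hk, hGk⟩ := isPreconnected_uIcc.induction₂' (s := uIcc s t)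
    (fun a b => ∀ F, IsHarmonicContinuation (Ω a) A (w a) F →
      ∃ G, IsHarmonicContinuation (Ω b) A (w b) G ∧ ∃ k, HarmonicOnNhd k D ∧
        ∀ x ∈ D \ A, G x = F x + n * Q * (b - a) * fundamentalSolution n (x - x₀) + k x)
    (fun τ hτ => by
      obtain ⟨δ, hδ, hstep⟩ := h.exists_nhds_continuation hn hI hΩ hw hQ (hsub hτ)
        (hbd τ (hsub hτ)) hA (hAΩ τ hτ) hx₀
      have key : ∀ a ∈ Metric.ball τ δ, a ∈ uIcc s t → ∀ b ∈ Metric.ball τ δ, b ∈ uIcc s t →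
          ∀ F, IsHarmonicContinuation (Ω a) A (w a) F →
          ∃ G, IsHarmonicContinuation (Ω b) A (w b) G ∧ ∃ k, HarmonicOnNhd k D ∧
            ∀ x ∈ D \ A,
              G x = F x + n * Q * (b - a) * fundamentalSolution n (x - x₀) + k x := by
        intro a ha ha' b hb hb' F hF
        obtain ⟨G, hG, k, hk, hGk⟩ := hstep a ha b hb F hF
        have hDab : D ⊆ Ω a ∩ Ω b := fun x hx => ⟨hx a ha', hx b hb'⟩
        exact ⟨G, hG, k, fun x hx => hk x (hDab hx), fun x hx => hGk x ⟨hDab hx.1, hx.2⟩⟩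
      filter_upwards [self_mem_nhdsWithin, mem_nhdsWithin_of_mem_nhds (Metric.ball_mem_nhds τ hδ)]
        with b hb hb'
      have hτδ := Metric.mem_ball_self (x := τ) hδ
      exact ⟨key τ hτδ hτ b hb' hb, key b hb' hb τ hτδ hτ⟩)
    (fun a b c _ _ _ hab hbc F hF => by
      obtain ⟨G, hG, k, hk, hGk⟩ := hab F hF
      obtain ⟨G', hG', k', hk', hGk'⟩ := hbc G hG
      refine ⟨G', hG', k + k', hk.add hk', fun x hx => ?_⟩
      rw [hGk' x hx, hGk x hx, Pi.add_apply]
      ring)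
    left_mem_uIcc right_mem_uIcc F hF
  classical
  -- Off A the remainder is forced by the formula and is harmonic because G, F and K are. Near A it
  -- coincides with k, harmonic on D.
  refine ⟨G, hG, fun x => if x ∈ A then k x else
    G x - F x - n * Q * (t - s) * fundamentalSolution n (x - x₀), fun x hx => ?_, fun x hx => ?_⟩
  · by_cases hxA : x ∈ A
    · refine (harmonicAt_congr_nhds ?_).2 (hk x (hAD hxA))
      filter_upwards [hDo.mem_nhds (hAD hxA)] with z hz
      split_ifs with hzA
      · rfl
      · rw [hGk z ⟨hz, hzA⟩]; ring
    · refine (harmonicAt_congr_nhds ?_).2 (((hG.1 x ⟨hx.2, hxA⟩).sub (hF.1 x ⟨hx.1, hxA⟩)).sub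
        ((harmonicAt_comp_sub_right (harmonicAt_fundamentalSolution hn (sub_ne_zero.2
          (ne_of_mem_of_not_mem hx₀ hxA).symm))).const_smul (c := (n : ℝ) * Q * (t - s))))
      filter_upwards [hA.isOpen_compl.mem_nhds hxA] with z hz
      rw [if_neg hz]
      rfl
  · simp only [if_neg hx.2]
    ring

end Singularities
end

/-! ### The theorem. -/

theorem theorem2 (n : ℕ) (hn : 2 ≤ n) (I : Set ℝ) (hI : IsOpen I) (hI' : I.OrdConnected)
    (Ω : ℝ → Set (EuclideanSpace ℝ (Fin n))) (hΩ : IsAnalyticFamily I Ω)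
    (w : ℝ → EuclideanSpace ℝ (Fin n) → ℝ) (hw : IsSchwarzPotential I Ω w)
    (x₀ : EuclideanSpace ℝ (Fin n)) (Q : ℝ) (hQ : Q ≠ 0)
    (P : ℝ → EuclideanSpace ℝ (Fin n) → ℝ) (hP : IsPressure I Ω x₀ Q P) :
    -- Laplacian growth is equivalent to `∂w/∂t = -nP` near the moving boundary
    (SolvesLaplacianGrowth I Ω x₀ Q P ↔
      ∀ t ∈ I, ∀ y ∈ frontier (Ω t), ∀ᶠ p in 𝓝 (t, y), p.2 ∈ closure (Ω p.1) →
        HasDerivAt (fun τ => w τ p.2) (-(n : ℝ) * P p.1 p.2) p.1) ∧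
    -- for compact boundaries, the singularities of `w` do not move, except that the one at the
    -- sink changes strength
    (SolvesLaplacianGrowth I Ω x₀ Q P →
      (∀ t ∈ I, ∃ R : ℝ, ∀ᶠ τ in 𝓝 t, frontier (Ω τ) ⊆ Metric.ball 0 R) →
      ∀ s ∈ I, ∀ t ∈ I, ∀ S : Set (EuclideanSpace ℝ (Fin n)), IsClosed S →
        (∀ τ ∈ uIcc s t, S ⊆ Ω τ) →
        ∀ F, IsHarmonicContinuation (Ω s) (S ∪ {x₀}) (w s) F →
          ∃ G, IsHarmonicContinuation (Ω t) (S ∪ {x₀}) (w t) G ∧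
            ∃ h, HarmonicOnNhd h (Ω s ∩ Ω t) ∧
              ∀ x ∈ (Ω s ∩ Ω t) \ (S ∪ {x₀}),
                G x = F x + n * Q * (t - s) * fundamentalSolution n (x - x₀) + h x) := by
  refine ⟨⟨fun h t ht y hy => h.eventually_hasDerivAt hn hI hΩ hw ht hy,
    solvesLaplacianGrowth_of_hasDerivAt hn hI hΩ hw hP⟩, ?_⟩
  intro h hbd s hs t ht S hS hSΩ F hF
  -- The sink is adjoined to S: a closed set contained in every intermediate domain is all that the
  -- continuation argument requires.
  exact h.exists_continuation hn hI hI' hΩ hw hQ hbd hs ht (hS.union isClosed_singleton)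
    (fun τ hτ => union_subset (hSΩ τ hτ)
      (singleton_subset_iff.2 (hP.sink_mem τ (hI'.uIcc_subset hs ht hτ)))) (by simp) hF
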